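/- **Setting.** Let $(M,d)$ be a metric space of diameter at most $D>0$, $s_0\in M$, and let $\ell\ge 1$, $m\ge 2$. An input is a sequence of cost functions $c_1,\dots,c_T\colon M\to[0,\infty]$ ($T$ arbitrary) such that each $c_t$ vanishes at some state and $\operatorname{argmin}_s(d(b,s)+c_t(s))$ exists for every $b\in M$. A solution $s_1,\dots,s_T$ costs $\sum_{t=1}^T \big(c_t(s_t)+d(s_{t-1},s_t)\big)$; $\mathrm{OFF}$ is the infimum of this cost over all solutions. The heuristics $H_1,\dots,H_\ell$ are (possibly randomized, arbitrarily correlated) online algorithms starting in $s_0$, with state $s_t^i$ and cost $f_t(i)=c_t(s_t^i)+d(s_{t-1}^i,s_t^i)\le 2D$ in round $t$, and $\mathrm{OPT}_{\le 0}=\min_i\sum_{t=1}^T f_t(i)$. $H_i$ is *$R$-competitive with high probability* if for every $\beta\ge1$ there is a constant $\alpha$ such that on every input its cost exceeds $R\cdot\mathrm{OFF}+\alpha$ with probability at most $(2+\mathrm{OFF})^{-\beta}$. In each round one heuristic is queried, and a query of $H_i$ reveals $s^i_t$ only if $H_i$ was queried in all of the rounds $t-m+2,\dots,t$. **The algorithm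 $\mathrm{ALG}(\omega)$.** Put $\epsilon(\omega)=(D\ell\ln\ell)^{1/3}m^{-4/3}\omega^{-1/3}$, $\gamma(\omega)=(D\ell\ln\ell)^{1/3}m^{2/3}\omega^{-1/3}$ and $\eta=-\ln(1-\gamma(\omega))$. It maintains the HEDGE distribution $x_t$ over the heuristics with learning rate $\eta$ (initially uniform) and an exploited heuristic $i_t$ (initially uniformly random). Its first round is an exploitation round. After an exploitation round $t$, with probability $1-\epsilon$ the next round is again an exploitation round; with probability $\epsilon$ a uniformly random heuristic $e$ is queried in the rounds $t+1,\dots,t+m$, in round $t+m$ HEDGE is fed the loss $f_{t+m}(e)/(2D)$ for $e$ and $0$ for the others, $i_{t+m+1}$ is obtained from $i_{t+m}$ by an optimal transport of $x_{t+m}$ to $x_{t+m+1}$ (with respect to the total variation distance), and round $t+m+1$ is an exploitation round. In exploitation rounds $i_t$ is queried. If $s_t^{i_t}$ is known from the queries, the algorithm moves there and sets $b_t=s_t^{i_t}$; otherwise it sets $b_t=b_{t-1}$ and makes the greedy step $s_t\in\operatorname{argmin}_s(d(b_t,s)+c_t(s))$, where $b$ is initially the starting position. **The doubling algorithm** with initial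 guess $\omega$ starts with $i=0$, $a_0=1$ and the instance $\mathrm{ALG}(\omega)$. Before each round $t$ it computes the offline optimum $\mathrm{OFF}_i$ of the rounds $a_i,\dots,t-1$ (with free initial state). If $\mathrm{OFF}_i>R\cdot2^i\omega$, it increases $i$ by one, sets $a_i=t$ and starts a new instance $\mathrm{ALG}(2^i\omega)$ from the current position. Then it makes the step of the current instance. **Proposition.** For all $D,\ell,m$ and every $\omega_0>0$ with $\gamma(\omega_0)<1$ there is a constant $C$ such that the following holds. Let $\omega\ge\omega_0$ and $R\ge 1$, and let $H_1,\dots,H_\ell$ be heuristics as above on a metric space of diameter at most $D$, at least one of which is $R$-competitive with high probability. Then for every $\beta\ge 1$ there is a constant $K$, independent of the input, such that on every input, with probability at least $1-(2+\mathrm{OFF})^{-\beta}$ over the random bits of the heuristics, the expected cost $\mathbb E[\mathrm{ALG}]$ of the doubling algorithm, the expectation being over its own random bits, satisfies $$\mathbb E[\mathrm{ALG}]-\mathrm{OPT}_{\le0}\;\le\; C\,R^{2/3}\,\mathrm{OPT}_{\le0}^{2/3}+K .$$ -/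

import Mathlib

open scoped ENNReal NNReal

noncomputable section

namespace MTS

/-! ### Metrical task systems -/

/-- A cost function on the states, with values in `[0, ∞]`. -/
abbrev CostFn (M : Type*) := M → ℝ≥0∞

/-- The admissible cost functions: some state has cost zero, and the greedy step
`argmin_s (d(b, s) + c(s))` exists for every `b` (the latter is automatic on a finite space). -/
def Admissible {M : Type*} [MetricSpace M] (c : CostFn M) : Prop :=
  (∃ s, c s = 0) ∧ ∀ b, ∃ s, ∀ s', edist b s + c s ≤ edist b s' + c s'

/-- Cost of the trajectory `s` in the rounds `a, …, b - 1` (rounds are numbered from `1`;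
`s 0` is the position before round `1`). -/
def pathCost {M : Type*} [MetricSpace M] (c : ℕ → CostFn M) (s : ℕ → M) (a b : ℕ) : ℝ≥0∞ :=
  ∑ t ∈ Finset.Ico a b, (c t (s t) + edist (s (t - 1)) (s t))

/-- `OFF`: the offline optimum of the rounds `1, …, T`, starting in `s₀`. -/
def offline {M : Type*} [MetricSpace M] (s₀ : M) (c : ℕ → CostFn M) (T : ℕ) : ℝ≥0∞ :=
  ⨅ (s : ℕ → M) (_ : s 0 = s₀), pathCost c s 1 (T + 1)

/-- The offline optimum of the interval of rounds `a, …, b - 1` alone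
(the position before round `a` is free). -/
def offlineOn {M : Type*} [MetricSpace M] (c : ℕ → CostFn M) (a b : ℕ) : ℝ≥0∞ :=
  ⨅ s : ℕ → M, pathCost c s a b

/-! ### Heuristics -/

/-- A (deterministic) online algorithm started in `s₀`: its state after a round is a function of
the cost functions revealed so far, the one of the current round included. -/
structure OnlineAlg (M : Type*) (s₀ : M) where
  state : List (CostFn M) → M
  state_nil : state [] = s₀

/-- The cost functions of the rounds `1, …, t`. -/
def history {M : Type*} (c : ℕ → CostFn M) (t : ℕ) : List (CostFn M) :=
  (List.range t).map fun k => c (k + 1)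

/-- The state of `A` after round `t`. -/
def OnlineAlg.traj {M : Type*} {s₀ : M} (A : OnlineAlg M s₀) (c : ℕ → CostFn M) (t : ℕ) : M :=
  A.state (history c t)

/-- `f_t`: the cost incurred by `A` in round `t ≥ 1`. -/
def OnlineAlg.stepCost {M : Type*} [MetricSpace M] {s₀ : M} (A : OnlineAlg M s₀)
    (c : ℕ → CostFn M) (t : ℕ) : ℝ≥0∞ :=
  c t (A.traj c t) + edist (A.traj c (t - 1)) (A.traj c t)

/-- The cost of `A` on the rounds `1, …, T`. -/
def OnlineAlg.totalCost {M : Type*} [MetricSpace M] {s₀ : M} (A : OnlineAlg M s₀)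
    (c : ℕ → CostFn M) (T : ℕ) : ℝ≥0∞ :=
  ∑ t ∈ Finset.Icc 1 T, A.stepCost c t

/-- `OPT_{≤ 0}`: the cost of the best of the heuristics. -/
def opt {M : Type*} [MetricSpace M] {s₀ : M} {ℓ : ℕ} (H : Fin ℓ → OnlineAlg M s₀)
    (c : ℕ → CostFn M) (T : ℕ) : ℝ≥0∞ :=
  ⨅ i, (H i).totalCost c T

/-- The randomized online algorithm `A` (a random variable on `(Ω, P)` with values in the
deterministic online algorithms) is `R`-competitive with high probability: for every `β ≥ 1` there
is a constant `α` such that, on every input, its cost exceeds `R * OFF + α` with probability at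
most `(2 + OFF) ^ (-β)`. -/
def CompetitiveWHP {M : Type*} [MetricSpace M] {s₀ : M} {Ω : Type*} [MeasurableSpace Ω]
    (P : MeasureTheory.Measure Ω) (A : Ω → OnlineAlg M s₀) (R : ℝ≥0) : Prop :=
  ∀ β : ℝ, 1 ≤ β → ∃ α : ℝ≥0, ∀ c : ℕ → CostFn M, (∀ t, Admissible (c t)) → ∀ T : ℕ,
    P {w | (R : ℝ≥0∞) * offline s₀ c T + α < (A w).totalCost c T}
      ≤ (2 + offline s₀ c T) ^ (-β)

/-! ### The algorithm `ALG(ω)` for `m`-delayed bandit access -/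

/-- The exploration rate `ε = (D ℓ ln ℓ)^{1/3} m^{-4/3} ω^{-1/3}`. -/
def epsParam (D : ℝ) (ℓ m : ℕ) (ω : ℝ) : ℝ :=
  (D * ℓ * Real.log ℓ) ^ (1 / 3 : ℝ) * (m : ℝ) ^ (-4 / 3 : ℝ) * ω ^ (-1 / 3 : ℝ)

/-- The parameter `γ = (D ℓ ln ℓ)^{1/3} m^{2/3} ω^{-1/3}`. -/
def gammaParam (D : ℝ) (ℓ m : ℕ) (ω : ℝ) : ℝ :=
  (D * ℓ * Real.log ℓ) ^ (1 / 3 : ℝ) * (m : ℝ) ^ (2 / 3 : ℝ) * ω ^ (-1 / 3 : ℝ)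

/-- The learning rate `η` of HEDGE, given by `γ = 1 - exp (-η)`. -/
def etaParam (D : ℝ) (ℓ m : ℕ) (ω : ℝ) : ℝ :=
  -Real.log (1 - gammaParam D ℓ m ω)

/-- The distribution proportional to the HEDGE weights `w`. -/
def hedgeDist {ℓ : ℕ} (w : Fin ℓ → ℝ≥0) (i : Fin ℓ) : ℝ≥0 :=
  w i / ∑ j, w j

/-- The HEDGE update of the weights for the loss vector `g`. -/
def hedgeUpdate {ℓ : ℕ} (η : ℝ) (g : Fin ℓ → ℝ) (w : Fin ℓ → ℝ≥0) (i : Fin ℓ) : ℝ≥0 :=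
  w i * (Real.exp (-η * g i)).toNNReal

/-- The distribution proportional to a nonzero nonnegative vector `v`; if `v = 0`,
the point mass at `i`. -/
def proportional {ℓ : ℕ} (i : Fin ℓ) (v : Fin ℓ → ℝ≥0) : PMF (Fin ℓ) :=
  open Classical in
  if h : ∃ j, v j ≠ 0 then
    PMF.normalize (fun j => (v j : ℝ≥0∞))
      (by
        obtain ⟨j, hj⟩ := h
        exact fun h0 => hj (by simpa using ENNReal.tsum_eq_zero.1 h0 j))
      (by
        rw [tsum_fintype]
        exact ENNReal.sum_ne_top.2 fun j _ => ENNReal.coe_ne_top)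
  else PMF.pure i

/-- A coin that shows `true` with probability `p` (with probability `1` if `p > 1`). -/
def coin (p : ℝ≥0) : PMF Bool :=
  PMF.ofFintype (fun b => if b then ((min 1 p : ℝ≥0) : ℝ≥0∞) else ((1 - min 1 p : ℝ≥0) : ℝ≥0∞))
    (by
      rw [Fintype.sum_bool]
      simp only [if_true, Bool.false_eq_true, if_false]
      rw [← ENNReal.coe_add, add_tsub_cancel_of_le (min_le_left 1 p), ENNReal.coe_one])

/-- The procedure Round: a step from `i ∼ x` to `j ∼ x'` according to an optimal transport plan `τ`
from `x` to `x'` for the discrete metric, that is, `j` has probability `τ i j / x i`.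
The plan is `τ i i = min (x i) (x' i)` and
`τ i j = (x i - x' i)⁺ (x' j - x j)⁺ / ∑ k, (x' k - x k)⁺` for `j ≠ i`
(subtraction in `ℝ≥0` is truncated at `0`). -/
def round {ℓ : ℕ} (x x' : Fin ℓ → ℝ≥0) (i : Fin ℓ) : PMF (Fin ℓ) :=
  (coin (min (x i) (x' i) / x i)).bind fun stay =>
    if stay then PMF.pure i else proportional i fun j => x' j - x j

/-- The greedy step `argmin_s (d(b, s) + c(s))`. -/
def greedy {M : Type*} [MetricSpace M] (c : CostFn M) (b : M) : M :=
  open Classical in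
  if h : ∃ s, ∀ s', edist b s + c s ≤ edist b s' + c s' then h.choose else b

/-- The memory of a running instance of the algorithm before a round. -/
structure AlgState (M : Type*) (ℓ : ℕ) where
  /-- the HEDGE weights -/
  weights : Fin ℓ → ℝ≥0
  /-- the exploited heuristic -/
  leader : Fin ℓ
  /-- `0` if the coming round is an exploitation round; otherwise, the exploration takes place
  `wait - 1` rounds after the coming one -/
  wait : ℕ
  /-- the explored heuristic (meaningful if `wait ≠ 0`) -/
  explored : Fin ℓ
  /-- the heuristic queried last -/
  lastQuery : Fin ℓ
  /-- the number of consecutive queries of `lastQuery` so far -/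
  run : ℕ
  /-- the state obtained by following the exploited heuristic for the last time -/
  base : M
  /-- the current position -/
  pos : M
  /-- the cost paid so far -/
  paid : ℝ≥0∞

/-- A new instance of the algorithm, started at the position `p` with cost `z` paid before. -/
def fresh {M : Type*} {ℓ : ℕ} [NeZero ℓ] (p : M) (z : ℝ≥0∞) : PMF (AlgState M ℓ) :=
  (PMF.uniformOfFintype (Fin ℓ)).map fun i =>
    { weights := fun _ => 1, leader := i, wait := 0, explored := i, lastQuery := i, run := 0,
      base := p, pos := p, paid := z }

/-- The moves of one round with cost function `c`, where `h i` is the state of the `i`-th heuristic.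
The algorithm queries the exploited heuristic in exploitation rounds and the explored one
in the `m` rounds up to an exploration. The state of the exploited heuristic is known if
this heuristic was queried in the last `m - 1` rounds, the present one included; then the algorithm
goes there, and otherwise it makes a greedy step from the last state known in this way. -/
def move {M : Type*} [MetricSpace M] {ℓ : ℕ} (m : ℕ) (c : CostFn M) (h : Fin ℓ → M)
    (σ : AlgState M ℓ) : AlgState M ℓ :=
  let q := if σ.wait = 0 then σ.leader else σ.explored
  let r := if q = σ.lastQuery then σ.run + 1 else 1
  let b := if q = σ.leader ∧ m ≤ r + 1 then h σ.leader else σ.base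
  let p := if q = σ.leader ∧ m ≤ r + 1 then h σ.leader else greedy c σ.base
  { σ with lastQuery := q, run := r, base := b, pos := p, paid := σ.paid + (c p + edist σ.pos p) }

/-- One round of the algorithm with exploration rate `ε` and learning rate `η`, where `h i` is the
state and `f i` the cost of the `i`-th heuristic in this round. After an exploitation round,
an exploration of a uniformly random heuristic is scheduled with probability `ε`;
it takes place `m` rounds later. In an exploration round the cost `f e` of the explored heuristic
`e` is fed to HEDGE (it is available, as `e` was queried `m` times in a row)
and the exploited heuristic is updated by Round. -/
def step {M : Type*} [MetricSpace M] {ℓ : ℕ} [NeZero ℓ] (D : ℝ) (m : ℕ) (ε η : ℝ)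
    (c : CostFn M) (h : Fin ℓ → M) (f : Fin ℓ → ℝ≥0∞) (σ : AlgState M ℓ) :
    PMF (AlgState M ℓ) :=
  let σ' := move m c h σ
  if σ.wait = 0 then
    (coin ε.toNNReal).bind fun explore =>
      if explore then
        (PMF.uniformOfFintype (Fin ℓ)).map fun e => { σ' with wait := m, explored := e }
      else PMF.pure σ'
  else if σ.wait = 1 then
    let g : Fin ℓ → ℝ := fun j => if j = σ.explored then (f j).toReal / (2 * D) else 0
    let w' := hedgeUpdate η g σ.weights
    (round (hedgeDist σ.weights) (hedgeDist w') σ.leader).map fun j =>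
      { σ' with wait := 0, weights := w', leader := j }
  else PMF.pure { σ' with wait := σ.wait - 1 }

/-! ### The doubling algorithm -/

/-- The index `i` of the instance running in round `t` of the doubling algorithm and its first
round `a_i`: before round `t`, if the offline optimum of the rounds `a_i, …, t - 1` exceeds
`R * 2 ^ i * ω`, instance `i` is replaced by instance `i + 1`. -/
def phase {M : Type*} [MetricSpace M] (R ω : ℝ≥0) (c : ℕ → CostFn M) : ℕ → ℕ × ℕ
  | 0 => (0, 1)
  | t + 1 =>
    open Classical in
    if (R : ℝ≥0∞) * 2 ^ (phase R ω c t).1 * ω < offlineOn c (phase R ω c t).2 (t + 1)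
    then ((phase R ω c t).1 + 1, t + 1)
    else phase R ω c t

/-- The law of the memory of the doubling algorithm after `t` rounds, when the heuristics are
`H`. Instance `i` is `ALG(2 ^ i * ω)`, started in the position reached by its predecessor. -/
def law {M : Type*} [MetricSpace M] {s₀ : M} {ℓ : ℕ} [NeZero ℓ] (D : ℝ) (m : ℕ) (R ω : ℝ≥0)
    (H : Fin ℓ → OnlineAlg M s₀) (c : ℕ → CostFn M) : ℕ → PMF (AlgState M ℓ)
  | 0 => fresh s₀ 0
  | t + 1 =>
    (law D m R ω H c t).bind fun σ =>
      (if (phase R ω c (t + 1)).2 = t + 1 then fresh σ.pos σ.paid else PMF.pure σ).bind fun σ' =>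
        step D m (epsParam D ℓ m (2 ^ (phase R ω c (t + 1)).1 * ω))
          (etaParam D ℓ m (2 ^ (phase R ω c (t + 1)).1 * ω))
          (c (t + 1)) (fun i => (H i).traj c (t + 1)) (fun i => (H i).stepCost c (t + 1)) σ'

/-- `E[ALG]`: the expected cost of the doubling algorithm on the rounds `1, …, T`. -/
def expectedCost {M : Type*} [MetricSpace M] {s₀ : M} {ℓ : ℕ} [NeZero ℓ] (D : ℝ) (m : ℕ)
    (R ω : ℝ≥0) (H : Fin ℓ → OnlineAlg M s₀) (c : ℕ → CostFn M) (T : ℕ) : ℝ≥0∞ :=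
  ∑' σ, law D m R ω H c T σ * σ.paid

end MTS

end

/-!
Fix the outcome of the heuristics. Within an instance `ALG(w)` the leader is distributed according
to HEDGE, because it moves by optimal transports, and HEDGE multiplies every probability by at least
`exp (-η)` per round. So up to a factor `1 + O(γ)` the current leader may be replaced by the one of
`m` rounds ago, and the losses sampled at rate `ε / ℓ` can be charged to HEDGE's regret bound. A
potential function (cost paid, plus distance from the base, plus a multiple of the distance from
the base to the leader) shows that the algorithm pays what the leaders pay, up to `O(1)` times their
cost in the rounds with a possible greedy step. These rounds have probability `O(ε)`, and `ε ≤ γ`.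
With the given `ε` and `γ`, an instance in which the best heuristic pays `x` has regret
`O(w ^ (-1 / 3) * x + w ^ (2 / 3))`.

By competitiveness, the best heuristic has paid at most `O(R ^ 2 * w)` at the end of the phase with
the guess `w`, so `w ^ (-1 / 3) * x` is bounded by the increase of
`R ^ (2 / 3) * OPT ^ (2 / 3)` during the phase and telescopes over the phases. The terms
`w ^ (2 / 3)` form a geometric sum dominated by the last guess, which is the initial one or
`O(OPT)`. Competitiveness is only needed at the ends of the phases; their number is `O(OFF)`, and
only those after `OFF` has passed the square root of its final value matter, so a union bound gives
the stated probability.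
-/

noncomputable section

namespace MTS

/-- The expectation of the `[0, ∞]`-valued function `F` under the discrete distribution `p`. -/
def expect {α : Type*} (p : PMF α) (F : α → ℝ≥0∞) : ℝ≥0∞ := ∑' a, p a * F a

section Expectation

variable {α β : Type*} (p : PMF α)

lemma expect_pure (a : α) (F : α → ℝ≥0∞) : expect (PMF.pure a) F = F a := by
  classical
  rw [expect, tsum_eq_single a fun b hb => by simp [PMF.pure_apply, hb]]
  simp

lemma expect_bind (q : α → PMF β) (F : β → ℝ≥0∞) :
    expect (p.bind q) F = expect p fun a => expect (q a) F := by
  simp only [expect, PMF.bind_apply, ← ENNReal.tsum_mul_right, ← ENNReal.tsum_mul_left, mul_assoc]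
  exact ENNReal.tsum_comm

lemma expect_map (g : α → β) (F : β → ℝ≥0∞) : expect (p.map g) F = expect p fun a => F (g a) := by
  simp only [← PMF.bind_pure_comp, expect_bind, Function.comp_apply, expect_pure]

variable {p} in
lemma expect_mono {F G : α → ℝ≥0∞} (h : ∀ a ∈ p.support, F a ≤ G a) : expect p F ≤ expect p G :=
  ENNReal.tsum_le_tsum fun a => by
    by_cases ha : p a = 0
    · simp [ha]
    · exact mul_le_mul_right (h a ((p.mem_support_iff a).2 ha)) _

variable {p} in
lemma expect_congr {F G : α → ℝ≥0∞} (h : ∀ a ∈ p.support, F a = G a) : expect p F = expect p G :=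
  (expect_mono fun a ha => (h a ha).le).antisymm (expect_mono fun a ha => (h a ha).ge)

lemma expect_add (F G : α → ℝ≥0∞) : expect p (fun a => F a + G a) = expect p F + expect p G := by
  simp only [expect, mul_add]
  exact ENNReal.tsum_add

lemma expect_const_mul (c : ℝ≥0∞) (F : α → ℝ≥0∞) :
    expect p (fun a => c * F a) = c * expect p F := by
  simp only [expect, ← ENNReal.tsum_mul_left, mul_left_comm c]

lemma expect_const (c : ℝ≥0∞) : expect p (fun _ => c) = c := by
  rw [expect, ENNReal.tsum_mul_right, p.tsum_coe, one_mul]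

variable {p} in
lemma expect_le_of_forall_le {F : α → ℝ≥0∞} {c : ℝ≥0∞} (h : ∀ a ∈ p.support, F a ≤ c) :
    expect p F ≤ c :=
  (expect_mono h).trans_eq (expect_const p c)

lemma expect_sum {ι : Type*} (s : Finset ι) (F : ι → α → ℝ≥0∞) :
    expect p (fun a => ∑ i ∈ s, F i a) = ∑ i ∈ s, expect p (F i) := by
  classical
  induction s using Finset.induction_on with
  | empty => simp [expect_const]
  | insert i s hi ih => simp only [Finset.sum_insert hi, expect_add, ih]

lemma expect_eq_sum [Fintype α] (F : α → ℝ≥0∞) : expect p F = ∑ a, p a * F a :=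
  tsum_fintype _

lemma expect_uniformOfFintype [Fintype α] [Nonempty α] (F : α → ℝ≥0∞) :
    expect (PMF.uniformOfFintype α) F = (Fintype.card α : ℝ≥0∞)⁻¹ * ∑ a, F a := by
  simp [expect_eq_sum, Finset.mul_sum]

lemma expect_coin (q : ℝ≥0) (F : Bool → ℝ≥0∞) :
    expect (coin q) F = (min 1 q : ℝ≥0) * F true + (1 - (min 1 q : ℝ≥0)) * F false := by
  simp [expect_eq_sum, coin]

/-- The expectation of `F` under `p` on the event `S`. -/
def expectOn (S : Set α) (F : α → ℝ≥0∞) : ℝ≥0∞ := expect p (S.indicator F)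

lemma expectOn_univ (F : α → ℝ≥0∞) : expectOn p Set.univ F = expect p F := by
  rw [expectOn, Set.indicator_univ]

variable {p} in
lemma expectOn_le_expect {S : Set α} {F G : α → ℝ≥0∞} (h : ∀ a ∈ p.support, a ∈ S → F a ≤ G a) :
    expectOn p S F ≤ expect p G :=
  expect_mono fun a ha => by
    by_cases hS : a ∈ S
    · simpa [hS] using h a ha hS
    · simp [hS]

variable {p} in
lemma expectOn_le_add_of_subset_union {S T U : Set α} (h : S ⊆ T ∪ U) {F : α → ℝ≥0∞} :
    expectOn p S F ≤ expectOn p T F + expectOn p U F := by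
  rw [expectOn, expectOn, expectOn, ← expect_add]
  refine expect_mono fun a _ => ?_
  classical
  simp only [Set.indicator_apply]
  split_ifs with hS hT hU hU
  · exact le_self_add
  · exact le_self_add
  · exact le_add_self
  · exact absurd (h hS) (by simp [hT, hU])
  all_goals exact zero_le

lemma expectOn_const_mul (S : Set α) (c : ℝ≥0∞) (F : α → ℝ≥0∞) :
    expectOn p S (fun a => c * F a) = c * expectOn p S F := by
  rw [expectOn, expectOn, ← expect_const_mul]
  exact expect_congr fun a _ => Set.indicator_const_mul S F c a

end Expectation

section Round

variable {ℓ : ℕ} {x x' : Fin ℓ → ℝ≥0}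

lemma expect_proportional {i : Fin ℓ} {v : Fin ℓ → ℝ≥0} (hv : ∃ j, v j ≠ 0) (F : Fin ℓ → ℝ≥0∞) :
    expect (proportional i v) F = (∑ j, (v j : ℝ≥0∞))⁻¹ * ∑ j, v j * F j := by
  simp only [proportional, dif_pos hv, expect_eq_sum, PMF.normalize_apply, tsum_fintype,
    Finset.mul_sum]
  exact Finset.sum_congr rfl fun j _ => by ring

lemma sum_coe_mul_expect_proportional (i : Fin ℓ) (v : Fin ℓ → ℝ≥0) (F : Fin ℓ → ℝ≥0∞) :
    (∑ j, (v j : ℝ≥0∞)) * expect (proportional i v) F = ∑ j, v j * F j := by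
  by_cases hv : ∃ j, v j ≠ 0
  · have hne : ∑ j, (v j : ℝ≥0∞) ≠ 0 := fun h0 =>
      let ⟨j, hj⟩ := hv
      hj (by simpa using Finset.sum_eq_zero_iff.1 h0 j (Finset.mem_univ j))
    have hfin : ∑ j, (v j : ℝ≥0∞) ≠ ∞ := ENNReal.sum_ne_top.2 fun j _ => ENNReal.coe_ne_top
    rw [expect_proportional hv, ← mul_assoc, ENNReal.mul_inv_cancel hne hfin, one_mul]
  · push Not at hv
    simp [hv]

lemma expect_round (i : Fin ℓ) (F : Fin ℓ → ℝ≥0∞) :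
    expect (round x x' i) F = (min (x i) (x' i) / x i : ℝ≥0) * F i
      + (1 - (min (x i) (x' i) / x i : ℝ≥0))
        * expect (proportional i fun j => x' j - x j) F := by
  have hstay : min (x i) (x' i) / x i ≤ 1 := NNReal.div_le_of_le_mul (by simp)
  rw [round, expect_bind, expect_coin, min_eq_right hstay]
  simp [expect_pure]

lemma coe_mul_expect_round (i : Fin ℓ) (F : Fin ℓ → ℝ≥0∞) :
    x i * expect (round x x' i) F = (min (x i) (x' i) : ℝ≥0) * F i
      + (x i - x' i : ℝ≥0) * expect (proportional i fun j => x' j - x j) F := by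
  have hstay : x i * (min (x i) (x' i) / x i) = min (x i) (x' i) := by
    rcases eq_or_ne (x i) 0 with h | h
    · simp [h]
    · exact mul_div_cancel₀ _ h
  have hleave : x i * (1 - min (x i) (x' i) / x i) = x i - x' i := by
    rw [mul_tsub, hstay, mul_one, tsub_min]
  rw [expect_round, mul_add, ← mul_assoc, ← mul_assoc]
  norm_cast
  rw [hstay, hleave]

lemma sum_tsub_comm_of_sum_eq {ι : Type*} {s : Finset ι} {x x' : ι → ℝ≥0}
    (h : ∑ i ∈ s, x i = ∑ i ∈ s, x' i) : ∑ i ∈ s, (x i - x' i) = ∑ i ∈ s, (x' i - x i) := by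
  refine add_right_cancel (b := ∑ i ∈ s, min (x i) (x' i)) ?_
  rw [← Finset.sum_add_distrib, ← Finset.sum_add_distrib]
  have hx' (i : ι) : x' i - x i + min (x i) (x' i) = x' i := by rw [min_comm, tsub_add_min]
  simpa only [tsub_add_min, hx'] using h

lemma sum_coe_mul_expect_round (h : ∑ i, x i = ∑ i, x' i) (F : Fin ℓ → ℝ≥0∞) :
    ∑ i, x i * expect (round x x' i) F = ∑ i, x' i * F i := by
  have hmoved : ∑ i, ((x i - x' i : ℝ≥0) : ℝ≥0∞) = ∑ i, ((x' i - x i : ℝ≥0) : ℝ≥0∞) := by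
    exact_mod_cast sum_tsub_comm_of_sum_eq h
  have hflow : ∑ i, (x i - x' i : ℝ≥0) * expect (proportional i fun j => x' j - x j) F
      = ∑ i, (x' i - x i : ℝ≥0) * F i := by
    by_cases hv : ∃ j, x' j - x j ≠ 0
    · simp only [expect_proportional hv, ← Finset.sum_mul, hmoved]
      rw [← expect_proportional (i := hv.choose) hv, sum_coe_mul_expect_proportional]
    · push Not at hv
      have hx : ∀ i, ((x i - x' i : ℝ≥0) : ℝ≥0∞) = 0 := by simpa [hv] using hmoved
      simp [hv, hx]
  simp only [coe_mul_expect_round, Finset.sum_add_distrib, hflow]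
  rw [← Finset.sum_add_distrib]
  refine Finset.sum_congr rfl fun i _ => ?_
  rw [← add_mul, ← ENNReal.coe_add, add_comm, min_comm, tsub_add_min]

lemma expect_round_ne_le {i : Fin ℓ} {q : ℝ≥0} (hx : 0 < x i) (h : q * x i ≤ x' i) (hq : q ≤ 1) :
    expect (round x x' i) (({i}ᶜ : Set (Fin ℓ)).indicator 1) ≤ 1 - q := by
  have hle : expect (proportional i fun j => x' j - x j) (({i}ᶜ : Set (Fin ℓ)).indicator 1) ≤ 1 :=
    expect_le_of_forall_le fun j _ => Set.indicator_le_self _ _ j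
  have hstay : q ≤ min (x i) (x' i) / x i :=
    (le_div_iff₀ hx).2 (le_min (mul_le_of_le_one_left zero_le hq) h)
  rw [expect_round, Set.indicator_of_notMem (by simp), mul_zero, zero_add]
  exact (mul_le_of_le_one_right' hle).trans
    (tsub_le_tsub_left (ENNReal.coe_le_coe.2 hstay) 1)

end Round

/-! ### HEDGE -/

section Hedge

variable {ℓ : ℕ} {η : ℝ} {g : Fin ℓ → ℝ} {w : Fin ℓ → ℝ≥0}

lemma sum_weights_pos [NeZero ℓ] (hw : ∀ i, 0 < w i) : 0 < ∑ j, w j :=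
  Finset.sum_pos (fun i _ => hw i) Finset.univ_nonempty

lemma hedgeDist_pos [NeZero ℓ] (hw : ∀ i, 0 < w i) (i : Fin ℓ) : 0 < hedgeDist w i :=
  div_pos (hw i) (sum_weights_pos hw)

lemma sum_hedgeDist [NeZero ℓ] (hw : ∀ i, 0 < w i) : ∑ i, hedgeDist w i = 1 := by
  simp only [hedgeDist, ← Finset.sum_div, div_self (sum_weights_pos hw).ne']

lemma hedgeUpdate_pos (hw : ∀ i, 0 < w i) (i : Fin ℓ) : 0 < hedgeUpdate η g w i :=
  mul_pos (hw i) (Real.toNNReal_pos.2 (Real.exp_pos _))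

lemma coe_hedgeUpdate (i : Fin ℓ) : (hedgeUpdate η g w i : ℝ) = w i * Real.exp (-η * g i) := by
  simp [hedgeUpdate, Real.coe_toNNReal _ (Real.exp_pos _).le]

lemma hedgeUpdate_le (hη : 0 ≤ η) {i : Fin ℓ} (hg : 0 ≤ g i) : hedgeUpdate η g w i ≤ w i := by
  refine mul_le_of_le_one_right zero_le (Real.toNNReal_le_one.2 (Real.exp_le_one_iff.2 ?_))
  exact mul_nonpos_of_nonpos_of_nonneg (neg_nonpos.2 hη) hg

lemma exp_neg_mul_le_hedgeUpdate (hη : 0 ≤ η) {i : Fin ℓ} (hg : g i ≤ 1) :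
    (Real.exp (-η)).toNNReal * w i ≤ hedgeUpdate η g w i := by
  rw [hedgeUpdate, mul_comm]
  gcongr
  nlinarith

lemma exp_mul_hedgeDist_le_hedgeDist_hedgeUpdate [NeZero ℓ] (hη : 0 ≤ η) (hw : ∀ i, 0 < w i)
    (hg : ∀ i, 0 ≤ g i) (i : Fin ℓ) :
    (Real.exp (-η * g i)).toNNReal * hedgeDist w i ≤ hedgeDist (hedgeUpdate η g w) i := by
  have hsum : ∑ j, hedgeUpdate η g w j ≤ ∑ j, w j :=
    Finset.sum_le_sum fun j _ => hedgeUpdate_le hη (hg j)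
  have hpos := sum_weights_pos (hedgeUpdate_pos (η := η) (g := g) hw)
  calc (Real.exp (-η * g i)).toNNReal * hedgeDist w i
      = hedgeUpdate η g w i / ∑ j, w j := by rw [hedgeDist, hedgeUpdate]; ring
    _ ≤ hedgeUpdate η g w i / ∑ j, hedgeUpdate η g w j := by gcongr

lemma exp_neg_mul_hedgeDist_hedgeUpdate_le [NeZero ℓ] (hη : 0 ≤ η) (hw : ∀ i, 0 < w i)
    (hg : ∀ i, 0 ≤ g i) (hg1 : ∀ i, g i ≤ 1) (i : Fin ℓ) :
    (Real.exp (-η)).toNNReal * hedgeDist (hedgeUpdate η g w) i ≤ hedgeDist w i := by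
  have hsum : (Real.exp (-η)).toNNReal * ∑ j, w j ≤ ∑ j, hedgeUpdate η g w j := by
    rw [Finset.mul_sum]
    exact Finset.sum_le_sum fun j _ => exp_neg_mul_le_hedgeUpdate hη (hg1 j)
  have hpos := sum_weights_pos (hedgeUpdate_pos (η := η) (g := g) hw)
  rw [hedgeDist, hedgeDist, le_div_iff₀ (sum_weights_pos hw), ← mul_div_assoc,
    div_mul_eq_mul_div, div_le_iff₀ hpos]
  calc (Real.exp (-η)).toNNReal * hedgeUpdate η g w i * ∑ j, w j
      = hedgeUpdate η g w i * ((Real.exp (-η)).toNNReal * ∑ j, w j) := by ring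
    _ ≤ w i * ∑ j, hedgeUpdate η g w j := mul_le_mul' (hedgeUpdate_le hη (hg i)) hsum

/-- The potential of HEDGE with respect to the comparator `i`: the relative entropy of the point
mass at `i` with respect to the current distribution. -/
def hedgePotential (w : Fin ℓ → ℝ≥0) (i : Fin ℓ) : ℝ := -Real.log (hedgeDist w i)

lemma hedgePotential_nonneg [NeZero ℓ] (hw : ∀ i, 0 < w i) (i : Fin ℓ) :
    0 ≤ hedgePotential w i := by
  have hle : hedgeDist w i ≤ 1 :=
    (Finset.single_le_sum (fun _ _ => zero_le) (Finset.mem_univ i)).trans_eq (sum_hedgeDist hw)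
  exact neg_nonneg.2 (Real.log_nonpos (NNReal.coe_nonneg _) (by exact_mod_cast hle))

lemma hedgePotential_one (i : Fin ℓ) : hedgePotential (fun _ => 1) i = Real.log ℓ := by
  simp [hedgePotential, hedgeDist]

lemma hedgePotential_eq_log_sub_log [NeZero ℓ] (hw : ∀ i, 0 < w i) (i : Fin ℓ) :
    hedgePotential w i = Real.log (∑ j, w j : ℝ≥0) - Real.log (w i) := by
  rw [hedgePotential, hedgeDist, NNReal.coe_div, Real.log_div (NNReal.coe_pos.2 (hw i)).ne'
    (NNReal.coe_pos.2 (sum_weights_pos hw)).ne', neg_sub]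

lemma exp_neg_mul_le_of_mem_Icc {y : ℝ} (hy : y ∈ Set.Icc 0 1) :
    Real.exp (-η * y) ≤ 1 - (1 - Real.exp (-η)) * y := by
  have hconvex := convexOn_exp.2 (Set.mem_univ (-η)) (Set.mem_univ 0) hy.1
    (sub_nonneg.2 hy.2) (by ring)
  simp only [smul_eq_mul, mul_zero, add_zero, Real.exp_zero, mul_one] at hconvex
  rw [mul_comm (-η)]
  linarith

lemma sum_hedgeUpdate_le [NeZero ℓ] (hw : ∀ i, 0 < w i) (hg : ∀ i, g i ∈ Set.Icc 0 1) :
    ((∑ j, hedgeUpdate η g w j : ℝ≥0) : ℝ)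
      ≤ (∑ j, w j : ℝ≥0) * (1 - (1 - Real.exp (-η)) * ∑ j, hedgeDist w j * g j) := by
  have hW : ((∑ j, w j : ℝ≥0) : ℝ) ≠ 0 := (NNReal.coe_pos.2 (sum_weights_pos hw)).ne'
  have hmean : ((∑ j, w j : ℝ≥0) : ℝ) * ∑ j, hedgeDist w j * g j = ∑ j, w j * g j := by
    simp only [Finset.mul_sum, hedgeDist, NNReal.coe_div]
    exact Finset.sum_congr rfl fun j _ => by field_simp
  rw [mul_sub, mul_one, mul_left_comm, hmean, NNReal.coe_sum, NNReal.coe_sum, Finset.mul_sum,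
    ← Finset.sum_sub_distrib]
  refine Finset.sum_le_sum fun j _ => ?_
  rw [coe_hedgeUpdate]
  calc (w j : ℝ) * Real.exp (-η * g j) ≤ w j * (1 - (1 - Real.exp (-η)) * g j) := by
        gcongr
        exact exp_neg_mul_le_of_mem_Icc (hg j)
    _ = w j - (1 - Real.exp (-η)) * (w j * g j) := by ring

lemma hedgePotential_hedgeUpdate_add_le [NeZero ℓ] (hw : ∀ i, 0 < w i)
    (hg : ∀ i, g i ∈ Set.Icc 0 1) (i : Fin ℓ) :
    hedgePotential (hedgeUpdate η g w) i + (1 - Real.exp (-η)) * ∑ j, hedgeDist w j * g j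
      ≤ hedgePotential w i + η * g i := by
  have hw' : ∀ i, 0 < hedgeUpdate η g w i := hedgeUpdate_pos hw
  have hW : (0 : ℝ) < (∑ j, w j : ℝ≥0) := NNReal.coe_pos.2 (sum_weights_pos hw)
  have hW' : (0 : ℝ) < (∑ j, hedgeUpdate η g w j : ℝ≥0) := NNReal.coe_pos.2 (sum_weights_pos hw')
  have hsum := sum_hedgeUpdate_le (η := η) hw hg
  have hfactor := pos_of_mul_pos_right (hW'.trans_le hsum) hW.le
  have hlog : Real.log (∑ j, hedgeUpdate η g w j : ℝ≥0)
      ≤ Real.log (∑ j, w j : ℝ≥0) - (1 - Real.exp (-η)) * ∑ j, hedgeDist w j * g j := by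
    refine (Real.log_le_log hW' hsum).trans ?_
    rw [Real.log_mul hW.ne' hfactor.ne']
    linarith [Real.log_le_sub_one_of_pos hfactor]
  rw [hedgePotential_eq_log_sub_log hw, hedgePotential_eq_log_sub_log hw', coe_hedgeUpdate,
    Real.log_mul (NNReal.coe_pos.2 (hw i)).ne' (Real.exp_pos _).ne', Real.log_exp]
  linarith

end Hedge

/-! ### One round of the algorithm -/

section Step

variable {M : Type*} {ℓ : ℕ}

lemma AlgState.wait_cases (σ : AlgState M ℓ) : σ.wait = 0 ∨ σ.wait = 1 ∨ 2 ≤ σ.wait := by omega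

/-- The probability of scheduling an exploration when the exploration rate is `ε`. -/
def exploreProb (ε : ℝ) : ℝ≥0 := min 1 ε.toNNReal

lemma exploreProb_add_one_sub (ε : ℝ) : (exploreProb ε + (1 - exploreProb ε) : ℝ≥0∞) = 1 :=
  add_tsub_cancel_of_le (by exact_mod_cast min_le_left _ _)

lemma one_le_two_mul_one_sub_exploreProb {ε : ℝ} (hε : ε ≤ 1 / 2) :
    (1 : ℝ≥0∞) ≤ 2 * (1 - exploreProb ε) := by
  have hhalf : exploreProb ε ≤ 1 / 2 :=
    (min_le_right _ _).trans (Real.toNNReal_le_iff_le_coe.2 (by simpa using hε))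
  have hone : (1 : ℝ≥0) ≤ 2 * (1 - exploreProb ε) := by
    rw [mul_tsub, mul_one]
    refine le_tsub_of_add_le_left ((add_le_add_left (mul_le_mul_right hhalf 2) 1).trans_eq ?_)
    norm_num
  exact_mod_cast hone

/-- The loss vector fed to HEDGE after an exploration of `e`, when the heuristics have the costs
`f`. -/
def exploredLoss (D : ℝ) (f : Fin ℓ → ℝ≥0∞) (e : Fin ℓ) : Fin ℓ → ℝ :=
  Pi.single e ((f e).toReal / (2 * D))

/-- The HEDGE weights `w` after an exploration of `e`. -/
def exploredWeights (D η : ℝ) (f : Fin ℓ → ℝ≥0∞) (w : Fin ℓ → ℝ≥0) (e : Fin ℓ) : Fin ℓ → ℝ≥0 :=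
  hedgeUpdate η (exploredLoss D f e) w

variable {D : ℝ} {m : ℕ} {ε η : ℝ} {f : Fin ℓ → ℝ≥0∞}

lemma exploredLoss_nonneg (hD : 0 ≤ D) (e i : Fin ℓ) : 0 ≤ exploredLoss D f e i :=
  (Pi.single_nonneg.2 (by positivity) : (0 : Fin ℓ → ℝ) ≤ _) i

lemma exploredLoss_mem_Icc (hD : 0 < D) (hf : ∀ i, f i ≤ ENNReal.ofReal (2 * D)) (e i : Fin ℓ) :
    exploredLoss D f e i ∈ Set.Icc 0 1 := by
  refine ⟨exploredLoss_nonneg hD.le e i, ?_⟩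
  rcases eq_or_ne i e with rfl | hie
  · rw [exploredLoss, Pi.single_eq_same, div_le_one (by positivity)]
    exact ENNReal.toReal_le_of_le_ofReal (by positivity) (hf i)
  · simp [exploredLoss, hie]

lemma exploredLoss_le (hD : 0 ≤ D) (e i : Fin ℓ) :
    exploredLoss D f e i ≤ (f i).toReal / (2 * D) := by
  rcases eq_or_ne i e with rfl | hie
  · simp [exploredLoss]
  · rw [exploredLoss, Pi.single_eq_of_ne hie]
    positivity

lemma exploredWeights_pos {w : Fin ℓ → ℝ≥0} (hw : ∀ i, 0 < w i) (e i : Fin ℓ) :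
    0 < exploredWeights D η f w e i :=
  hedgeUpdate_pos hw i

variable [NeZero ℓ]

lemma expect_uniform_exploredLoss (hD : 0 < D) {i : Fin ℓ} (hf : f i ≠ ∞) :
    expect (PMF.uniformOfFintype (Fin ℓ)) (fun e => ENNReal.ofReal (exploredLoss D f e i))
      = (ℓ : ℝ≥0∞)⁻¹ / ENNReal.ofReal (2 * D) * f i := by
  rw [expect_uniformOfFintype, Fintype.card_fin, Finset.sum_eq_single_of_mem i (Finset.mem_univ i)
    fun e _ he => by simp [exploredLoss, Pi.single_eq_of_ne he.symm], exploredLoss,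
    Pi.single_eq_same, ENNReal.ofReal_div_of_pos (by positivity), ENNReal.ofReal_toReal hf]
  simp only [div_eq_mul_inv]
  ring

lemma expect_fresh (p : M) (z : ℝ≥0∞) (F : AlgState M ℓ → ℝ≥0∞) :
    expect (fresh p z) F = expect (PMF.uniformOfFintype (Fin ℓ)) fun i => F
      { weights := fun _ => 1, leader := i, wait := 0, explored := i, lastQuery := i, run := 0,
        base := p, pos := p, paid := z } :=
  expect_map _ _ _

variable [MetricSpace M] {c : CostFn M} {h : Fin ℓ → M} {σ : AlgState M ℓ}

lemma expect_step_of_wait_eq_zero (hσ : σ.wait = 0) (F : AlgState M ℓ → ℝ≥0∞) :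
    expect (step D m ε η c h f σ) F
      = exploreProb ε * expect (PMF.uniformOfFintype (Fin ℓ))
            (fun e => F { move m c h σ with wait := m, explored := e })
        + (1 - exploreProb ε) * F (move m c h σ) := by
  simp only [step, hσ, if_true, expect_bind, expect_coin, expect_map, expect_pure, exploreProb,
    Bool.false_eq_true, if_false]

lemma expect_step_of_wait_eq_one (hσ : σ.wait = 1) (F : AlgState M ℓ → ℝ≥0∞) :
    expect (step D m ε η c h f σ) F
      = expect (round (hedgeDist σ.weights)
          (hedgeDist (exploredWeights D η f σ.weights σ.explored)) σ.leader) fun j =>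
        F { move m c h σ with
          wait := 0, weights := exploredWeights D η f σ.weights σ.explored, leader := j } := by
  have hloss : (fun j => if j = σ.explored then (f j).toReal / (2 * D) else 0)
      = exploredLoss D f σ.explored := by
    funext j
    rcases eq_or_ne j σ.explored with rfl | hj
    · simp [exploredLoss]
    · simp [exploredLoss, hj]
  simp only [step, hσ, one_ne_zero, if_true, if_false, hloss, expect_map]
  rfl

lemma expect_step_of_two_le_wait (hσ : 2 ≤ σ.wait) (F : AlgState M ℓ → ℝ≥0∞) :
    expect (step D m ε η c h f σ) F = F { move m c h σ with wait := σ.wait - 1 } := by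
  simp only [step, if_neg (show σ.wait ≠ 0 by omega), if_neg (show σ.wait ≠ 1 by omega),
    expect_pure]

/-- The invariant of a running instance: positive weights, and waiting time at most `m`. -/
def AlgState.Valid (m : ℕ) (σ : AlgState M ℓ) : Prop := (∀ i, 0 < σ.weights i) ∧ σ.wait ≤ m

lemma AlgState.Valid.of_mem_support_step (hσ : σ.Valid m) {τ : AlgState M ℓ}
    (hτ : τ ∈ (step D m ε η c h f σ).support) : τ.Valid m := by
  unfold step at hτ
  split_ifs at hτ with hexploit hexplore
  · obtain ⟨b, -, hb⟩ := (PMF.mem_support_bind_iff _ _ _).1 hτ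
    cases b with
    | false =>
      obtain rfl : τ = move m c h σ := by simpa using hb
      exact hσ
    | true =>
      obtain ⟨e, -, rfl⟩ := (PMF.mem_support_map_iff _ _ _).1 hb
      exact ⟨hσ.1, le_rfl⟩
  · obtain ⟨j, -, rfl⟩ := (PMF.mem_support_map_iff _ _ _).1 hτ
    exact ⟨hedgeUpdate_pos hσ.1, Nat.zero_le _⟩
  · obtain rfl : τ = { move m c h σ with wait := σ.wait - 1 } := by simpa using hτ
    exact ⟨hσ.1, (Nat.sub_le _ _).trans hσ.2⟩

/-- The conditional expectation, before a round, of a function `F` of the weights, the leader,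
the waiting time and the explored heuristic after the round. -/
def stepAvg (D : ℝ) (m : ℕ) (ε η : ℝ) (f : Fin ℓ → ℝ≥0∞)
    (F : (Fin ℓ → ℝ≥0) → Fin ℓ → ℕ → Fin ℓ → ℝ≥0∞) (w : Fin ℓ → ℝ≥0) (l : Fin ℓ) (k : ℕ)
    (e : Fin ℓ) : ℝ≥0∞ :=
  if k = 0 then
    exploreProb ε * expect (PMF.uniformOfFintype (Fin ℓ)) (fun e' => F w l m e')
      + (1 - exploreProb ε) * F w l 0 e
  else if k = 1 then
    expect (round (hedgeDist w) (hedgeDist (exploredWeights D η f w e)) l) fun j =>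
      F (exploredWeights D η f w e) j 0 e
  else F w l (k - 1) e

lemma stepAvg_leader (g : Fin ℓ → ℝ≥0∞) (w : Fin ℓ → ℝ≥0) (l : Fin ℓ) (k : ℕ) (e : Fin ℓ) :
    stepAvg D m ε η f (fun _ l _ _ => g l) w l k e =
      if k = 1 then expect (round (hedgeDist w) (hedgeDist (exploredWeights D η f w e)) l) g
      else g l := by
  unfold stepAvg
  split_ifs with hk0 hk1
  · omega
  · rw [expect_const, ← add_mul, exploreProb_add_one_sub, one_mul]
  · rfl
  · rfl

lemma expect_step_eq_stepAvg (F : (Fin ℓ → ℝ≥0) → Fin ℓ → ℕ → Fin ℓ → ℝ≥0∞) :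
    expect (step D m ε η c h f σ) (fun τ => F τ.weights τ.leader τ.wait τ.explored)
      = stepAvg D m ε η f F σ.weights σ.leader σ.wait σ.explored := by
  rcases σ.wait_cases with hw | hw | hw
  · simp [expect_step_of_wait_eq_zero hw, stepAvg, hw, move]
  · simp [expect_step_of_wait_eq_one hw, stepAvg, hw, move]
  · simp [expect_step_of_two_le_wait hw, stepAvg, move, show σ.wait ≠ 0 by omega,
      show σ.wait ≠ 1 by omega]

lemma sum_hedgeDist_mul_stepAvg (F : (Fin ℓ → ℝ≥0) → Fin ℓ → ℕ → Fin ℓ → ℝ≥0∞)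
    {w : Fin ℓ → ℝ≥0} (hw : ∀ i, 0 < w i) (l : Fin ℓ) (k : ℕ) (e : Fin ℓ) :
    ∑ i, hedgeDist w i * stepAvg D m ε η f F w i k e
      = stepAvg D m ε η f (fun w _ k e => ∑ i, hedgeDist w i * F w i k e) w l k e := by
  unfold stepAvg
  split_ifs
  · simp only [mul_add, Finset.sum_add_distrib, expect_sum, expect_const_mul, Finset.mul_sum,
      mul_left_comm]
  · rw [sum_coe_mul_expect_round (F := fun j => F (exploredWeights D η f w e) j 0 e)
      ((sum_hedgeDist hw).trans (sum_hedgeDist (exploredWeights_pos hw e)).symm), expect_const]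
  · rfl

lemma exp_neg_mul_sum_hedgeDist_mul_stepAvg_leader_le (hD : 0 < D) (hη : 0 ≤ η)
    (hf : ∀ i, f i ≤ ENNReal.ofReal (2 * D)) (g : Fin ℓ → ℝ≥0∞) {w : Fin ℓ → ℝ≥0}
    (hw : ∀ i, 0 < w i) (k : ℕ) (e : Fin ℓ) :
    (Real.exp (-η)).toNNReal * ∑ i, hedgeDist w i * stepAvg D m ε η f (fun _ l _ _ => g l) w i k e
      ≤ ∑ i, hedgeDist w i * g i := by
  simp only [stepAvg_leader]
  split_ifs
  · rw [sum_coe_mul_expect_round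
      ((sum_hedgeDist hw).trans (sum_hedgeDist (exploredWeights_pos hw e)).symm), Finset.mul_sum]
    refine Finset.sum_le_sum fun i _ => ?_
    rw [← mul_assoc]
    gcongr
    exact_mod_cast exp_neg_mul_hedgeDist_hedgeUpdate_le hη hw (exploredLoss_nonneg hD.le e)
      (fun i => (exploredLoss_mem_Icc hD hf e i).2) i
  · refine mul_le_of_le_one_left zero_le ?_
    exact_mod_cast Real.toNNReal_le_one.2 (Real.exp_le_one_iff.2 (neg_nonpos.2 hη))

end Step

/-- A run of the algorithm: the parameters `D`, `m`, `ε`, `η` of `step`, the cost function `cost n`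
of its round `n` (rounds are numbered from `0`), the states `traj n` of the heuristics before round
`n`, and the distribution `start` of the state (of which only the position and the cost paid matter)
in which its predecessor has stopped. -/
structure AlgRun (M : Type*) (ℓ : ℕ) where
  D : ℝ
  m : ℕ
  ε : ℝ
  η : ℝ
  cost : ℕ → CostFn M
  traj : ℕ → Fin ℓ → M
  start : PMF (AlgState M ℓ)

/-- The cost of the `i`-th heuristic when it moves from the state `h i` to the state `h' i`. -/
def moveCost {M : Type*} [MetricSpace M] {ℓ : ℕ} (c : CostFn M) (h h' : Fin ℓ → M) (i : Fin ℓ) :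
    ℝ≥0∞ :=
  c (h' i) + edist (h i) (h' i)

namespace AlgRun

variable {M : Type*} [MetricSpace M] {ℓ : ℕ} (A : AlgRun M ℓ)

/-- The cost of the `i`-th heuristic in round `n`. -/
def loss (n : ℕ) : Fin ℓ → ℝ≥0∞ := moveCost (A.cost n) (A.traj n) (A.traj (n + 1))

variable [NeZero ℓ]

/-- Round `n`. -/
abbrev next (n : ℕ) : AlgState M ℓ → PMF (AlgState M ℓ) :=
  step A.D A.m A.ε A.η (A.cost n) (A.traj (n + 1)) (A.loss n)

/-- The law of the memory of the algorithm after `n` rounds. -/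
def law : ℕ → PMF (AlgState M ℓ)
  | 0 => A.start.bind fun σ => fresh σ.pos σ.paid
  | n + 1 => (law n).bind (A.next n)

lemma expect_law_zero (F : AlgState M ℓ → ℝ≥0∞) :
    expect (A.law 0) F = expect A.start fun σ => expect (fresh σ.pos σ.paid) F :=
  expect_bind _ _ _

lemma expect_law_succ (n : ℕ) (F : AlgState M ℓ → ℝ≥0∞) :
    expect (A.law (n + 1)) F = expect (A.law n) fun σ => expect (A.next n σ) F :=
  expect_bind _ _ _

variable {A} in
lemma valid_of_mem_support_law {n : ℕ} {σ : AlgState M ℓ} (hσ : σ ∈ (A.law n).support) :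
    σ.Valid A.m := by
  induction n generalizing σ with
  | zero =>
    simp only [law, PMF.mem_support_bind_iff, fresh, PMF.mem_support_map_iff] at hσ
    obtain ⟨_, -, i, -, rfl⟩ := hσ
    exact ⟨fun _ => one_pos, Nat.zero_le _⟩
  | succ n ih =>
    obtain ⟨τ, hτ, hσ⟩ := (PMF.mem_support_bind_iff _ _ _).1 hσ
    exact (ih hτ).of_mem_support_step hσ

/-- Before every round, the leader is distributed according to HEDGE, independently of the waiting
time and of the explored heuristic. -/
theorem expect_law_eq_sum_hedgeDist (n : ℕ) (F : (Fin ℓ → ℝ≥0) → Fin ℓ → ℕ → Fin ℓ → ℝ≥0∞)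
    (hF : ∀ w l e e', F w l 0 e = F w l 0 e') :
    expect (A.law n) (fun σ => F σ.weights σ.leader σ.wait σ.explored)
      = expect (A.law n) fun σ =>
        ∑ i, hedgeDist σ.weights i * F σ.weights i σ.wait σ.explored := by
  induction n generalizing F with
  | zero =>
    have hdist (i : Fin ℓ) : (hedgeDist (fun _ : Fin ℓ => (1 : ℝ≥0)) i : ℝ≥0∞) = (ℓ : ℝ≥0∞)⁻¹ := by
      simp [hedgeDist, ENNReal.coe_inv (Nat.cast_ne_zero.2 (NeZero.ne ℓ))]
    simp only [expect_law_zero, expect_fresh, hdist]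
    refine expect_congr fun σ _ => ?_
    simp only [hF _ _ _ 0, expect_const]
    rw [expect_uniformOfFintype, Fintype.card_fin, Finset.mul_sum]
  | succ n ih =>
    simp only [expect_law_succ]
    have hstep (σ : AlgState M ℓ) := expect_step_eq_stepAvg (D := A.D) (m := A.m) (ε := A.ε)
      (η := A.η) (c := A.cost n) (h := A.traj (n + 1)) (f := A.loss n) (σ := σ)
    rw [expect_congr fun σ _ => hstep σ F, ih _ fun w l e e' => by simp [stepAvg, hF w l e e'],
      expect_congr fun σ _ => hstep σ fun w _ k e => ∑ i, hedgeDist w i * F w i k e]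
    refine expect_congr fun σ hσ => ?_
    exact sum_hedgeDist_mul_stepAvg F (valid_of_mem_support_law hσ).1 _ _ _

end AlgRun

namespace AlgRun

variable {M : Type*} [MetricSpace M] {ℓ : ℕ} [NeZero ℓ] {A : AlgRun M ℓ}

lemma exp_neg_mul_expectOn_leader_next_le (hD : 0 < A.D) (hη : 0 ≤ A.η)
    (hf : ∀ n i, A.loss n i ≤ ENNReal.ofReal (2 * A.D)) (n : ℕ) (K : Set ℕ) (g : Fin ℓ → ℝ≥0∞) :
    (Real.exp (-A.η)).toNNReal * expectOn (A.law n) {σ | σ.wait ∈ K}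
        (fun σ => expect (A.next n σ) fun τ => g τ.leader)
      ≤ expectOn (A.law n) {σ | σ.wait ∈ K} fun σ => g σ.leader := by
  classical
  have hite (F : AlgState M ℓ → ℝ≥0∞) : expectOn (A.law n) {σ | σ.wait ∈ K} F
      = expect (A.law n) fun σ => if σ.wait ∈ K then F σ else 0 :=
    expect_congr fun σ _ => Set.indicator_apply _ _ _
  simp only [expect_step_eq_stepAvg fun _ l _ _ => g l, hite]
  rw [A.expect_law_eq_sum_hedgeDist n (fun w l k e => if k ∈ K then
      stepAvg A.D A.m A.ε A.η (A.loss n) (fun _ l _ _ => g l) w l k e else 0)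
      (fun w l e e' => by simp [stepAvg]),
    A.expect_law_eq_sum_hedgeDist n (fun _ l k _ => if k ∈ K then g l else 0) fun _ _ _ _ => rfl,
    ← expect_const_mul]
  refine expect_mono fun σ hσ => ?_
  split_ifs
  · exact exp_neg_mul_sum_hedgeDist_mul_stepAvg_leader_le hD hη (hf n) g
      (valid_of_mem_support_law hσ).1 _ _
  · simp

lemma exp_neg_mul_expect_leader_succ_le (hD : 0 < A.D) (hη : 0 ≤ A.η)
    (hf : ∀ n i, A.loss n i ≤ ENNReal.ofReal (2 * A.D)) (n : ℕ) (g : Fin ℓ → ℝ≥0∞) :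
    (Real.exp (-A.η)).toNNReal * expect (A.law (n + 1)) (fun σ => g σ.leader)
      ≤ expect (A.law n) fun σ => g σ.leader := by
  simpa only [expect_law_succ, Set.mem_univ, Set.ofPred_true, expectOn_univ] using
    exp_neg_mul_expectOn_leader_next_le hD hη hf n Set.univ g

lemma exp_neg_pow_mul_expect_leader_add_le (hD : 0 < A.D) (hη : 0 ≤ A.η)
    (hf : ∀ n i, A.loss n i ≤ ENNReal.ofReal (2 * A.D)) (n k : ℕ) (g : Fin ℓ → ℝ≥0∞) :
    ((Real.exp (-A.η)).toNNReal : ℝ≥0∞) ^ k * expect (A.law (n + k)) (fun σ => g σ.leader)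
      ≤ expect (A.law n) fun σ => g σ.leader := by
  induction k with
  | zero => simp
  | succ k ih =>
    rw [pow_succ, mul_assoc]
    exact (mul_le_mul_right (exp_neg_mul_expect_leader_succ_le hD hη hf (n + k) g) _).trans ih

lemma expectOn_wait_eq_succ {k : ℕ} (hk : 1 ≤ k) (hkm : k < A.m) (n : ℕ)
    (F : (Fin ℓ → ℝ≥0) → Fin ℓ → Fin ℓ → ℝ≥0∞) :
    expectOn (A.law (n + 1)) {σ | σ.wait = k} (fun σ => F σ.weights σ.leader σ.explored)
      = expectOn (A.law n) {σ | σ.wait = k + 1} fun σ => F σ.weights σ.leader σ.explored := by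
  have hk0 : k ≠ 0 := by omega
  have hkm' : A.m ≠ k := by omega
  rw [expectOn, expect_law_succ]
  refine expect_congr fun σ _ => ?_
  rcases σ.wait_cases with hw | hw | hw
  · simp [expect_step_of_wait_eq_zero hw, hw, hk0.symm, hkm', move,
      expect_const]
  · simp [expect_step_of_wait_eq_one hw, hw, hk0, hk0.symm, expect_const]
  · have hwk : σ.wait - 1 = k ↔ σ.wait = k + 1 := by omega
    simp [expect_step_of_two_le_wait hw, Set.indicator_apply, move, hwk]

lemma expectOn_wait_eq_m_succ (hm : 1 ≤ A.m) (n : ℕ)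
    (F : (Fin ℓ → ℝ≥0) → Fin ℓ → Fin ℓ → ℝ≥0∞) :
    expectOn (A.law (n + 1)) {σ | σ.wait = A.m} (fun σ => F σ.weights σ.leader σ.explored)
      = exploreProb A.ε * expectOn (A.law n) {σ | σ.wait = 0} fun σ =>
          expect (PMF.uniformOfFintype (Fin ℓ)) fun e => F σ.weights σ.leader e := by
  have hm0 : 0 ≠ A.m := by omega
  rw [← expectOn_const_mul, expectOn, expect_law_succ]
  refine expect_congr fun σ hσ => ?_
  rcases σ.wait_cases with hw | hw | hw
  · simp [expect_step_of_wait_eq_zero hw, hw, hm0, move]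
  · simp [expect_step_of_wait_eq_one hw, hw, hm0, expect_const]
  · have hwm : σ.wait - 1 ≠ A.m := by have := (valid_of_mem_support_law hσ).2; omega
    simp [expect_step_of_two_le_wait hw, hwm, show σ.wait ≠ 0 by omega]

/-- The states with waiting time `m - i` stem from the exploitation states `i + 1` rounds before. -/
lemma expectOn_wait_eq_m_sub (n : ℕ) {i : ℕ} (hi : i < A.m)
    (F : (Fin ℓ → ℝ≥0) → Fin ℓ → Fin ℓ → ℝ≥0∞) :
    expectOn (A.law (n + (i + 1))) {σ | σ.wait = A.m - i}
        (fun σ => F σ.weights σ.leader σ.explored)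
      = exploreProb A.ε * expectOn (A.law n) {σ | σ.wait = 0} fun σ =>
          expect (PMF.uniformOfFintype (Fin ℓ)) fun e => F σ.weights σ.leader e := by
  induction i with
  | zero => exact expectOn_wait_eq_m_succ hi n F
  | succ i ih =>
    rw [← ih (by omega), ← add_assoc n, expectOn_wait_eq_succ (by omega) (by omega),
      show A.m - (i + 1) + 1 = A.m - i by omega]

lemma expectOn_wait_eq_m_sub_eq_zero {n i : ℕ} (hi : i < A.m) (hn : n ≤ i)
    (F : (Fin ℓ → ℝ≥0) → Fin ℓ → Fin ℓ → ℝ≥0∞) :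
    expectOn (A.law n) {σ | σ.wait = A.m - i} (fun σ => F σ.weights σ.leader σ.explored) = 0 := by
  induction n generalizing i with
  | zero =>
    have hwait : 0 ≠ A.m - i := by omega
    simp [expectOn, expect_law_zero, expect_fresh, hwait, expect_const]
  | succ n ih =>
    rw [expectOn_wait_eq_succ (by omega) (by omega), show A.m - i + 1 = A.m - (i - 1) by omega]
    exact ih (by omega) (by omega)

lemma one_sub_exploreProb_mul_expectOn_leader_le (n : ℕ) (g : Fin ℓ → ℝ≥0∞) :
    (1 - exploreProb A.ε) * expectOn (A.law n) {σ | σ.wait = 0} (fun σ => g σ.leader)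
      ≤ expectOn (A.law (n + 1)) {σ | σ.wait = 0} fun σ => g σ.leader := by
  rw [← expectOn_const_mul, expectOn.eq_def (A.law (n + 1)), expect_law_succ]
  refine expectOn_le_expect fun σ _ hσ => ?_
  rw [expect_step_of_wait_eq_zero hσ, Set.indicator_of_mem (a := move _ _ _ σ) hσ]
  exact le_add_self

lemma expectOn_leader_le_two_pow_mul (hε : A.ε ≤ 1 / 2) (n k : ℕ) (g : Fin ℓ → ℝ≥0∞) :
    expectOn (A.law n) {σ | σ.wait = 0} (fun σ => g σ.leader)
      ≤ 2 ^ k * expectOn (A.law (n + k)) {σ | σ.wait = 0} fun σ => g σ.leader := by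
  induction k with
  | zero => simp
  | succ k ih =>
    refine ih.trans ?_
    rw [pow_succ, mul_assoc]
    gcongr
    calc _ ≤ 2 * (1 - (exploreProb A.ε : ℝ≥0∞))
            * expectOn (A.law (n + k)) {σ | σ.wait = 0} (fun σ => g σ.leader) :=
          le_mul_of_one_le_left' (one_le_two_mul_one_sub_exploreProb hε)
      _ ≤ _ := by
        rw [mul_assoc]
        gcongr
        exact one_sub_exploreProb_mul_expectOn_leader_le (n + k) g

lemma expectOn_wait_eq_m_sub_leader_le (hε : A.ε ≤ 1 / 2) (n : ℕ) {i : ℕ} (hi : i < A.m)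
    (g : Fin ℓ → ℝ≥0∞) :
    expectOn (A.law n) {σ | σ.wait = A.m - i} (fun σ => g σ.leader)
      ≤ exploreProb A.ε * 2 ^ A.m
        * expectOn (A.law n) {σ | σ.wait = 0} fun σ => g σ.leader := by
  rcases Nat.lt_or_ge i n with hn | hn
  · obtain ⟨n, rfl⟩ := Nat.exists_eq_add_of_le' hn
    rw [expectOn_wait_eq_m_sub n hi fun _ l _ => g l, mul_assoc]
    simp only [expect_const]
    gcongr
    refine (expectOn_leader_le_two_pow_mul hε n (i + 1) g).trans ?_
    gcongr
    · norm_num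
    · omega
  · rw [expectOn_wait_eq_m_sub_eq_zero hi hn fun _ l _ => g l]
    exact zero_le

lemma expectOn_wait_ne_zero_leader_le (hε : A.ε ≤ 1 / 2) (n : ℕ) (g : Fin ℓ → ℝ≥0∞) :
    expectOn (A.law n) {σ | σ.wait ≠ 0} (fun σ => g σ.leader)
      ≤ A.m * (exploreProb A.ε * 2 ^ A.m)
        * expectOn (A.law n) {σ | σ.wait = 0} fun σ => g σ.leader := by
  calc _ ≤ expect (A.law n) (fun σ => ∑ i ∈ Finset.range A.m,
        {σ : AlgState M ℓ | σ.wait = A.m - i}.indicator (fun σ => g σ.leader) σ) := by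
        refine expectOn_le_expect fun σ hσ (h0 : σ.wait ≠ 0) => ?_
        have hwait : σ.wait ≤ A.m := (valid_of_mem_support_law hσ).2
        refine le_trans ?_ (Finset.single_le_sum (fun _ _ => zero_le)
          (Finset.mem_range.2 (show A.m - σ.wait < A.m by omega)))
        rw [Set.indicator_of_mem (by simp; omega)]
    _ = ∑ i ∈ Finset.range A.m,
          expectOn (A.law n) {σ | σ.wait = A.m - i} fun σ => g σ.leader := expect_sum _ _ _
    _ ≤ ∑ i ∈ Finset.range A.m, exploreProb A.ε * 2 ^ A.m
          * expectOn (A.law n) {σ | σ.wait = 0} fun σ => g σ.leader :=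
        Finset.sum_le_sum fun i hi =>
          expectOn_wait_eq_m_sub_leader_le hε n (Finset.mem_range.1 hi) g
    _ = _ := by rw [Finset.sum_const, Finset.card_range, nsmul_eq_mul]; ring

end AlgRun

/-! ### The potential function -/

section Greedy

variable {M : Type*} {ℓ : ℕ} {D : ℝ} {m : ℕ} {ε η : ℝ} {c : CostFn M}
  {h h' : Fin ℓ → M} {f : Fin ℓ → ℝ≥0∞} {σ : AlgState M ℓ}

/-- The number of consecutive queries of the exploited heuristic so far. -/
def AlgState.leaderRun (σ : AlgState M ℓ) : ℕ := if σ.lastQuery = σ.leader then σ.run else 0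

/-- The coefficient of the distance between the base and the exploited heuristic in the potential
function. In an exploitation round it is proportional to the number of queries of the exploited
heuristic that are missing until its state is known. -/
def AlgState.coeff (m : ℕ) (σ : AlgState M ℓ) : ℕ :=
  if σ.wait = 0 then 1 + 6 * (m - 2 - σ.leaderRun) else 1 + 6 * m + 2 * σ.wait

/-- Whether the state of the exploited heuristic is known in the coming round. -/
def AlgState.Known (m : ℕ) (σ : AlgState M ℓ) : Prop :=
  (if σ.wait = 0 then σ.leader else σ.explored) = σ.leader ∧
    m ≤ (if (if σ.wait = 0 then σ.leader else σ.explored) = σ.lastQuery then σ.run + 1 else 1) + 1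

/-- Whether the coming round may be one with a greedy step. -/
def AlgState.Bad (m : ℕ) (σ : AlgState M ℓ) : Prop := σ.wait ≠ 0 ∨ σ.leaderRun + 2 < m

lemma AlgState.coeff_le (hσ : σ.wait ≤ m) : σ.coeff m ≤ 1 + 8 * m := by
  unfold AlgState.coeff
  split_ifs <;> omega

lemma AlgState.coeff_le_of_wait_eq_zero (hσ : σ.wait = 0) : σ.coeff m ≤ 1 + 6 * m := by
  unfold AlgState.coeff
  split_ifs
  omega

lemma AlgState.known_of_not_bad (hσ : ¬σ.Bad m) : σ.Known m := by
  obtain ⟨hwait, hrun⟩ : σ.wait = 0 ∧ m ≤ σ.leaderRun + 2 := by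
    simpa [AlgState.Bad] using hσ
  refine ⟨if_pos hwait, ?_⟩
  simp only [hwait, if_true, eq_comm (a := σ.leader)]
  unfold AlgState.leaderRun at hrun
  split_ifs at hrun ⊢ <;> omega

variable [MetricSpace M]

/-- The potential function with coefficient `κ`, where `h` are the states of the heuristics. -/
def AlgState.potentialWith (κ : ℝ≥0∞) (h : Fin ℓ → M) (σ : AlgState M ℓ) : ℝ≥0∞ :=
  σ.paid + edist σ.pos σ.base + κ * edist σ.base (h σ.leader)

/-- The potential function for the cost of the algorithm, where `h` are the states of the
heuristics. -/
def AlgState.potential (m : ℕ) (h : Fin ℓ → M) (σ : AlgState M ℓ) : ℝ≥0∞ :=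
  σ.potentialWith (σ.coeff m) h

lemma AlgState.potentialWith_mono {κ κ' : ℝ≥0∞} (hκ : κ ≤ κ') :
    σ.potentialWith κ h ≤ σ.potentialWith κ' h := by
  unfold AlgState.potentialWith
  gcongr

lemma AlgState.mul_potentialWith_add_mul_potentialWith {p q : ℝ≥0∞} (hpq : p + q = 1)
    (κ κ' : ℝ≥0∞) :
    p * σ.potentialWith κ h + q * σ.potentialWith κ' h = σ.potentialWith (p * κ + q * κ') h := by
  unfold AlgState.potentialWith
  calc _ = (p + q) * (σ.paid + edist σ.pos σ.base)
        + (p * κ + q * κ') * edist σ.base (h σ.leader) := by ring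
    _ = _ := by rw [hpq, one_mul]

lemma edist_greedy_add_le (hc : Admissible c) (b p : M) :
    edist b (greedy c b) + c (greedy c b) ≤ edist b p + c p := by
  unfold greedy
  rw [dif_pos (hc.2 b)]
  exact (hc.2 b).choose_spec p

lemma move_of_known (hσ : σ.Known m) :
    (move m c h σ).base = h σ.leader ∧ (move m c h σ).pos = h σ.leader ∧
      (move m c h σ).paid = σ.paid + (c (h σ.leader) + edist σ.pos (h σ.leader)) := by
  unfold AlgState.Known at hσ
  simp only [move, if_pos hσ, and_self]

lemma move_of_not_known (hσ : ¬σ.Known m) :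
    (move m c h σ).base = σ.base ∧ (move m c h σ).pos = greedy c σ.base ∧
      (move m c h σ).paid = σ.paid + (c (greedy c σ.base) + edist σ.pos (greedy c σ.base)) := by
  unfold AlgState.Known at hσ
  simp only [move, if_neg hσ, and_self]

lemma leaderRun_move_of_wait_eq_zero (hσ : σ.wait = 0) :
    (move m c h σ).leaderRun = σ.leaderRun + 1 := by
  simp only [AlgState.leaderRun, move, hσ, if_true, eq_comm (a := σ.leader)]
  split_ifs <;> rfl

lemma potentialWith_move_of_known (hσ : σ.Known m) (κ : ℝ≥0∞) :
    (move m c h' σ).potentialWith κ h' = (move m c h' σ).paid := by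
  obtain ⟨hbase, hpos, -⟩ := move_of_known (c := c) (h := h') hσ
  have hleader : (move m c h' σ).leader = σ.leader := rfl
  simp [AlgState.potentialWith, hbase, hpos, hleader]

lemma paid_move_of_known_le (hσ : σ.Known m) :
    (move m c h' σ).paid ≤ σ.potentialWith 1 h + moveCost c h h' σ.leader := by
  rw [(move_of_known hσ).2.2]
  calc σ.paid + (c (h' σ.leader) + edist σ.pos (h' σ.leader))
      ≤ σ.paid + (c (h' σ.leader) + (edist σ.pos σ.base + edist σ.base (h σ.leader)
          + edist (h σ.leader) (h' σ.leader))) := by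
        gcongr
        exact edist_triangle4 _ _ _ _
    _ = _ := by unfold AlgState.potentialWith moveCost; ring

/-- The greedy step costs twice as much as following the exploited heuristic from the base, as the
algorithm also has to pay for the way back. -/
lemma paid_add_edist_move_of_not_known_le (hc : Admissible c) (hσ : ¬σ.Known m) :
    (move m c h' σ).paid + edist (move m c h' σ).pos (move m c h' σ).base
      ≤ σ.potentialWith 2 h + 2 * moveCost c h h' σ.leader := by
  obtain ⟨hbase, hpos, hpaid⟩ := move_of_not_known (c := c) (h := h') hσ
  rw [hbase, hpos, hpaid]
  set p := greedy c σ.base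
  have hgreedy : edist σ.base p + c p
      ≤ edist σ.base (h σ.leader) + edist (h σ.leader) (h' σ.leader) + c (h' σ.leader) :=
    (edist_greedy_add_le hc _ _).trans (add_le_add_left (edist_triangle _ _ _) _)
  calc σ.paid + (c p + edist σ.pos p) + edist p σ.base
      ≤ σ.paid + (c p + (edist σ.pos σ.base + edist σ.base p)) + edist σ.base p + c p := by
        rw [edist_comm p]
        refine le_add_right ?_
        gcongr
        exact edist_triangle _ _ _
    _ = σ.paid + edist σ.pos σ.base + 2 * (edist σ.base p + c p) := by ring
    _ ≤ σ.paid + edist σ.pos σ.base + 2 * (edist σ.base (h σ.leader)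
          + edist (h σ.leader) (h' σ.leader) + c (h' σ.leader)) := by
        exact add_le_add_right (mul_le_mul_right hgreedy 2) _
    _ = _ := by unfold AlgState.potentialWith moveCost; ring

lemma edist_base_move_of_not_known_le (hσ : ¬σ.Known m) :
    edist (move m c h' σ).base (h' σ.leader)
      ≤ edist σ.base (h σ.leader) + moveCost c h h' σ.leader := by
  rw [(move_of_not_known hσ).1]
  exact (edist_triangle _ _ _).trans (by gcongr; exact le_add_self)

lemma potentialWith_move_le (hc : Admissible c) (κ : ℝ≥0∞) :
    (move m c h' σ).potentialWith κ h'
      ≤ σ.potentialWith (2 + κ) h + (2 + κ) * moveCost c h h' σ.leader := by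
  by_cases hσ : σ.Known m
  · have hκ : 1 ≤ 2 + κ := le_add_right one_le_two
    rw [potentialWith_move_of_known hσ]
    exact (paid_move_of_known_le hσ).trans
      (add_le_add (AlgState.potentialWith_mono hκ) (le_mul_of_one_le_left' hκ))
  · calc _ ≤ σ.potentialWith 2 h + 2 * moveCost c h h' σ.leader
          + κ * (edist σ.base (h σ.leader) + moveCost c h h' σ.leader) :=
          add_le_add (paid_add_edist_move_of_not_known_le hc hσ)
            (mul_le_mul_right (edist_base_move_of_not_known_le hσ) κ)
      _ = _ := by unfold AlgState.potentialWith; ring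

lemma mul_exploreProb_le {a b : ℝ≥0} (hε : a * ε ≤ b) : a * exploreProb ε ≤ b := by
  refine (mul_le_mul_right (min_le_right _ _) a).trans ?_
  rwa [← Real.toNNReal_coe (r := a), ← Real.toNNReal_mul a.coe_nonneg,
    Real.toNNReal_le_iff_le_coe]

lemma edist_le_add_mul_indicator {δ : ℝ≥0∞} (hM : ∀ s s' : M, edist s s' ≤ δ) (b : M)
    (h : Fin ℓ → M) (l j : Fin ℓ) :
    edist b (h j) ≤ edist b (h l) + δ * ({l}ᶜ : Set (Fin ℓ)).indicator 1 j := by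
  rcases eq_or_ne j l with rfl | hj
  · exact le_self_add
  · simpa [hj] using (edist_triangle b (h l) (h j)).trans (by gcongr; exact hM _ _)

variable [NeZero ℓ]

lemma expect_step_potential_of_wait_eq_zero (hm : m ≠ 0) (hσ : σ.wait = 0) :
    expect (step D m ε η c h' f σ) (AlgState.potential m h')
      = (move m c h' σ).potentialWith (exploreProb ε * (1 + 8 * m : ℕ)
          + (1 - exploreProb ε) * (1 + 6 * (m - 2 - (σ.leaderRun + 1)) : ℕ)) h' := by
  have hexplore (e : Fin ℓ) :
      ({ move m c h' σ with wait := m, explored := e } : AlgState M ℓ).potential m h'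
        = (move m c h' σ).potentialWith (1 + 8 * m : ℕ) h' := by
    have hcoeff : ({ move m c h' σ with wait := m, explored := e } : AlgState M ℓ).coeff m
        = 1 + 8 * m := by
      simp only [AlgState.coeff, hm, if_false]
      ring
    rw [AlgState.potential, hcoeff]
    rfl
  have hcoeff : (move m c h' σ).coeff m = 1 + 6 * (m - 2 - (σ.leaderRun + 1)) := by
    rw [AlgState.coeff, leaderRun_move_of_wait_eq_zero hσ]
    exact if_pos hσ
  simp only [expect_step_of_wait_eq_zero hσ, hexplore, expect_const]
  rw [AlgState.potential, hcoeff,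
    AlgState.mul_potentialWith_add_mul_potentialWith (exploreProb_add_one_sub ε)]

lemma expect_step_potential_le_of_not_bad (hm : m ≠ 0) (hσ : ¬σ.Bad m) :
    expect (step D m ε η c h' f σ) (AlgState.potential m h')
      ≤ σ.potential m h + moveCost c h h' σ.leader := by
  have hwait : σ.wait = 0 := not_not.1 (not_or.1 hσ).1
  rw [expect_step_potential_of_wait_eq_zero hm hwait,
    potentialWith_move_of_known (AlgState.known_of_not_bad hσ)]
  refine (paid_move_of_known_le (h := h) (AlgState.known_of_not_bad hσ)).trans ?_
  gcongr
  refine AlgState.potentialWith_mono ?_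
  rw [AlgState.coeff, if_pos hwait]
  exact_mod_cast Nat.le_add_right _ _

lemma expect_step_potential_le_of_wait_eq_zero_of_bad (hε : 2 * m * ε ≤ 1) (hc : Admissible c)
    (hwait : σ.wait = 0) (hσ : σ.Bad m) :
    expect (step D m ε η c h' f σ) (AlgState.potential m h')
      ≤ σ.potential m h + σ.coeff m * moveCost c h h' σ.leader := by
  have hrun : σ.leaderRun + 2 < m := hσ.resolve_left (not_not.2 hwait)
  set N := m - 2 - (σ.leaderRun + 1)
  have hcoeff : σ.coeff m = 7 + 6 * N := by
    rw [AlgState.coeff, if_pos hwait]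
    omega
  have hp : 8 * m * (exploreProb ε : ℝ≥0∞) ≤ 4 := by
    exact_mod_cast mul_exploreProb_le (a := 8 * m) (b := 4) (by push_cast; linarith)
  have hκ : (2 : ℝ≥0∞) + (exploreProb ε * (1 + 8 * m : ℕ) + (1 - exploreProb ε) * (1 + 6 * N : ℕ))
      ≤ σ.coeff m := by
    rw [hcoeff]
    push_cast
    calc (2 : ℝ≥0∞) + (exploreProb ε * (1 + 8 * m) + (1 - exploreProb ε) * (1 + 6 * N))
        = 2 + (exploreProb ε + (1 - exploreProb ε)) + 8 * m * exploreProb ε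
          + (1 - exploreProb ε) * (6 * N) := by ring
      _ ≤ 2 + 1 + 4 + 1 * (6 * N) := by
        rw [exploreProb_add_one_sub]
        gcongr
        exact tsub_le_self
      _ = _ := by ring
  rw [expect_step_potential_of_wait_eq_zero (by omega) hwait]
  refine (potentialWith_move_le (h := h) hc _).trans ?_
  gcongr
  exact AlgState.potentialWith_mono hκ

lemma expect_step_potential_le_of_two_le_wait (hc : Admissible c) (hσ : 2 ≤ σ.wait) :
    expect (step D m ε η c h' f σ) (AlgState.potential m h')
      ≤ σ.potential m h + σ.coeff m * moveCost c h h' σ.leader := by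
  have hcoeff : σ.coeff m
      = 2 + ({ move m c h' σ with wait := σ.wait - 1 } : AlgState M ℓ).coeff m := by
    simp only [AlgState.coeff, if_neg (show σ.wait ≠ 0 by omega),
      if_neg (show σ.wait - 1 ≠ 0 by omega)]
    omega
  rw [expect_step_of_two_le_wait hσ, AlgState.potential, AlgState.potential, hcoeff, Nat.cast_add]
  exact potentialWith_move_le hc _

lemma ofReal_mul_expect_round_leader_ne_le (hD : 0 < D) (hη : 0 ≤ η)
    (hf : ∀ i, f i ≠ ∞) {w : Fin ℓ → ℝ≥0} (hw : ∀ i, 0 < w i) (l e : Fin ℓ) :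
    ENNReal.ofReal D * expect (round (hedgeDist w) (hedgeDist (exploredWeights D η f w e)) l)
        (({l}ᶜ : Set (Fin ℓ)).indicator 1)
      ≤ ENNReal.ofReal η * f l := by
  set g := exploredLoss D f e
  have hg : 0 ≤ η * g l := mul_nonneg hη (exploredLoss_nonneg hD.le e l)
  have hle : expect (round (hedgeDist w) (hedgeDist (exploredWeights D η f w e)) l)
      (({l}ᶜ : Set (Fin ℓ)).indicator 1) ≤ 1 - ENNReal.ofReal (Real.exp (-η * g l)) :=
    expect_round_ne_le (hedgeDist_pos hw l)
      (exp_mul_hedgeDist_le_hedgeDist_hedgeUpdate hη hw (exploredLoss_nonneg hD.le e) l)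
      (Real.toNNReal_le_one.2 (Real.exp_le_one_iff.2 (by linarith)))
  calc _ ≤ ENNReal.ofReal D * (1 - ENNReal.ofReal (Real.exp (-η * g l))) := by gcongr
    _ = ENNReal.ofReal (D * (1 - Real.exp (-η * g l))) := by
      rw [ENNReal.ofReal_mul hD.le, ENNReal.ofReal_sub _ (Real.exp_pos _).le, ENNReal.ofReal_one]
    _ ≤ ENNReal.ofReal (η * (f l).toReal) := by
      refine ENNReal.ofReal_le_ofReal ?_
      calc D * (1 - Real.exp (-η * g l)) ≤ D * (η * ((f l).toReal / (2 * D))) := by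
            gcongr
            have := mul_le_mul_of_nonneg_left (exploredLoss_le (f := f) hD.le e l) hη
            linarith [Real.add_one_le_exp (-η * g l)]
        _ = η * (f l).toReal / 2 := by field_simp
        _ ≤ _ := half_le_self (by positivity)
    _ = _ := by rw [ENNReal.ofReal_mul hη, ENNReal.ofReal_toReal (hf l)]

lemma expect_step_potential_le_of_wait_eq_one (hD : 0 < D)
    (hM : ∀ s s' : M, edist s s' ≤ ENNReal.ofReal D) (hη : 0 ≤ η) (hc : Admissible c)
    (hf : ∀ i, f i ≠ ∞) (hw : ∀ i, 0 < σ.weights i) (hσ : σ.wait = 1) :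
    expect (step D m ε η c h' f σ) (AlgState.potential m h')
      ≤ σ.potential m h + σ.coeff m * moveCost c h h' σ.leader
        + (1 + 6 * m : ℕ) * (ENNReal.ofReal η * f σ.leader) := by
  have hcoeff : ((σ.coeff m : ℕ) : ℝ≥0∞) = 2 + (1 + 6 * m : ℕ) := by
    rw [AlgState.coeff, hσ]
    push_cast
    ring
  rw [expect_step_of_wait_eq_one hσ]
  set w := exploredWeights D η f σ.weights σ.explored
  have hpotential (j : Fin ℓ) :
      ({ move m c h' σ with wait := 0, weights := w, leader := j } : AlgState M ℓ).potential m h'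
        ≤ (move m c h' σ).potentialWith (1 + 6 * m : ℕ) h' + (1 + 6 * m : ℕ)
          * (ENNReal.ofReal D * ({σ.leader}ᶜ : Set (Fin ℓ)).indicator 1 j) := by
    refine (AlgState.potentialWith_mono (κ' := (1 + 6 * m : ℕ))
      (by exact_mod_cast AlgState.coeff_le_of_wait_eq_zero rfl)).trans ?_
    calc (move m c h' σ).paid + edist (move m c h' σ).pos (move m c h' σ).base
          + (1 + 6 * m : ℕ) * edist (move m c h' σ).base (h' j)
        ≤ (move m c h' σ).paid + edist (move m c h' σ).pos (move m c h' σ).base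
          + (1 + 6 * m : ℕ) * (edist (move m c h' σ).base (h' σ.leader)
            + ENNReal.ofReal D * ({σ.leader}ᶜ : Set (Fin ℓ)).indicator 1 j) := by
          gcongr
          exact edist_le_add_mul_indicator hM _ h' σ.leader j
      _ = _ := by rw [mul_add, ← add_assoc]; rfl
  refine (expect_mono fun j _ => hpotential j).trans ?_
  rw [expect_add, expect_const, expect_const_mul, expect_const_mul]
  refine add_le_add ?_
    (mul_le_mul_right (ofReal_mul_expect_round_leader_ne_le hD hη hf hw _ _) _)
  rw [AlgState.potential, hcoeff]
  exact potentialWith_move_le hc _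

/-- The factor, relative to the cost of the exploited heuristic, by which the potential function may
grow further in bad rounds. -/
def badFactor (m : ℕ) (η : ℝ) : ℝ≥0 := 8 * m + (1 + 6 * m) * η.toNNReal

theorem expect_step_potential_le (hD : 0 < D) (hM : ∀ s s' : M, edist s s' ≤ ENNReal.ofReal D)
    (hη : 0 ≤ η) (hm : m ≠ 0) (hε : 2 * m * ε ≤ 1) (hc : Admissible c)
    (hh : ∀ i, moveCost c h h' i ≠ ∞) (hσ : σ.Valid m) :
    expect (step D m ε η c h' (moveCost c h h') σ) (AlgState.potential m h')
      ≤ σ.potential m h + moveCost c h h' σ.leader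
        + {σ | σ.Bad m}.indicator (fun σ => badFactor m η * moveCost c h h' σ.leader) σ := by
  by_cases hbad : σ.Bad m
  · have hcoeff : ((σ.coeff m : ℕ) : ℝ≥0∞) ≤ 1 + 8 * m := by
      exact_mod_cast AlgState.coeff_le hσ.2
    rw [Set.indicator_of_mem (Set.mem_ofPred_eq ▸ hbad)]
    calc _ ≤ σ.potential m h + σ.coeff m * moveCost c h h' σ.leader
          + (1 + 6 * m : ℕ) * (ENNReal.ofReal η * moveCost c h h' σ.leader) := by
          rcases σ.wait_cases with hwait | hwait | hwait
          · exact le_add_right (expect_step_potential_le_of_wait_eq_zero_of_bad hε hc hwait hbad)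
          · exact expect_step_potential_le_of_wait_eq_one hD hM hη hc hh hσ.1 hwait
          · exact le_add_right (expect_step_potential_le_of_two_le_wait hc hwait)
      _ ≤ σ.potential m h + (1 + 8 * m) * moveCost c h h' σ.leader
          + (1 + 6 * m : ℕ) * (ENNReal.ofReal η * moveCost c h h' σ.leader) := by gcongr
      _ = _ := by
        unfold badFactor ENNReal.ofReal
        push_cast
        ring
  · rw [Set.indicator_of_notMem (Set.mem_ofPred_eq ▸ hbad), add_zero]
    exact expect_step_potential_le_of_not_bad hm hbad

end Greedy

namespace AlgRun

variable {M : Type*} [MetricSpace M] {ℓ : ℕ} [NeZero ℓ] {A : AlgRun M ℓ}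

lemma expectOn_leaderRun_lt_succ_le (hm : A.m ≠ 0) (n j : ℕ) (g : Fin ℓ → ℝ≥0∞) :
    expectOn (A.law (n + 1)) {σ | σ.wait = 0 ∧ σ.leaderRun < j + 1} (fun σ => g σ.leader)
      ≤ expectOn (A.law n) {σ | σ.wait = 0 ∧ σ.leaderRun < j} (fun σ => g σ.leader)
        + expectOn (A.law n) {σ | σ.wait ∈ ({1} : Set ℕ)}
            (fun σ => expect (A.next n σ) fun τ => g τ.leader) := by
  rw [expectOn, expectOn, expectOn, expect_law_succ, ← expect_add]
  refine expect_mono fun σ _ => ?_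
  rcases σ.wait_cases with hwait | hwait | hwait
  · refine le_add_right ?_
    have hrun := leaderRun_move_of_wait_eq_zero (m := A.m) (c := A.cost n) (h := A.traj (n + 1))
      hwait
    have hwait' : (move A.m (A.cost n) (A.traj (n + 1)) σ).wait = 0 := hwait
    rw [expect_step_of_wait_eq_zero hwait]
    simp only [Set.indicator_apply, Set.mem_ofPred_eq, hm, hwait', hwait, hrun, false_and, true_and,
      if_false, expect_const, mul_zero, zero_add, add_lt_add_iff_right]
    exact mul_le_of_le_one_left zero_le tsub_le_self
  · refine le_add_left ?_
    rw [Set.indicator_of_mem (Set.mem_ofPred_eq ▸ hwait)]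
    exact expect_mono fun τ _ => Set.indicator_le_self _ _ τ
  · simp [expect_step_of_two_le_wait hwait, show σ.wait - 1 ≠ 0 by omega]

lemma exp_neg_mul_expectOn_leaderRun_lt_le (hD : 0 < A.D) (hη : 0 ≤ A.η) (hm : A.m ≠ 0)
    (hε : A.ε ≤ 1 / 2) (hf : ∀ n i, A.loss n i ≤ ENNReal.ofReal (2 * A.D)) (n j : ℕ)
    (g : Fin ℓ → ℝ≥0∞) :
    (Real.exp (-A.η)).toNNReal
        * expectOn (A.law (n + j)) {σ | σ.wait = 0 ∧ σ.leaderRun < j} (fun σ => g σ.leader)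
      ≤ j * (exploreProb A.ε * 2 ^ A.m) * 2 ^ j
        * expectOn (A.law (n + j)) {σ | σ.wait = 0} fun σ => g σ.leader := by
  induction j with
  | zero => simp [expectOn, expect_const]
  | succ j ih =>
    have hnext := exp_neg_mul_expectOn_leader_next_le hD hη hf (n + j) {1} g
    have hone := expectOn_wait_eq_m_sub_leader_le hε (n + j) (i := A.m - 1) (by omega) g
    have hlater := expectOn_leader_le_two_pow_mul hε (n + j) 1 g
    rw [show A.m - (A.m - 1) = 1 by omega] at hone
    set U := expectOn (A.law (n + j)) {σ | σ.wait = 0} fun σ => g σ.leader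
    calc _ ≤ j * (exploreProb A.ε * 2 ^ A.m) * 2 ^ j * U + exploreProb A.ε * 2 ^ A.m * U := by
          refine (mul_le_mul_right (expectOn_leaderRun_lt_succ_le hm (n + j) j g) _).trans ?_
          rw [mul_add]
          exact add_le_add ih (hnext.trans hone)
      _ ≤ j * (exploreProb A.ε * 2 ^ A.m) * 2 ^ j * U
          + exploreProb A.ε * 2 ^ A.m * 2 ^ j * U := by
          exact add_le_add_right (mul_le_mul_left
            (le_mul_of_one_le_right' (one_le_pow₀ one_le_two)) U) _
      _ = (j + 1) * (exploreProb A.ε * 2 ^ A.m) * 2 ^ j * U := by ring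
      _ ≤ (j + 1) * (exploreProb A.ε * 2 ^ A.m) * 2 ^ j * (2 ^ 1
          * expectOn (A.law (n + j + 1)) {σ | σ.wait = 0} fun σ => g σ.leader) := by gcongr
      _ = _ := by
        push_cast
        rw [add_assoc]
        ring

lemma exp_neg_mul_expectOn_bad_le (hD : 0 < A.D) (hη : 0 ≤ A.η) (hm : A.m ≠ 0)
    (hε : A.ε ≤ 1 / 2) (hf : ∀ n i, A.loss n i ≤ ENNReal.ofReal (2 * A.D)) (n : ℕ)
    (g : Fin ℓ → ℝ≥0∞) :
    (Real.exp (-A.η)).toNNReal * expectOn (A.law (n + A.m)) {σ | σ.Bad A.m} (fun σ => g σ.leader)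
      ≤ 2 * A.m * 4 ^ A.m * exploreProb A.ε
        * expect (A.law (n + A.m)) fun σ => g σ.leader := by
  have hexp : ((Real.exp (-A.η)).toNNReal : ℝ≥0∞) ≤ 1 := by
    exact_mod_cast Real.toNNReal_le_one.2 (Real.exp_le_one_iff.2 (neg_nonpos.2 hη))
  have hwait := expectOn_wait_ne_zero_leader_le hε (n + A.m) g
  have hrun := exp_neg_mul_expectOn_leaderRun_lt_le hD hη hm hε hf n A.m g
  have hfour : (2 : ℝ≥0∞) ^ A.m * 2 ^ A.m = 4 ^ A.m := by rw [← mul_pow]; norm_num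
  have hsub : {σ : AlgState M ℓ | σ.Bad A.m}
      ⊆ {σ | σ.wait ≠ 0} ∪ {σ | σ.wait = 0 ∧ σ.leaderRun < A.m} := fun σ hσ => by
    simp only [AlgState.Bad, Set.mem_ofPred_eq, Set.mem_union] at hσ ⊢
    omega
  set U := expectOn (A.law (n + A.m)) {σ | σ.wait = 0} fun σ => g σ.leader
  calc _ ≤ (Real.exp (-A.η)).toNNReal
          * (expectOn (A.law (n + A.m)) {σ | σ.wait ≠ 0} (fun σ => g σ.leader)
            + expectOn (A.law (n + A.m)) {σ | σ.wait = 0 ∧ σ.leaderRun < A.m}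
              fun σ => g σ.leader) := by
        gcongr
        exact expectOn_le_add_of_subset_union hsub
    _ ≤ A.m * (exploreProb A.ε * 2 ^ A.m) * U
          + A.m * (exploreProb A.ε * 2 ^ A.m) * 2 ^ A.m * U := by
        rw [mul_add]
        exact add_le_add ((mul_le_of_le_one_left zero_le hexp).trans hwait) hrun
    _ = A.m * exploreProb A.ε * 2 ^ A.m * U
          + A.m * exploreProb A.ε * (2 ^ A.m * 2 ^ A.m) * U := by ring
    _ ≤ A.m * exploreProb A.ε * 4 ^ A.m * U + A.m * exploreProb A.ε * 4 ^ A.m * U := by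
        rw [hfour]
        gcongr
        norm_num
    _ = 2 * A.m * 4 ^ A.m * exploreProb A.ε * U := by ring
    _ ≤ _ := by
      gcongr
      exact expectOn_le_expect fun _ _ _ => le_rfl

/-! ### The regret of HEDGE on the sampled losses -/

lemma expect_hedgePotential_succ_add_le (hD : 0 < A.D) (hη : 0 ≤ A.η)
    (hf : ∀ n i, A.loss n i ≤ ENNReal.ofReal (2 * A.D)) (n : ℕ) (i : Fin ℓ) :
    expect (A.law (n + 1)) (fun σ => ENNReal.ofReal (hedgePotential σ.weights i))
        + ENNReal.ofReal (1 - Real.exp (-A.η)) * expectOn (A.law n) {σ | σ.wait = 1}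
            (fun σ => ENNReal.ofReal (exploredLoss A.D (A.loss n) σ.explored σ.leader))
      ≤ expect (A.law n) (fun σ => ENNReal.ofReal (hedgePotential σ.weights i))
        + ENNReal.ofReal A.η * expectOn (A.law n) {σ | σ.wait = 1}
            fun σ => ENNReal.ofReal (exploredLoss A.D (A.loss n) σ.explored i) := by
  have hleader := A.expect_law_eq_sum_hedgeDist n
    (fun _ l k e => if k = 1 then ENNReal.ofReal (exploredLoss A.D (A.loss n) e l) else 0)
    fun _ _ _ _ => rfl
  have hite (F : AlgState M ℓ → ℝ≥0∞) : expectOn (A.law n) {σ | σ.wait = 1} F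
      = expect (A.law n) fun σ => if σ.wait = 1 then F σ else 0 :=
    expect_congr fun σ _ => Set.indicator_apply _ _ _
  rw [hite, hite, hleader, expect_law_succ, ← expect_const_mul, ← expect_const_mul, ← expect_add,
    ← expect_add]
  refine expect_mono fun σ hσ => ?_
  rcases σ.wait_cases with hwait | hwait | hwait
  · simp [expect_step_of_wait_eq_zero hwait, hwait, move, expect_const, ← add_mul,
      exploreProb_add_one_sub]
  · have hw := (valid_of_mem_support_law hσ).1
    have hloss := exploredLoss_mem_Icc hD (hf n) σ.explored
    have hγ : 0 ≤ 1 - Real.exp (-A.η) := sub_nonneg.2 (Real.exp_le_one_iff.2 (neg_nonpos.2 hη))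
    have hsum : ∑ j, (hedgeDist σ.weights j : ℝ≥0∞)
          * ENNReal.ofReal (exploredLoss A.D (A.loss n) σ.explored j)
        = ENNReal.ofReal
          (∑ j, hedgeDist σ.weights j * exploredLoss A.D (A.loss n) σ.explored j) := by
      rw [ENNReal.ofReal_sum_of_nonneg fun j _ => mul_nonneg (NNReal.coe_nonneg _) (hloss j).1]
      simp only [ENNReal.ofReal_mul (NNReal.coe_nonneg _), ENNReal.ofReal_coe_nnreal]
    simp only [expect_step_of_wait_eq_one hwait, hwait, if_true, expect_const, hsum]
    rw [← ENNReal.ofReal_mul hγ, ← ENNReal.ofReal_mul hη,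
      ← ENNReal.ofReal_add (hedgePotential_nonneg (exploredWeights_pos hw _) i)
        (mul_nonneg hγ (Finset.sum_nonneg fun j _ =>
          mul_nonneg (NNReal.coe_nonneg _) (hloss j).1)),
      ← ENNReal.ofReal_add (hedgePotential_nonneg hw i) (mul_nonneg hη (hloss i).1)]
    exact ENNReal.ofReal_le_ofReal (hedgePotential_hedgeUpdate_add_le hw hloss i)
  · simp [expect_step_of_two_le_wait hwait, show σ.wait ≠ 1 by omega, move]

variable (A) in
/-- The probability that a given heuristic is explored `m` rounds after an exploitation round,
divided by the scale `2 * D` of the losses. -/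
def samplingRate : ℝ≥0∞ := exploreProb A.ε * ((ℓ : ℝ≥0∞)⁻¹ / ENNReal.ofReal (2 * A.D))

lemma expectOn_wait_eq_one_exploredLoss (hD : 0 < A.D) (hm : A.m ≠ 0)
    (hf : ∀ n i, A.loss n i ≠ ∞) (n k : ℕ) (j : Fin ℓ → Fin ℓ) :
    expectOn (A.law (n + A.m)) {σ | σ.wait = 1}
        (fun σ => ENNReal.ofReal (exploredLoss A.D (A.loss k) σ.explored (j σ.leader)))
      = A.samplingRate
        * expectOn (A.law n) {σ | σ.wait = 0} fun σ => A.loss k (j σ.leader) := by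
  have hone := expectOn_wait_eq_m_sub (A := A) n (i := A.m - 1) (by omega)
    fun _ l e => ENNReal.ofReal (exploredLoss A.D (A.loss k) e (j l))
  rw [show A.m - (A.m - 1) = 1 by omega, show A.m - 1 + 1 = A.m by omega] at hone
  rw [hone, samplingRate, mul_assoc]
  simp only [expect_uniform_exploredLoss hD (hf k _), expectOn_const_mul]

lemma expect_hedgePotential_le_log (hD : 0 < A.D) (hη : 0 ≤ A.η)
    (hf : ∀ n i, A.loss n i ≤ ENNReal.ofReal (2 * A.D)) {n : ℕ} (hn : n ≤ A.m) (i : Fin ℓ) :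
    expect (A.law n) (fun σ => ENNReal.ofReal (hedgePotential σ.weights i))
      ≤ ENNReal.ofReal (Real.log ℓ) := by
  induction n with
  | zero => simp [expect_law_zero, expect_fresh, hedgePotential_one, expect_const]
  | succ n ih =>
    have hzero := expectOn_wait_eq_m_sub_eq_zero (A := A) (n := n) (i := A.m - 1) (by omega)
      (by omega) fun _ _ e => ENNReal.ofReal (exploredLoss A.D (A.loss n) e i)
    rw [show A.m - (A.m - 1) = 1 by omega] at hzero
    have hsucc := le_self_add.trans (expect_hedgePotential_succ_add_le hD hη hf n i)
    rw [hzero, mul_zero, add_zero] at hsucc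
    exact hsucc.trans (ih (by omega))

theorem sum_expectOn_leader_loss_le (hD : 0 < A.D) (hη : 0 ≤ A.η) (hm : A.m ≠ 0)
    (hf : ∀ n i, A.loss n i ≤ ENNReal.ofReal (2 * A.D)) (N : ℕ) (i : Fin ℓ) :
    ENNReal.ofReal (1 - Real.exp (-A.η)) * A.samplingRate * ∑ n ∈ Finset.range N,
          expectOn (A.law n) {σ | σ.wait = 0} (fun σ => A.loss (n + A.m) σ.leader)
        + expect (A.law (N + A.m)) (fun σ => ENNReal.ofReal (hedgePotential σ.weights i))
      ≤ ENNReal.ofReal (Real.log ℓ)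
        + ENNReal.ofReal A.η * A.samplingRate * ∑ n ∈ Finset.range N, A.loss (n + A.m) i := by
  induction N with
  | zero => simpa using expect_hedgePotential_le_log hD hη hf le_rfl i
  | succ N ih =>
    have hne (n : ℕ) (j : Fin ℓ) : A.loss n j ≠ ∞ := ((hf n j).trans_lt ENNReal.ofReal_lt_top).ne
    have hround := expect_hedgePotential_succ_add_le hD hη hf (N + A.m) i
    rw [expectOn_wait_eq_one_exploredLoss hD hm hne N (N + A.m) fun l => l,
      expectOn_wait_eq_one_exploredLoss hD hm hne N (N + A.m) fun _ => i,
      ← mul_assoc, ← mul_assoc] at hround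
    have hconst : expectOn (A.law N) {σ | σ.wait = 0} (fun _ => A.loss (N + A.m) i)
        ≤ A.loss (N + A.m) i :=
      (expectOn_le_expect fun _ _ _ => le_rfl).trans_eq (expect_const _ _)
    rw [Finset.sum_range_succ, Finset.sum_range_succ, mul_add, mul_add, add_right_comm,
      ← add_assoc, show N + 1 + A.m = N + A.m + 1 by omega]
    set a := ENNReal.ofReal (1 - Real.exp (-A.η)) * A.samplingRate
    set b := ENNReal.ofReal A.η * A.samplingRate
    set S := ∑ n ∈ Finset.range N,
      expectOn (A.law n) {σ | σ.wait = 0} (fun σ => A.loss (n + A.m) σ.leader)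
    set pot := fun n => expect (A.law n) fun σ => ENNReal.ofReal (hedgePotential σ.weights i)
    change a * S + pot (N + A.m + 1) + _ ≤ _
    rw [add_assoc]
    calc _ ≤ a * S + (pot (N + A.m) + b * A.loss (N + A.m) i) :=
          add_le_add_right (hround.trans (add_le_add_right (mul_le_mul_right hconst _) _)) _
      _ ≤ _ := by
        rw [← add_assoc]
        exact add_le_add_left ih _

/-! ### The cost in terms of the costs of the leaders -/

lemma expect_law_zero_potential_le (hM : ∀ s s' : M, edist s s' ≤ ENNReal.ofReal A.D) :
    expect (A.law 0) (AlgState.potential A.m (A.traj 0))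
      ≤ expect A.start (fun σ => σ.paid) + (1 + 6 * A.m) * ENNReal.ofReal A.D := by
  rw [expect_law_zero, ← expect_const A.start ((1 + 6 * A.m : ℝ≥0∞) * _), ← expect_add]
  refine expect_mono fun σ _ => ?_
  rw [expect_fresh]
  refine expect_le_of_forall_le fun i _ => ?_
  simp only [AlgState.potential, AlgState.potentialWith, edist_self, add_zero]
  gcongr
  · exact_mod_cast AlgState.coeff_le_of_wait_eq_zero rfl
  · exact hM _ _

theorem expect_potential_le (hD : 0 < A.D) (hM : ∀ s s' : M, edist s s' ≤ ENNReal.ofReal A.D)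
    (hη : 0 ≤ A.η) (hm : A.m ≠ 0) (hε : 2 * A.m * A.ε ≤ 1) (hc : ∀ n, Admissible (A.cost n))
    (hf : ∀ n i, A.loss n i ≠ ∞) (N : ℕ) :
    expect (A.law N) (AlgState.potential A.m (A.traj N))
      ≤ expect A.start (fun σ => σ.paid) + (1 + 6 * A.m) * ENNReal.ofReal A.D
        + ∑ n ∈ Finset.range N, (expect (A.law n) (fun σ => A.loss n σ.leader)
          + badFactor A.m A.η
            * expectOn (A.law n) {σ | σ.Bad A.m} fun σ => A.loss n σ.leader) := by
  induction N with
  | zero => simpa using expect_law_zero_potential_le hM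
  | succ N ih =>
    rw [expect_law_succ, Finset.sum_range_succ, ← add_assoc]
    refine le_trans ?_ (add_le_add_left ih _)
    rw [← expectOn_const_mul, expectOn, ← expect_add, ← expect_add]
    refine expect_mono fun σ hσ => ?_
    rw [← add_assoc]
    exact expect_step_potential_le hD hM hη hm hε (hc N) (hf N) (valid_of_mem_support_law hσ)

end AlgRun

lemma coe_exploreProb {ε : ℝ} (hε : ε ≤ 1) : (exploreProb ε : ℝ≥0∞) = ENNReal.ofReal ε := by
  rw [exploreProb, min_eq_right (Real.toNNReal_le_one.2 hε)]
  rfl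

lemma one_add_ofReal_le_ofReal_exp {a : ℝ} (ha : 0 ≤ a) :
    1 + ENNReal.ofReal a ≤ ENNReal.ofReal (Real.exp a) := by
  rw [← ENNReal.ofReal_one, ← ENNReal.ofReal_add zero_le_one ha]
  exact ENNReal.ofReal_le_ofReal (by linarith [Real.add_one_le_exp a])

lemma le_ofReal_exp_mul {a : ℝ} {x y : ℝ≥0∞} (h : (Real.exp (-a)).toNNReal * x ≤ y) :
    x ≤ ENNReal.ofReal (Real.exp a) * y := by
  calc x = ENNReal.ofReal (Real.exp a) * (ENNReal.ofReal (Real.exp (-a)) * x) := by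
        rw [← mul_assoc, ← ENNReal.ofReal_mul (Real.exp_pos _).le, ← Real.exp_add, add_neg_cancel,
          Real.exp_zero, ENNReal.ofReal_one, one_mul]
    _ ≤ _ := by gcongr; exact h

namespace AlgRun

variable {M : Type*} [MetricSpace M] {ℓ : ℕ} [NeZero ℓ] {A : AlgRun M ℓ}

lemma expect_leader_add_le (hD : 0 < A.D) (hη : 0 ≤ A.η)
    (hf : ∀ n i, A.loss n i ≤ ENNReal.ofReal (2 * A.D)) (n k : ℕ) (g : Fin ℓ → ℝ≥0∞) :
    expect (A.law (n + k)) (fun σ => g σ.leader)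
      ≤ ENNReal.ofReal (Real.exp (k * A.η)) * expect (A.law n) fun σ => g σ.leader := by
  refine le_ofReal_exp_mul (le_trans (le_of_eq ?_)
    (exp_neg_pow_mul_expect_leader_add_le hD hη hf n k g))
  rw [← mul_neg, Real.exp_nat_mul, Real.toNNReal_pow (Real.exp_pos _).le, ENNReal.coe_pow]

lemma expect_leader_le_mul_expectOn (hε₀ : 0 ≤ A.ε) (hε : A.ε ≤ 1 / 2) (n : ℕ)
    (g : Fin ℓ → ℝ≥0∞) :
    expect (A.law n) (fun σ => g σ.leader)
      ≤ ENNReal.ofReal (Real.exp (A.m * 2 ^ A.m * A.ε))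
        * expectOn (A.law n) {σ | σ.wait = 0} fun σ => g σ.leader := by
  have hprob : (A.m * (exploreProb A.ε * 2 ^ A.m) : ℝ≥0∞)
      = ENNReal.ofReal (A.m * 2 ^ A.m * A.ε) := by
    rw [coe_exploreProb (by linarith), ENNReal.ofReal_mul (by positivity),
      ENNReal.ofReal_mul (by positivity), ENNReal.ofReal_natCast, ENNReal.ofReal_pow (by norm_num),
      ENNReal.ofReal_ofNat]
    ring
  have hwait := expectOn_wait_ne_zero_leader_le hε n g
  rw [hprob] at hwait
  calc _ = expectOn (A.law n) Set.univ fun σ => g σ.leader := (expectOn_univ _ _).symm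
    _ ≤ expectOn (A.law n) {σ | σ.wait = 0} (fun σ => g σ.leader)
          + expectOn (A.law n) {σ | σ.wait ≠ 0} fun σ => g σ.leader :=
        expectOn_le_add_of_subset_union fun σ _ => em (σ.wait = 0)
    _ ≤ (1 + ENNReal.ofReal (A.m * 2 ^ A.m * A.ε))
          * expectOn (A.law n) {σ | σ.wait = 0} fun σ => g σ.leader := by
        rw [add_mul, one_mul]
        gcongr
    _ ≤ _ := by
      gcongr
      exact one_add_ofReal_le_ofReal_exp (by positivity)

lemma expect_leader_add_mul_expectOn_bad_le (hD : 0 < A.D) (hη : 0 ≤ A.η) (hm : A.m ≠ 0)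
    (hε₀ : 0 ≤ A.ε) (hε : A.ε ≤ 1 / 2) (hf : ∀ n i, A.loss n i ≤ ENNReal.ofReal (2 * A.D))
    (n : ℕ) (b : ℝ≥0) (g : Fin ℓ → ℝ≥0∞) :
    expect (A.law (n + A.m)) (fun σ => g σ.leader)
        + b * expectOn (A.law (n + A.m)) {σ | σ.Bad A.m} (fun σ => g σ.leader)
      ≤ ENNReal.ofReal (Real.exp (b * Real.exp A.η * (2 * A.m * 4 ^ A.m) * A.ε))
        * expect (A.law (n + A.m)) fun σ => g σ.leader := by
  have hbad := le_ofReal_exp_mul (exp_neg_mul_expectOn_bad_le hD hη hm hε hf n g)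
  set v := expect (A.law (n + A.m)) fun σ => g σ.leader
  calc _ ≤ v + b * (ENNReal.ofReal (Real.exp A.η)
          * (2 * A.m * 4 ^ A.m * exploreProb A.ε * v)) := by gcongr
    _ = (1 + ENNReal.ofReal (b * Real.exp A.η * (2 * A.m * 4 ^ A.m) * A.ε)) * v := by
      rw [coe_exploreProb (by linarith), ENNReal.ofReal_mul (by positivity),
        ENNReal.ofReal_mul (by positivity), ENNReal.ofReal_mul (by positivity),
        ENNReal.ofReal_mul (by positivity), ENNReal.ofReal_mul (by positivity),
        ENNReal.ofReal_natCast, ENNReal.ofReal_pow (by norm_num), ENNReal.ofReal_ofNat,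
        ENNReal.ofReal_ofNat, ENNReal.ofReal_coe_nnreal]
      ring
    _ ≤ _ := by
      gcongr
      exact one_add_ofReal_le_ofReal_exp (by positivity)

variable (A) in
/-- `exp roundExponent` is the factor between the cost of the algorithm in a round and the cost of
the leader exploited `m` rounds before. -/
def roundExponent : ℝ :=
  badFactor A.m A.η * Real.exp A.η * (2 * A.m * 4 ^ A.m) * A.ε + A.m * A.η + A.m * 2 ^ A.m * A.ε

lemma expect_leader_add_badFactor_mul_expectOn_bad_le (hD : 0 < A.D) (hη : 0 ≤ A.η) (hm : A.m ≠ 0)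
    (hε₀ : 0 ≤ A.ε) (hε : A.ε ≤ 1 / 2) (hf : ∀ n i, A.loss n i ≤ ENNReal.ofReal (2 * A.D))
    (n : ℕ) (g : Fin ℓ → ℝ≥0∞) :
    expect (A.law (n + A.m)) (fun σ => g σ.leader)
        + badFactor A.m A.η * expectOn (A.law (n + A.m)) {σ | σ.Bad A.m} (fun σ => g σ.leader)
      ≤ ENNReal.ofReal (Real.exp A.roundExponent)
        * expectOn (A.law n) {σ | σ.wait = 0} fun σ => g σ.leader := by
  refine (expect_leader_add_mul_expectOn_bad_le hD hη hm hε₀ hε hf n _ g).trans ?_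
  rw [roundExponent, Real.exp_add, Real.exp_add, ENNReal.ofReal_mul (by positivity),
    ENNReal.ofReal_mul (by positivity), mul_assoc (ENNReal.ofReal _),
    mul_assoc (ENNReal.ofReal _), mul_assoc (ENNReal.ofReal _)]
  gcongr
  refine (expect_leader_add_le hD hη hf n A.m g).trans ?_
  gcongr
  exact expect_leader_le_mul_expectOn hε₀ hε n g

lemma sum_expectOn_leader_loss_le_of_log_le (hD : 0 < A.D) (hη : 0 < A.η) (hm : A.m ≠ 0)
    (hε₀ : 0 < A.ε) (hε : A.ε ≤ 1 / 2) (hf : ∀ n i, A.loss n i ≤ ENNReal.ofReal (2 * A.D)) {V : ℝ}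
    (hV : 2 * A.D * (ℓ * Real.log ℓ) ≤ V * ((1 - Real.exp (-A.η)) * A.ε)) (N : ℕ) (i : Fin ℓ) :
    ∑ n ∈ Finset.range N,
        expectOn (A.law n) {σ | σ.wait = 0} (fun σ => A.loss (n + A.m) σ.leader)
      ≤ ENNReal.ofReal V
        + ENNReal.ofReal (Real.exp A.η) * ∑ n ∈ Finset.range N, A.loss (n + A.m) i := by
  have hregret := le_self_add.trans (sum_expectOn_leader_loss_le hD hη.le hm hf N i)
  have hγ : 0 < 1 - Real.exp (-A.η) := sub_pos.2 (Real.exp_lt_one_iff.2 (neg_neg_iff_pos.2 hη))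
  have hℓ : (0 : ℝ) < ℓ := by exact_mod_cast NeZero.pos ℓ
  set q := A.ε / (ℓ * (2 * A.D)) with hq
  have hqpos : 0 < q := by positivity
  have hrate : A.samplingRate = ENNReal.ofReal q := by
    rw [samplingRate, coe_exploreProb (by linarith), hq, ENNReal.ofReal_div_of_pos (by positivity),
      ENNReal.ofReal_mul hℓ.le, ENNReal.ofReal_natCast, div_eq_mul_inv, div_eq_mul_inv,
      ENNReal.mul_inv (.inr ENNReal.ofReal_ne_top) (.inl (ENNReal.natCast_ne_top ℓ))]
  rw [hrate, ← ENNReal.ofReal_mul hγ.le, ← ENNReal.ofReal_mul hη.le] at hregret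
  have hcancel : ENNReal.ofReal ((1 - Real.exp (-A.η)) * q) ≠ 0 :=
    (ENNReal.ofReal_pos.2 (mul_pos hγ hqpos)).ne'
  rw [← ENNReal.mul_le_mul_iff_right hcancel ENNReal.ofReal_ne_top, mul_add, ← mul_assoc,
    ← ENNReal.ofReal_mul (mul_pos hγ hqpos).le, ← ENNReal.ofReal_mul (mul_pos hγ hqpos).le]
  refine hregret.trans ?_
  refine add_le_add (ENNReal.ofReal_le_ofReal ?_)
    (mul_le_mul_left (ENNReal.ofReal_le_ofReal ?_) _)
  · rw [hq, show (1 - Real.exp (-A.η)) * (A.ε / (ℓ * (2 * A.D))) * V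
      = V * ((1 - Real.exp (-A.η)) * A.ε) / (2 * A.D * ℓ) by field_simp,
      le_div_iff₀ (by positivity)]
    linarith
  · have hexp : (1 - Real.exp (-A.η)) * Real.exp A.η = Real.exp A.η - 1 := by
      rw [sub_mul, ← Real.exp_add, neg_add_cancel, Real.exp_zero, one_mul]
    calc A.η * q ≤ (Real.exp A.η - 1) * q := by
          gcongr
          linarith [Real.add_one_le_exp A.η]
      _ = _ := by rw [← hexp]; ring

lemma sum_expectOn_leader_loss_le_of_subsingleton [Subsingleton (Fin ℓ)] (N : ℕ) (i : Fin ℓ) :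
    ∑ n ∈ Finset.range N,
        expectOn (A.law n) {σ | σ.wait = 0} (fun σ => A.loss (n + A.m) σ.leader)
      ≤ ∑ n ∈ Finset.range N, A.loss (n + A.m) i :=
  Finset.sum_le_sum fun n _ => (expectOn_le_expect fun σ _ _ => by
    rw [Subsingleton.elim σ.leader i]).trans_eq (expect_const _ _)

variable (A) in
/-- The cost of the rounds before the losses of HEDGE are available. -/
def startupCost : ℝ := (1 + 6 * A.m) * A.D + A.m * ((1 + badFactor A.m A.η) * (2 * A.D))

omit [MetricSpace M] [NeZero ℓ] in
lemma ofReal_startupCost (hD : 0 ≤ A.D) :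
    ENNReal.ofReal A.startupCost = (1 + 6 * A.m) * ENNReal.ofReal A.D
      + A.m * ((1 + badFactor A.m A.η) * ENNReal.ofReal (2 * A.D)) := by
  rw [startupCost, ENNReal.ofReal_add (by positivity) (by positivity),
    ENNReal.ofReal_mul (by positivity), ENNReal.ofReal_mul (by positivity),
    ENNReal.ofReal_mul (p := 1 + _) (by positivity), ENNReal.ofReal_add zero_le_one (by positivity),
    ENNReal.ofReal_add zero_le_one (by positivity), ENNReal.ofReal_mul (p := 6) (by positivity),
    ENNReal.ofReal_natCast, ENNReal.ofReal_one, ENNReal.ofReal_coe_nnreal, ENNReal.ofReal_ofNat]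

variable (A) in
/-- The bound on the growth of the potential function in round `n`. -/
def roundCost (n : ℕ) : ℝ≥0∞ :=
  expect (A.law n) (fun σ => A.loss n σ.leader)
    + badFactor A.m A.η * expectOn (A.law n) {σ | σ.Bad A.m} fun σ => A.loss n σ.leader

lemma roundCost_le (hf : ∀ n i, A.loss n i ≤ ENNReal.ofReal (2 * A.D)) (n : ℕ) :
    A.roundCost n ≤ (1 + badFactor A.m A.η) * ENNReal.ofReal (2 * A.D) := by
  rw [roundCost, add_mul, one_mul]
  gcongr
  · exact expect_le_of_forall_le fun σ _ => hf n _
  · exact (expectOn_le_expect fun σ _ _ => hf n _).trans_eq (expect_const _ _)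

lemma sum_roundCost_le_of_le (hf : ∀ n i, A.loss n i ≤ ENNReal.ofReal (2 * A.D)) {N : ℕ}
    (hN : N ≤ A.m) :
    ∑ n ∈ Finset.range N, A.roundCost n
      ≤ A.m * ((1 + badFactor A.m A.η) * ENNReal.ofReal (2 * A.D)) := by
  refine (Finset.sum_le_card_nsmul _ _ _ fun n _ => roundCost_le hf n).trans ?_
  rw [Finset.card_range, nsmul_eq_mul]
  gcongr

lemma sum_roundCost_le (hD : 0 < A.D) (hη : 0 ≤ A.η) (hm : A.m ≠ 0)
    (hε₀ : 0 ≤ A.ε) (hε : A.ε ≤ 1 / 2) (hf : ∀ n i, A.loss n i ≤ ENNReal.ofReal (2 * A.D)) {V : ℝ}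
    (hV : 2 * A.D * (ℓ * Real.log ℓ) ≤ V * ((1 - Real.exp (-A.η)) * A.ε))
    (hℓ : ℓ = 1 ∨ 0 < A.η ∧ 0 < A.ε) (N : ℕ) (i : Fin ℓ) :
    ∑ n ∈ Finset.range N, A.roundCost n
      ≤ A.m * ((1 + badFactor A.m A.η) * ENNReal.ofReal (2 * A.D))
        + ENNReal.ofReal (Real.exp (A.roundExponent + A.η))
          * (ENNReal.ofReal V + ∑ n ∈ Finset.range N, A.loss n i) := by
  rcases le_total N A.m with hN | hN
  · exact le_add_right (sum_roundCost_le_of_le hf hN)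
  obtain ⟨N, rfl⟩ := Nat.exists_eq_add_of_le hN
  have hone : 1 ≤ ENNReal.ofReal (Real.exp A.η) := ENNReal.one_le_ofReal.2 (Real.one_le_exp hη)
  have hleader : ∑ n ∈ Finset.range N,
        expectOn (A.law n) {σ | σ.wait = 0} (fun σ => A.loss (n + A.m) σ.leader)
      ≤ ENNReal.ofReal V
        + ENNReal.ofReal (Real.exp A.η) * ∑ n ∈ Finset.range N, A.loss (n + A.m) i := by
    rcases hℓ with rfl | ⟨hη, hε₀⟩
    · exact le_add_left ((sum_expectOn_leader_loss_le_of_subsingleton N i).trans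
        (le_mul_of_one_le_left' hone))
    · exact sum_expectOn_leader_loss_le_of_log_le hD hη hm hε₀ hε hf hV N i
  rw [Finset.sum_range_add, Finset.sum_range_add]
  simp only [add_comm A.m]
  refine add_le_add (sum_roundCost_le_of_le hf le_rfl) ?_
  calc _ ≤ ∑ n ∈ Finset.range N, ENNReal.ofReal (Real.exp A.roundExponent)
          * expectOn (A.law n) {σ | σ.wait = 0} (fun σ => A.loss (n + A.m) σ.leader) :=
        Finset.sum_le_sum fun n _ =>
          expect_leader_add_badFactor_mul_expectOn_bad_le hD hη hm hε₀ hε hf n (A.loss (n + A.m))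
    _ ≤ ENNReal.ofReal (Real.exp A.roundExponent) * (ENNReal.ofReal V
          + ENNReal.ofReal (Real.exp A.η) * ∑ n ∈ Finset.range N, A.loss (n + A.m) i) := by
        rw [← Finset.mul_sum]
        gcongr
    _ ≤ ENNReal.ofReal (Real.exp A.roundExponent) * (ENNReal.ofReal (Real.exp A.η)
          * (ENNReal.ofReal V + ∑ n ∈ Finset.range N, A.loss (n + A.m) i)) := by
        rw [mul_add (ENNReal.ofReal (Real.exp A.η))]
        gcongr
        exact le_mul_of_one_le_left' hone
    _ ≤ _ := by
        rw [← mul_assoc, ← ENNReal.ofReal_mul (Real.exp_pos _).le, ← Real.exp_add]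
        gcongr
        exact le_add_self

theorem expect_paid_le (hD : 0 < A.D) (hM : ∀ s s' : M, edist s s' ≤ ENNReal.ofReal A.D)
    (hη : 0 ≤ A.η) (hm : 2 ≤ A.m) (hε₀ : 0 ≤ A.ε) (hε : 2 * A.m * A.ε ≤ 1)
    (hc : ∀ n, Admissible (A.cost n)) (hf : ∀ n i, A.loss n i ≤ ENNReal.ofReal (2 * A.D)) {V : ℝ}
    (hV : 2 * A.D * (ℓ * Real.log ℓ) ≤ V * ((1 - Real.exp (-A.η)) * A.ε))
    (hℓ : ℓ = 1 ∨ 0 < A.η ∧ 0 < A.ε) (N : ℕ) (i : Fin ℓ) :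
    expect (A.law N) (fun σ => σ.paid)
      ≤ expect A.start (fun σ => σ.paid) + ENNReal.ofReal A.startupCost
        + ENNReal.ofReal (Real.exp (A.roundExponent + A.η))
          * (ENNReal.ofReal V + ∑ n ∈ Finset.range N, A.loss n i) := by
  have hm' : (2 : ℝ) ≤ A.m := by exact_mod_cast hm
  have hm₀ : A.m ≠ 0 := by omega
  calc _ ≤ expect (A.law N) (AlgState.potential A.m (A.traj N)) :=
        expect_mono fun σ _ => le_self_add.trans le_self_add
    _ ≤ expect A.start (fun σ => σ.paid) + (1 + 6 * A.m) * ENNReal.ofReal A.D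
          + ∑ n ∈ Finset.range N, A.roundCost n :=
        expect_potential_le hD hM hη hm₀ hε hc
          (fun n j => ((hf n j).trans_lt ENNReal.ofReal_lt_top).ne) N
    _ ≤ _ := by
        rw [ofReal_startupCost hD.le, ← add_assoc, add_assoc _ (_ * (_ * _))]
        gcongr
        exact sum_roundCost_le hD hη hm₀ hε₀ (by nlinarith) hf hV hℓ N i

end AlgRun

/-! ### The offline optimum -/

section Offline

variable {M : Type*} [MetricSpace M] {s₀ : M} {c : ℕ → CostFn M} {Δ : ℝ≥0∞}

lemma pathCost_self (s : ℕ → M) (a : ℕ) : pathCost c s a a = 0 := by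
  rw [pathCost, Finset.Ico_self, Finset.sum_empty]

lemma pathCost_succ (s : ℕ → M) {a t : ℕ} (h : a ≤ t) :
    pathCost c s a (t + 1) = pathCost c s a t + (c t (s t) + edist (s (t - 1)) (s t)) :=
  Finset.sum_Ico_succ_top h _

lemma pathCost_succ_bot (s : ℕ → M) {a b : ℕ} (h : a < b) :
    pathCost c s a b = c a (s a) + edist (s (a - 1)) (s a) + pathCost c s (a + 1) b :=
  Finset.sum_eq_sum_Ico_succ_bot h _

lemma pathCost_add (s : ℕ → M) {a b e : ℕ} (hab : a ≤ b) (hbe : b ≤ e) :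
    pathCost c s a b + pathCost c s b e = pathCost c s a e :=
  Finset.sum_Ico_consecutive _ hab hbe

lemma pathCost_congr {s s' : ℕ → M} {a b : ℕ} (h : ∀ t, a ≤ t + 1 → t < b → s t = s' t) :
    pathCost c s a b = pathCost c s' a b := by
  refine Finset.sum_congr rfl fun t ht => ?_
  rw [Finset.mem_Ico] at ht
  rw [h t (by omega) ht.2, h (t - 1) (by omega) (by omega)]

lemma pathCost_mono (s : ℕ → M) {a a' b b' : ℕ} (ha : a' ≤ a) (hb : b ≤ b') :
    pathCost c s a b ≤ pathCost c s a' b' :=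
  Finset.sum_le_sum_of_subset (Finset.Ico_subset_Ico ha hb)

lemma exists_pathCost_succ_le (hM : ∀ s s' : M, edist s s' ≤ Δ) (hc : ∀ t, Admissible (c t))
    (s : ℕ → M) {a t : ℕ} (h : a ≤ t) :
    ∃ s' : ℕ → M, (∀ i, i ≠ t → s' i = s i) ∧
      pathCost c s' a (t + 1) ≤ pathCost c s a t + Δ := by
  obtain ⟨z, hz⟩ := (hc t).1
  refine ⟨Function.update s t z, fun i hi => Function.update_of_ne hi _ _, ?_⟩
  rw [pathCost_succ _ h, Function.update_self, hz, zero_add]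
  exact add_le_add (pathCost_congr fun i _ hi => Function.update_of_ne hi.ne _ _).le (hM _ _)

lemma offlineOn_self [Nonempty M] (a : ℕ) : offlineOn c a a = 0 := by
  simp only [offlineOn, pathCost_self, iInf_const]

lemma offlineOn_succ_le (hM : ∀ s s' : M, edist s s' ≤ Δ) (hc : ∀ t, Admissible (c t))
    {a t : ℕ} (h : a ≤ t) : offlineOn c a (t + 1) ≤ offlineOn c a t + Δ := by
  rw [offlineOn, offlineOn, ENNReal.iInf_add]
  refine le_iInf fun s => ?_
  obtain ⟨s', -, hs'⟩ := exists_pathCost_succ_le hM hc s h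
  exact (iInf_le _ s').trans hs'

lemma offline_le {s : ℕ → M} (hs : s 0 = s₀) (t : ℕ) :
    offline s₀ c t ≤ pathCost c s 1 (t + 1) := iInf₂_le s hs

lemma offline_zero : offline s₀ c 0 = 0 :=
  le_antisymm ((offline_le (s := fun _ => s₀) rfl 0).trans_eq (pathCost_self _ _)) zero_le

lemma offline_succ_le (hM : ∀ s s' : M, edist s s' ≤ Δ) (hc : ∀ t, Admissible (c t)) (t : ℕ) :
    offline s₀ c (t + 1) ≤ offline s₀ c t + Δ := by
  rw [offline.eq_1 s₀ c t]
  simp only [ENNReal.iInf_add]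
  refine le_iInf₂ fun s hs => ?_
  obtain ⟨s', hs', hcost⟩ := exists_pathCost_succ_le hM hc s (Nat.le_add_left 1 t)
  exact (offline_le ((hs' 0 (by omega)).trans hs) _).trans hcost

lemma offline_mono : Monotone (offline s₀ c) := fun _ _ h =>
  le_iInf₂ fun s hs => (offline_le hs _).trans (pathCost_mono s le_rfl (by omega))

lemma offline_ne_top (hM : ∀ s s' : M, edist s s' ≤ Δ) (hΔ : Δ ≠ ∞) (hc : ∀ t, Admissible (c t))
    (t : ℕ) : offline s₀ c t ≠ ∞ := by
  induction t with
  | zero => rw [offline_zero]; exact ENNReal.zero_ne_top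
  | succ t ih => exact ne_top_of_le_ne_top (ENNReal.add_ne_top.2 ⟨ih, hΔ⟩) (offline_succ_le hM hc t)

lemma offlineOn_le_offline {a t : ℕ} (ha : 1 ≤ a) : offlineOn c a (t + 1) ≤ offline s₀ c t :=
  le_iInf₂ fun s _ => (iInf_le _ s).trans (pathCost_mono s ha le_rfl)

lemma pathCost_ite_le (hM : ∀ s s' : M, edist s s' ≤ Δ) (s s' : ℕ → M) {a b t : ℕ} (hb : a ≤ b + 1)
    (ht : b < t) :
    pathCost c (fun i => if i ≤ b then s i else s' i) a (t + 1)
      ≤ pathCost c s a (b + 1) + Δ + pathCost c s' (b + 1) (t + 1) := by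
  rw [← pathCost_add _ hb (by omega), pathCost_succ_bot _ (Nat.succ_lt_succ ht),
    pathCost_succ_bot s' (Nat.succ_lt_succ ht), add_assoc (pathCost c s a (b + 1)),
    ← add_assoc Δ]
  refine add_le_add (pathCost_congr fun i _ hi => if_pos (by omega)).le
    (add_le_add ?_ (pathCost_congr fun i hi _ => if_neg (by omega)).le)
  rw [if_neg (by omega), add_comm Δ]
  exact add_le_add le_self_add (hM _ _)

lemma offline_le_add_offlineOn (hM : ∀ s s' : M, edist s s' ≤ Δ) {b t : ℕ} (h : b < t) :
    offline s₀ c t ≤ offline s₀ c b + Δ + offlineOn c (b + 1) (t + 1) := by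
  rw [offline.eq_1 s₀ c b, offlineOn]
  simp only [ENNReal.iInf_add, ENNReal.add_iInf]
  refine le_iInf fun s' => le_iInf₂ fun s hs => ?_
  exact (offline_le (s := fun i => if i ≤ b then s i else s' i)
    ((if_pos b.zero_le).trans hs) t).trans (pathCost_ite_le hM s s' (by omega) h)

end Offline

/-! ### The phases of the doubling algorithm -/

section Phase

variable {M : Type*} [MetricSpace M] {s₀ : M} {c : ℕ → CostFn M} {Δ : ℝ≥0∞} {R ω : ℝ≥0}

lemma phase_succ_cases (R ω : ℝ≥0) (c : ℕ → CostFn M) (t : ℕ) :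
    ((R : ℝ≥0∞) * 2 ^ (phase R ω c t).1 * ω < offlineOn c (phase R ω c t).2 (t + 1)
        ∧ phase R ω c (t + 1) = ((phase R ω c t).1 + 1, t + 1)) ∨
      (offlineOn c (phase R ω c t).2 (t + 1) ≤ (R : ℝ≥0∞) * 2 ^ (phase R ω c t).1 * ω
        ∧ phase R ω c (t + 1) = phase R ω c t) := by
  rw [phase.eq_2]
  split_ifs with h
  · exact .inl ⟨h, rfl⟩
  · exact .inr ⟨not_lt.1 h, rfl⟩

lemma one_le_phase_snd (t : ℕ) : 1 ≤ (phase R ω c t).2 := by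
  induction t with
  | zero => exact le_rfl
  | succ t ih =>
    rcases phase_succ_cases R ω c t with ⟨-, h⟩ | ⟨-, h⟩ <;> rw [h]
    · exact Nat.le_add_left 1 t
    · exact ih

variable [Nonempty M]

lemma phase_one : phase R ω c 1 = (0, 1) := by
  rcases phase_succ_cases R ω c 0 with ⟨h, -⟩ | ⟨-, h⟩
  · have h₀ : offlineOn c (phase R ω c 0).2 (0 + 1) = 0 := offlineOn_self 1
    exact absurd (h₀ ▸ h) not_lt_zero
  · exact h

lemma phase_snd_le {t : ℕ} (ht : 1 ≤ t) : (phase R ω c t).2 ≤ t := by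
  induction t, ht using Nat.le_induction with
  | base => rw [phase_one]
  | succ t _ ih =>
    rcases phase_succ_cases R ω c t with ⟨-, h⟩ | ⟨-, h⟩ <;> rw [h]
    exact ih.trans t.le_succ

lemma phase_phase_snd {t : ℕ} (ht : 1 ≤ t) : phase R ω c (phase R ω c t).2 = phase R ω c t := by
  induction t, ht using Nat.le_induction with
  | base => rw [phase_one, phase_one]
  | succ t _ ih =>
    rcases phase_succ_cases R ω c t with ⟨-, h⟩ | ⟨-, h⟩
    · rw [h, h]
    · rw [h, ih]

lemma offlineOn_phase_le {t : ℕ} (ht : 1 ≤ t) :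
    offlineOn c (phase R ω c t).2 t ≤ (R : ℝ≥0∞) * 2 ^ (phase R ω c t).1 * ω := by
  obtain ⟨t, rfl⟩ := Nat.exists_eq_add_of_le' ht
  rcases phase_succ_cases R ω c t with ⟨-, h⟩ | ⟨h', h⟩ <;> rw [h]
  · rw [offlineOn_self]
    exact zero_le
  · exact h'

lemma phase_eq_or_exists_phase_eq_succ {t : ℕ} (ht : 1 ≤ t) :
    phase R ω c t = (0, 1) ∨ ∃ b, 1 ≤ b ∧ b < t ∧ phase R ω c t = ((phase R ω c b).1 + 1, b + 1) ∧
      (R : ℝ≥0∞) * 2 ^ (phase R ω c b).1 * ω < offlineOn c (phase R ω c b).2 (b + 1) := by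
  induction t, ht using Nat.le_induction with
  | base => exact .inl phase_one
  | succ t ht ih =>
    rcases phase_succ_cases R ω c t with ⟨hlt, h⟩ | ⟨-, h⟩
    · exact .inr ⟨t, ht, t.lt_succ_self, h, hlt⟩
    · rw [h]
      exact ih.imp_right fun ⟨b, hb, hbt, hphase⟩ => ⟨b, hb, hbt.trans t.lt_succ_self, hphase⟩

omit [Nonempty M] in
lemma le_two_mul_offline_of_phase_fst_ne_zero {t : ℕ} (ht : 1 ≤ t)
    (hk : (phase R ω c t).1 ≠ 0) :
    (R : ℝ≥0∞) * 2 ^ (phase R ω c t).1 * ω ≤ 2 * offline s₀ c t := by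
  have : Nonempty M := ⟨s₀⟩
  obtain h | ⟨b, -, hbt, h, hlt⟩ := phase_eq_or_exists_phase_eq_succ (R := R) (ω := ω) (c := c) ht
  · exact absurd (congrArg Prod.fst h) hk
  · calc (R : ℝ≥0∞) * 2 ^ (phase R ω c t).1 * ω
        = 2 * ((R : ℝ≥0∞) * 2 ^ (phase R ω c b).1 * ω) := by rw [h]; ring
      _ ≤ 2 * offline s₀ c b := by
        gcongr
        exact hlt.le.trans (offlineOn_le_offline (one_le_phase_snd b))
      _ ≤ 2 * offline s₀ c t := by
        gcongr
        exact offline_mono hbt.le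

omit [Nonempty M] in
lemma offline_le_offline_add_of_phase_snd_eq (hM : ∀ s s' : M, edist s s' ≤ Δ)
    (hc : ∀ t, Admissible (c t)) {b t : ℕ} (hb : b < t) (h : (phase R ω c t).2 = b + 1) :
    offline s₀ c t ≤ offline s₀ c b + ((R : ℝ≥0∞) * 2 ^ (phase R ω c t).1 * ω + 2 * Δ) := by
  have : Nonempty M := ⟨s₀⟩
  have hphase := offlineOn_phase_le (R := R) (ω := ω) (c := c) (Nat.one_le_of_lt hb)
  rw [h] at hphase
  calc _ ≤ offline s₀ c b + Δ + offlineOn c (b + 1) (t + 1) := offline_le_add_offlineOn hM hb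
    _ ≤ offline s₀ c b + Δ + ((R : ℝ≥0∞) * 2 ^ (phase R ω c t).1 * ω + Δ) := by
      gcongr
      exact (offlineOn_succ_le hM hc hb).trans (by gcongr)
    _ = _ := by ring

omit [Nonempty M] in
lemma offline_le_mul_phase (hM : ∀ s s' : M, edist s s' ≤ Δ) (hc : ∀ t, Admissible (c t))
    {κ : ℝ≥0∞} (hΔ : Δ ≤ κ * (R * ω)) (t : ℕ) :
    offline s₀ c t ≤ 2 * (1 + 2 * κ) * (R * 2 ^ (phase R ω c t).1 * ω) := by
  have : Nonempty M := ⟨s₀⟩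
  induction t using Nat.strong_induction_on with
  | _ t ih =>
  rcases Nat.eq_zero_or_pos t with rfl | ht
  · rw [offline_zero]
    exact zero_le
  set W := (R : ℝ≥0∞) * 2 ^ (phase R ω c t).1 * ω with hW
  have hstep : W + 2 * Δ ≤ (1 + 2 * κ) * W := by
    calc W + 2 * Δ ≤ W + 2 * (κ * (R * 2 ^ (phase R ω c t).1 * ω)) := by
          gcongr
          refine hΔ.trans ?_
          gcongr
          exact le_mul_of_one_le_right' (one_le_pow₀ one_le_two)
      _ = _ := by ring
  obtain h | ⟨b, -, hbt, h, -⟩ := phase_eq_or_exists_phase_eq_succ (R := R) (ω := ω) (c := c) ht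
  · calc _ ≤ offline s₀ c 0 + (W + 2 * Δ) :=
          offline_le_offline_add_of_phase_snd_eq hM hc ht (congrArg Prod.snd h)
      _ ≤ 2 * (1 + 2 * κ) * W := by
        rw [offline_zero, zero_add, mul_assoc, two_mul ((1 + 2 * κ) * W)]
        exact hstep.trans le_self_add
  · calc _ ≤ offline s₀ c b + (W + 2 * Δ) :=
          offline_le_offline_add_of_phase_snd_eq hM hc hbt (congrArg Prod.snd h)
      _ ≤ 2 * (1 + 2 * κ) * (R * 2 ^ (phase R ω c b).1 * ω) + (1 + 2 * κ) * W :=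
        add_le_add (ih b hbt) hstep
      _ = _ := by rw [hW, h]; ring

/-- The last rounds before round `T + 1` of the phases, where phase `0` has the last round `0` of
an empty phase before it. -/
def phaseEnds (R ω : ℝ≥0) (c : ℕ → CostFn M) (T : ℕ) : Finset ℕ :=
  insert T {t ∈ Finset.range T | (phase R ω c (t + 1)).2 = t + 1}

omit [Nonempty M] in
lemma le_of_mem_phaseEnds {t T : ℕ} (ht : t ∈ phaseEnds R ω c T) : t ≤ T := by
  rcases Finset.mem_insert.1 ht with rfl | ht
  exacts [le_rfl, (Finset.mem_range.1 (Finset.mem_filter.1 ht).1).le]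

lemma card_filter_phase_snd_eq_le (T : ℕ) :
    (Finset.range T |>.filter fun t => (phase R ω c (t + 1)).2 = t + 1).card
      ≤ (phase R ω c T).1 + 1 := by
  induction T with
  | zero => exact Nat.zero_le _
  | succ T ih =>
    rw [Finset.range_add_one, Finset.filter_insert]
    rcases phase_succ_cases R ω c T with ⟨-, h⟩ | ⟨-, h⟩ <;> rw [h]
    · rw [if_pos rfl]
      exact (Finset.card_insert_le _ _).trans (by omega)
    · split_ifs with hT
      · obtain rfl | hT₀ := Nat.eq_zero_or_pos T
        · exact (Finset.card_insert_le _ _).trans (by simp)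
        · have := phase_snd_le (R := R) (ω := ω) (c := c) hT₀
          omega
      · exact ih

lemma card_phaseEnds_le (T : ℕ) : (phaseEnds R ω c T).card ≤ (phase R ω c T).1 + 2 :=
  (Finset.card_insert_le _ _).trans (Nat.succ_le_succ (card_filter_phase_snd_eq_le T))

lemma exists_mem_phaseEnds {t T : ℕ} (ht : 1 ≤ t) (htT : t ≤ T) :
    ∃ b ∈ phaseEnds R ω c T, b < t ∧ (phase R ω c t).2 = b + 1 ∧
      (b = 0 ∨ (phase R ω c t).1 = (phase R ω c b).1 + 1) := by
  have hmem {b : ℕ} (hbt : b < t) (hb : (phase R ω c t).2 = b + 1) : b ∈ phaseEnds R ω c T := by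
    have hphase := phase_phase_snd (R := R) (ω := ω) (c := c) ht
    rw [hb] at hphase
    exact Finset.mem_insert_of_mem
      (Finset.mem_filter.2 ⟨Finset.mem_range.2 (hbt.trans_le htT), hphase ▸ hb⟩)
  obtain h | ⟨b, -, hbt, h, -⟩ := phase_eq_or_exists_phase_eq_succ (R := R) (ω := ω) (c := c) ht
  · exact ⟨0, hmem ht (congrArg Prod.snd h), ht, congrArg Prod.snd h, .inl rfl⟩
  · exact ⟨b, hmem hbt (congrArg Prod.snd h), hbt, congrArg Prod.snd h,
      .inr (congrArg Prod.fst h)⟩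

/-- The guess `2 ^ i * ω` with which the instance `i` of round `t` runs. -/
def guess (R ω : ℝ≥0) (c : ℕ → CostFn M) (t : ℕ) : ℝ :=
  2 ^ (phase R ω c t).1 * ω

omit [Nonempty M] in
lemma le_guess (t : ℕ) : ω ≤ guess R ω c t :=
  le_mul_of_one_le_left ω.coe_nonneg (one_le_pow₀ one_le_two)

omit [Nonempty M] in
lemma guess_eq_or_guess_le (hM : ∀ s s' : M, edist s s' ≤ Δ) (hΔ : Δ ≠ ∞)
    (hc : ∀ t, Admissible (c t)) (hR : 1 ≤ R) {t : ℕ} :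
    guess R ω c t = ω ∨ guess R ω c t ≤ 2 * (offline s₀ c t).toReal := by
  by_cases hk : (phase R ω c t).1 = 0
  · exact .inl (by rw [guess, hk, pow_zero, one_mul])
  have ht : 1 ≤ t := Nat.one_le_iff_ne_zero.2 (by rintro rfl; exact hk rfl)
  have hle : (2 : ℝ≥0∞) ^ (phase R ω c t).1 * ω ≤ 2 * offline s₀ c t :=
    calc _ ≤ (R : ℝ≥0∞) * (2 ^ (phase R ω c t).1 * ω) :=
          le_mul_of_one_le_left' (by exact_mod_cast hR)
      _ ≤ _ := by
        rw [← mul_assoc]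
        exact le_two_mul_offline_of_phase_fst_ne_zero ht hk
  have := ENNReal.toReal_mono (ENNReal.mul_ne_top (by simp) (offline_ne_top hM hΔ hc t)) hle
  exact .inr (by simpa [guess] using this)

omit [Nonempty M] in
lemma toReal_offline_le_mul_guess {D ω₀ : ℝ} (hD : 0 ≤ D) (hω₀ : 0 < ω₀) (hω : ω₀ ≤ ω)
    (hR : 1 ≤ R) (hM : ∀ s s' : M, edist s s' ≤ ENNReal.ofReal D)
    (hc : ∀ t, Admissible (c t)) (t : ℕ) :
    (offline s₀ c t).toReal ≤ 2 * (1 + 2 * (D / ω₀)) * (R * guess R ω c t) := by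
  have hR' : (1 : ℝ) ≤ R := by exact_mod_cast hR
  have hΔ : ENNReal.ofReal D ≤ ENNReal.ofReal (D / ω₀) * (R * ω) := by
    rw [← ENNReal.ofReal_coe_nnreal (p := R), ← ENNReal.ofReal_coe_nnreal (p := ω),
      ← ENNReal.ofReal_mul R.coe_nonneg, ← ENNReal.ofReal_mul (by positivity)]
    refine ENNReal.ofReal_le_ofReal ?_
    calc D = D / ω₀ * (1 * ω₀) := by field_simp
      _ ≤ D / ω₀ * (R * ω) := by gcongr
  have hle := offline_le_mul_phase (s₀ := s₀) hM hc hΔ t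
  have hne : 2 * (1 + 2 * ENNReal.ofReal (D / ω₀)) * (R * 2 ^ (phase R ω c t).1 * ω) ≠ ∞ := by
    finiteness
  refine (ENNReal.toReal_mono hne hle).trans_eq ?_
  rw [guess, ENNReal.toReal_mul, ENNReal.toReal_mul, ENNReal.toReal_add (by simp) (by finiteness)]
  simp [ENNReal.toReal_ofReal (div_nonneg hD hω₀.le), mul_assoc]

end Phase

/-! ### The instances of the doubling algorithm -/

section Heuristics

variable {M : Type*} [MetricSpace M] {s₀ : M} {ℓ : ℕ} {c : ℕ → CostFn M}
  {H : Fin ℓ → OnlineAlg M s₀} {B : ℝ≥0∞}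

lemma totalCost_add (A : OnlineAlg M s₀) (b n : ℕ) :
    A.totalCost c (b + n) = A.totalCost c b + ∑ j ∈ Finset.range n, A.stepCost c (b + j + 1) := by
  induction n with
  | zero => rw [Finset.sum_range_zero, add_zero, add_zero]
  | succ n ih =>
    rw [Finset.sum_range_succ, ← add_assoc (A.totalCost c b), ← ih]
    exact Finset.sum_Icc_succ_top (by omega) _

omit [MetricSpace M] in
lemma traj_zero (A : OnlineAlg M s₀) : A.traj c 0 = s₀ := A.state_nil

lemma offline_le_totalCost (A : OnlineAlg M s₀) (t : ℕ) : offline s₀ c t ≤ A.totalCost c t :=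
  (offline_le (s := A.traj c) (traj_zero A) t).trans_eq
    (Finset.sum_congr (by ext; simp) fun _ _ => rfl)

lemma offline_le_opt (t : ℕ) : offline s₀ c t ≤ opt H c t :=
  le_iInf fun _ => offline_le_totalCost _ _

lemma opt_mono : Monotone (opt H c) := fun t t' h => iInf_mono fun i => by
  obtain ⟨n, rfl⟩ := Nat.exists_eq_add_of_le h
  rw [totalCost_add]
  exact le_self_add

variable [NeZero ℓ]

lemma opt_ne_top (hB : B ≠ ∞) (hH : ∀ i t, 1 ≤ t → (H i).stepCost c t ≤ B) (t : ℕ) :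
    opt H c t ≠ ∞ :=
  ne_top_of_le_ne_top (ENNReal.sum_ne_top.2 fun t ht =>
    ne_top_of_le_ne_top hB (hH 0 t (Finset.mem_Icc.1 ht).1)) (iInf_le _ 0)

lemma exists_sum_stepCost_le (hB : B ≠ ∞) (hH : ∀ i t, 1 ≤ t → (H i).stepCost c t ≤ B) (b n : ℕ) :
    ∃ i, ∑ j ∈ Finset.range n, (H i).stepCost c (b + j + 1) ≤ opt H c (b + n) - opt H c b := by
  obtain ⟨i, hi⟩ := exists_eq_ciInf_of_finite (f := fun i => (H i).totalCost c (b + n))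
  refine ⟨i, ENNReal.le_sub_of_add_le_left (opt_ne_top hB hH b) ?_⟩
  rw [opt, opt, ← hi, totalCost_add]
  gcongr
  exact iInf_le _ i

end Heuristics

section Law

variable {M : Type*} [MetricSpace M] {s₀ : M} {ℓ : ℕ} [NeZero ℓ] {c : ℕ → CostFn M} {D : ℝ}
  {m : ℕ} {R ω : ℝ≥0} {H : Fin ℓ → OnlineAlg M s₀}

/-- The run of the instance `ALG(w)` that the doubling algorithm starts in round `b + 1`. -/
def phaseRun (D : ℝ) (m : ℕ) (R ω : ℝ≥0) (H : Fin ℓ → OnlineAlg M s₀) (c : ℕ → CostFn M)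
    (b : ℕ) (w : ℝ) : AlgRun M ℓ where
  D := D
  m := m
  ε := epsParam D ℓ m w
  η := etaParam D ℓ m w
  cost j := c (b + j + 1)
  traj j i := (H i).traj c (b + j)
  start := law D m R ω H c b

lemma law_eq_phaseRun_law {b n : ℕ} (h : (phase R ω c (b + (n + 1))).2 = b + 1) :
    law D m R ω H c (b + (n + 1))
      = (phaseRun D m R ω H c b (guess R ω c (b + (n + 1)))).law (n + 1) := by
  induction n with
  | zero =>
    rw [zero_add] at h ⊢
    rw [law, AlgRun.law, AlgRun.law, PMF.bind_bind]
    simp only [h, if_true]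
    rfl
  | succ n ih =>
    have hphase : phase R ω c (b + (n + 1) + 1) = phase R ω c (b + (n + 1)) := by
      rcases phase_succ_cases R ω c (b + (n + 1)) with ⟨-, h'⟩ | ⟨-, h'⟩
      · rw [← add_assoc, h'] at h
        exact absurd h (by simp)
      · exact h'
    rw [← add_assoc b] at h ⊢
    rw [guess, hphase, ← guess]
    rw [hphase] at h
    have hne : (phase R ω c (b + (n + 1))).2 ≠ b + (n + 1) + 1 := by omega
    rw [law, hphase]
    simp only [hne, if_false, PMF.pure_bind]
    rw [ih h]
    rfl

lemma expectedCost_zero : expectedCost D m R ω H c 0 = 0 :=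
  (expect_fresh s₀ 0 fun σ : AlgState M ℓ => σ.paid).trans (expect_const _ _)

end Law

/-! ### The parameters of the instances -/

section Parameters

variable {D : ℝ} {ℓ m : ℕ} {ω ω₀ γ₀ : ℝ}

lemma rpow_third_pow_three {x : ℝ} (hx : 0 ≤ x) : (x ^ (1 / 3 : ℝ)) ^ 3 = x := by
  rw [← Real.rpow_natCast, ← Real.rpow_mul hx]
  norm_num

lemma rpow_third_pow_two {x : ℝ} (hx : 0 ≤ x) : (x ^ (1 / 3 : ℝ)) ^ 2 = x ^ (2 / 3 : ℝ) := by
  rw [← Real.rpow_natCast, ← Real.rpow_mul hx]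
  norm_num

/-- The constant in `γ = rateConst * ω ^ (-1 / 3)`. -/
def rateConst (D : ℝ) (ℓ m : ℕ) : ℝ :=
  (D * ℓ * Real.log ℓ) ^ (1 / 3 : ℝ) * (m : ℝ) ^ (2 / 3 : ℝ)

lemma mul_mul_log_nonneg (hD : 0 ≤ D) : 0 ≤ D * ℓ * Real.log ℓ :=
  mul_nonneg (by positivity) (Real.log_natCast_nonneg ℓ)

lemma rateConst_nonneg (hD : 0 ≤ D) : 0 ≤ rateConst D ℓ m :=
  mul_nonneg (Real.rpow_nonneg (mul_mul_log_nonneg hD) _) (by positivity)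

lemma rateConst_pow_three (hD : 0 ≤ D) : rateConst D ℓ m ^ 3 = D * ℓ * Real.log ℓ * m ^ 2 := by
  rw [rateConst, ← rpow_third_pow_two (Nat.cast_nonneg m), mul_pow,
    rpow_third_pow_three (mul_mul_log_nonneg hD), pow_right_comm,
    rpow_third_pow_three (Nat.cast_nonneg m)]

lemma gammaParam_eq (hω : 0 ≤ ω) : gammaParam D ℓ m ω = rateConst D ℓ m / ω ^ (1 / 3 : ℝ) := by
  rw [gammaParam, rateConst, neg_div, Real.rpow_neg hω, div_eq_mul_inv _ (ω ^ _)]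

lemma gammaParam_nonneg (hD : 0 ≤ D) (hω : 0 ≤ ω) : 0 ≤ gammaParam D ℓ m ω := by
  rw [gammaParam_eq hω]
  exact div_nonneg (rateConst_nonneg hD) (by positivity)

lemma gammaParam_anti (hD : 0 ≤ D) (hω₀ : 0 < ω₀) (h : ω₀ ≤ ω) :
    gammaParam D ℓ m ω ≤ gammaParam D ℓ m ω₀ := by
  rw [gammaParam_eq hω₀.le, gammaParam_eq (hω₀.le.trans h)]
  exact div_le_div_of_nonneg_left (rateConst_nonneg hD) (by positivity)
    (Real.rpow_le_rpow hω₀.le h (by norm_num))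

lemma epsParam_eq (hm : m ≠ 0) : epsParam D ℓ m ω = gammaParam D ℓ m ω / m ^ 2 := by
  have hpow : (m : ℝ) ^ (-4 / 3 : ℝ) = (m : ℝ) ^ (2 / 3 : ℝ) / m ^ 2 := by
    rw [← Real.rpow_natCast, ← Real.rpow_sub (by positivity)]
    norm_num
  rw [epsParam, gammaParam, hpow]
  ring

lemma epsParam_nonneg (hD : 0 ≤ D) (hω : 0 ≤ ω) (hm : m ≠ 0) : 0 ≤ epsParam D ℓ m ω := by
  rw [epsParam_eq hm]
  exact div_nonneg (gammaParam_nonneg hD hω) (by positivity)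

lemma epsParam_le_gammaParam (hD : 0 ≤ D) (hω : 0 ≤ ω) (hm : m ≠ 0) :
    epsParam D ℓ m ω ≤ gammaParam D ℓ m ω := by
  rw [epsParam_eq hm]
  exact div_le_self (gammaParam_nonneg hD hω) (one_le_pow₀ (by exact_mod_cast hm.bot_lt))

lemma two_mul_mul_epsParam_le_one (hD : 0 ≤ D) (hω : 0 ≤ ω) (hm : 2 ≤ m)
    (hγ : gammaParam D ℓ m ω ≤ 1) : 2 * m * epsParam D ℓ m ω ≤ 1 := by
  have hm' : (2 : ℝ) ≤ m := by exact_mod_cast hm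
  have hγ₀ := gammaParam_nonneg (ℓ := ℓ) (m := m) hD hω
  rw [epsParam_eq (by omega), mul_div_assoc', div_le_one (by positivity)]
  calc 2 * m * gammaParam D ℓ m ω ≤ m * m * 1 := by gcongr
    _ = m ^ 2 := by ring

lemma eq_one_or_gammaParam_pos_and_epsParam_pos [NeZero ℓ] (hD : 0 < D) (hω : 0 < ω)
    (hm : m ≠ 0) : ℓ = 1 ∨ 0 < gammaParam D ℓ m ω ∧ 0 < epsParam D ℓ m ω := by
  refine or_iff_not_imp_left.2 fun hℓ => ?_
  have hlog : 0 < Real.log ℓ :=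
    Real.log_pos (by exact_mod_cast (Nat.one_le_iff_ne_zero.2 (NeZero.ne ℓ)).lt_of_ne' hℓ)
  have hℓ₀ := NeZero.ne ℓ
  rw [gammaParam, epsParam]
  constructor <;> positivity

/-- The choice of `ε` and `γ` makes the cost of the exploration, of order `ω ^ (2 / 3)`, absorb
the regret `D ℓ log ℓ / (γ ε)` of HEDGE with losses sampled at rate `ε / ℓ`. -/
lemma two_mul_mul_log_eq (hD : 0 ≤ D) (hω : 0 < ω) (hm : m ≠ 0) :
    2 * D * (ℓ * Real.log ℓ) = 2 * rateConst D ℓ m * ω ^ (2 / 3 : ℝ)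
      * (gammaParam D ℓ m ω * epsParam D ℓ m ω) := by
  have : 0 < ω ^ (1 / 3 : ℝ) := by positivity
  rw [epsParam_eq hm, gammaParam_eq hω.le, ← rpow_third_pow_two hω.le]
  calc 2 * D * (ℓ * Real.log ℓ) = 2 * (D * ℓ * Real.log ℓ * m ^ 2) / m ^ 2 := by
        field_simp
    _ = _ := by
      rw [← rateConst_pow_three hD]
      field_simp

lemma exp_neg_etaParam (hγ : gammaParam D ℓ m ω < 1) :
    Real.exp (-etaParam D ℓ m ω) = 1 - gammaParam D ℓ m ω := by
  rw [etaParam, neg_neg, Real.exp_log (sub_pos.2 hγ)]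

lemma etaParam_nonneg (hγ : 0 ≤ gammaParam D ℓ m ω) (hγ' : gammaParam D ℓ m ω < 1) :
    0 ≤ etaParam D ℓ m ω :=
  neg_nonneg.2 (Real.log_nonpos (by linarith) (by linarith))

lemma exp_etaParam_le (hγ : gammaParam D ℓ m ω ≤ γ₀) (hγ₀ : γ₀ < 1) :
    Real.exp (etaParam D ℓ m ω) ≤ (1 - γ₀)⁻¹ := by
  rw [← neg_neg (etaParam D ℓ m ω), Real.exp_neg, exp_neg_etaParam (hγ.trans_lt hγ₀)]
  exact inv_anti₀ (by linarith) (by linarith)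

lemma etaParam_le (hγ : 0 ≤ gammaParam D ℓ m ω) (hγ' : gammaParam D ℓ m ω ≤ γ₀) (hγ₀ : γ₀ < 1) :
    etaParam D ℓ m ω ≤ (1 - γ₀)⁻¹ * gammaParam D ℓ m ω := by
  set γ := gammaParam D ℓ m ω
  have hpos : 0 < 1 - γ := by linarith
  calc -Real.log (1 - γ) = Real.log (1 - γ)⁻¹ := (Real.log_inv _).symm
    _ ≤ (1 - γ)⁻¹ - 1 := Real.log_le_sub_one_of_pos (inv_pos.2 hpos)
    _ = (1 - γ)⁻¹ * γ := by field_simp; ring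
    _ ≤ (1 - γ₀)⁻¹ * γ :=
      mul_le_mul_of_nonneg_right (inv_anti₀ (by linarith) (by linarith)) hγ

end Parameters

section PhaseCost

/-- `regretExponent * γ` bounds `roundExponent + η` if `κ` bounds `exp η` and `η / γ`. -/
def regretExponent (m : ℕ) (κ : ℝ) : ℝ :=
  badFactor m κ * κ * (2 * m * 4 ^ m) + m * κ + m * 2 ^ m + κ

/-- The bound on the startup cost if `κ` bounds `η`. -/
def startupConst (D : ℝ) (m : ℕ) (κ : ℝ) : ℝ :=
  (1 + 6 * m) * D + m * ((1 + badFactor m κ) * (2 * D))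

lemma badFactor_mono (m : ℕ) : Monotone (badFactor m) := fun η η' h => by
  rw [badFactor, badFactor]
  gcongr

lemma regretExponent_nonneg (m : ℕ) {κ : ℝ} (hκ : 0 ≤ κ) : 0 ≤ regretExponent m κ := by
  rw [regretExponent]
  positivity

lemma startupConst_nonneg {D : ℝ} (hD : 0 ≤ D) (m : ℕ) (κ : ℝ) : 0 ≤ startupConst D m κ := by
  rw [startupConst]
  positivity

namespace AlgRun

variable {M : Type*} {ℓ : ℕ} {A : AlgRun M ℓ} {κ γ : ℝ}

lemma startupCost_le (hD : 0 ≤ A.D) (hη : A.η ≤ κ) : A.startupCost ≤ startupConst A.D A.m κ := by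
  have hbad := badFactor_mono A.m hη
  rw [startupCost, startupConst]
  gcongr

lemma roundExponent_add_le (hε₀ : 0 ≤ A.ε) (hγ : γ ≤ 1) (hη : A.η ≤ κ * γ)
    (hexp : Real.exp A.η ≤ κ) (hε : A.ε ≤ γ) :
    A.roundExponent + A.η ≤ regretExponent A.m κ * γ := by
  have hκ : 0 ≤ κ := (Real.exp_pos _).le.trans hexp
  have : 0 ≤ γ := hε₀.trans hε
  have hbad := badFactor_mono A.m (hη.trans (mul_le_of_le_one_right hκ hγ))
  calc A.roundExponent + A.η
      ≤ badFactor A.m κ * κ * (2 * A.m * 4 ^ A.m) * γ + A.m * (κ * γ) + A.m * 2 ^ A.m * γ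
        + κ * γ := by
        rw [roundExponent]
        gcongr
    _ = regretExponent A.m κ * γ := by rw [regretExponent]; ring

end AlgRun

variable {M : Type*} [MetricSpace M] {s₀ : M} {ℓ : ℕ} [NeZero ℓ] {c : ℕ → CostFn M} {D : ℝ}
  {m : ℕ} {R ω : ℝ≥0} {H : Fin ℓ → OnlineAlg M s₀}

lemma expectedCost_le_of_phase_snd_eq (hD : 0 < D)
    (hM : ∀ s s' : M, edist s s' ≤ ENNReal.ofReal D) (hm : 2 ≤ m) (hω : 0 < ω)
    (hc : ∀ t, Admissible (c t))
    (hH : ∀ i t, 1 ≤ t → (H i).stepCost c t ≤ ENNReal.ofReal (2 * D)) {b n : ℕ}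
    (h : (phase R ω c (b + (n + 1))).2 = b + 1) {w γ₀ : ℝ} (hw : w = guess R ω c (b + (n + 1)))
    (hγ : gammaParam D ℓ m w ≤ γ₀) (hγ₀ : γ₀ < 1) :
    expectedCost D m R ω H c (b + (n + 1)) ≤ expectedCost D m R ω H c b
      + ENNReal.ofReal (startupConst D m (1 - γ₀)⁻¹)
      + ENNReal.ofReal (Real.exp (regretExponent m (1 - γ₀)⁻¹ * gammaParam D ℓ m w))
        * (ENNReal.ofReal (2 * rateConst D ℓ m * w ^ (2 / 3 : ℝ))
          + (opt H c (b + (n + 1)) - opt H c b)) := by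
  have hw₀ : 0 < w := hw ▸ (NNReal.coe_pos.2 hω).trans_le (le_guess _)
  have hm₀ : m ≠ 0 := by omega
  have hγ_nonneg := gammaParam_nonneg (ℓ := ℓ) (m := m) hD.le hw₀.le
  have hγ_lt := hγ.trans_lt hγ₀
  have hη := etaParam_le hγ_nonneg hγ hγ₀
  have hκ₀ : 0 ≤ (1 - γ₀)⁻¹ := inv_nonneg.2 (by linarith)
  have hε₀ := epsParam_nonneg (ℓ := ℓ) hD.le hw₀.le hm₀
  have hηκ : etaParam D ℓ m w ≤ (1 - γ₀)⁻¹ := hη.trans (mul_le_of_le_one_right hκ₀ hγ_lt.le)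
  obtain ⟨i, hi⟩ := exists_sum_stepCost_le ENNReal.ofReal_ne_top hH b (n + 1)
  have hbalance : 2 * D * (ℓ * Real.log ℓ) ≤ 2 * rateConst D ℓ m * w ^ (2 / 3 : ℝ)
      * ((1 - Real.exp (-etaParam D ℓ m w)) * epsParam D ℓ m w) := by
    rw [exp_neg_etaParam hγ_lt, sub_sub_cancel, ← two_mul_mul_log_eq hD.le hw₀ hm₀]
  have hrates : ℓ = 1 ∨ 0 < etaParam D ℓ m w ∧ 0 < epsParam D ℓ m w :=
    (eq_one_or_gammaParam_pos_and_epsParam_pos hD hw₀ hm₀).imp_right <|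
      And.imp_left fun hpos => neg_pos.2 (Real.log_neg (by linarith) (by linarith))
  have hcost := (phaseRun D m R ω H c b w).expect_paid_le hD hM
    (etaParam_nonneg hγ_nonneg hγ_lt) hm hε₀
    (two_mul_mul_epsParam_le_one hD.le hw₀.le hm hγ_lt.le) (fun _ => hc _)
    (fun _ i => hH i _ (by omega)) hbalance hrates (n + 1) i
  have hstartup := (phaseRun D m R ω H c b w).startupCost_le hD.le hηκ
  have hexponent := (phaseRun D m R ω H c b w).roundExponent_add_le hε₀ hγ_lt.le hη
    (exp_etaParam_le hγ hγ₀) (epsParam_le_gammaParam hD.le hw₀.le hm₀)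
  rw [expectedCost, law_eq_phaseRun_law h, ← hw]
  refine hcost.trans ?_
  gcongr
  exacts [le_rfl, hstartup, hexponent, hi]

end PhaseCost

/-! ### Summing the regret over the phases -/

section RegretPotential

variable {r B G w x y Y u v : ℝ}

lemma sub_le_mul_rpow_sub_rpow (hv : 0 ≤ v) (hvu : v ≤ u) :
    u - v ≤ 3 / 2 * u ^ (1 / 3 : ℝ) * (u ^ (2 / 3 : ℝ) - v ^ (2 / 3 : ℝ)) := by
  have hu := hv.trans hvu
  have hroot : v ^ (1 / 3 : ℝ) ≤ u ^ (1 / 3 : ℝ) := Real.rpow_le_rpow hv hvu (by norm_num)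
  have hv₀ : 0 ≤ v ^ (1 / 3 : ℝ) := Real.rpow_nonneg hv _
  rw [← rpow_third_pow_two hu, ← rpow_third_pow_two hv]
  nth_rw 1 [← rpow_third_pow_three hu, ← rpow_third_pow_three hv]
  set a := u ^ (1 / 3 : ℝ)
  set b := v ^ (1 / 3 : ℝ)
  have hfactor : 0 ≤ (a - b) ^ 2 * (a + 2 * b) := by positivity
  linarith

/-- While the best heuristic pays `x - y` in a phase in which its total cost `x` is at most
`B * r ^ 2 * w + Y`, this potential increases by at least a multiple of `w ^ (-1 / 3) * (x - y)`,
the regret of the phase. -/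
def regretPotential (r Y x : ℝ) : ℝ :=
  r ^ (2 / 3 : ℝ) * max (x - Y) 0 ^ (2 / 3 : ℝ) + min x Y

lemma regretPotential_zero (hY : 0 ≤ Y) : regretPotential r Y 0 = 0 := by
  rw [regretPotential, max_eq_right (by linarith), min_eq_left hY, Real.zero_rpow (by norm_num),
    mul_zero, add_zero]

lemma regretPotential_mono (hr : 0 ≤ r) : Monotone (regretPotential r Y) := fun x y h => by
  rw [regretPotential, regretPotential]
  gcongr

lemma div_mul_sub_le_regretPotential_sub (hr : 0 ≤ r) (hB : 0 ≤ B) (hG : 0 ≤ G) (hw : 0 < w)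
    (hGw : G / w ^ (1 / 3 : ℝ) ≤ 1) (hyx : y ≤ x) (hx : x ≤ B * r ^ 2 * w + Y) :
    G / w ^ (1 / 3 : ℝ) * (x - y)
      ≤ (1 + 3 / 2 * G * B ^ (1 / 3 : ℝ)) * (regretPotential r Y x - regretPotential r Y y) := by
  have hsplit (s : ℝ) : s = max (s - Y) 0 + min s Y := by
    rw [← sub_self Y, max_sub_sub_right]
    linarith [max_add_min s Y]
  set u := max (x - Y) 0
  set v := max (y - Y) 0
  have hv : 0 ≤ v := le_max_right _ _
  have hvu : v ≤ u := max_le_max_right 0 (by linarith)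
  have hmin : min y Y ≤ min x Y := min_le_min_right Y hyx
  have hpow : v ^ (2 / 3 : ℝ) ≤ u ^ (2 / 3 : ℝ) := Real.rpow_le_rpow hv hvu (by norm_num)
  have hu : u ^ (1 / 3 : ℝ) ≤ B ^ (1 / 3 : ℝ) * r ^ (2 / 3 : ℝ) * w ^ (1 / 3 : ℝ) := by
    rw [← rpow_third_pow_two hr, Real.rpow_pow_comm hr, ← Real.mul_rpow hB (sq_nonneg r),
      ← Real.mul_rpow (mul_nonneg hB (sq_nonneg r)) hw.le]
    exact Real.rpow_le_rpow (hv.trans hvu) (max_le (by linarith) (by positivity)) (by norm_num)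
  set κ := 3 / 2 * G * B ^ (1 / 3 : ℝ)
  have hκ : 0 ≤ κ := by positivity
  have hlarge : G / w ^ (1 / 3 : ℝ) * (u - v)
      ≤ κ * (r ^ (2 / 3 : ℝ) * (u ^ (2 / 3 : ℝ) - v ^ (2 / 3 : ℝ))) := by
    have := sub_nonneg.2 hpow
    calc _ ≤ G / w ^ (1 / 3 : ℝ)
            * (3 / 2 * (B ^ (1 / 3 : ℝ) * r ^ (2 / 3 : ℝ) * w ^ (1 / 3 : ℝ))
              * (u ^ (2 / 3 : ℝ) - v ^ (2 / 3 : ℝ))) := by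
          gcongr
          exact (sub_le_mul_rpow_sub_rpow hv hvu).trans (by gcongr)
      _ = _ := by simp only [κ]; field_simp
  have hsmall : G / w ^ (1 / 3 : ℝ) * (min x Y - min y Y) ≤ min x Y - min y Y :=
    mul_le_of_le_one_left (sub_nonneg.2 hmin) hGw
  have hmin' := mul_nonneg hκ (sub_nonneg.2 hmin)
  have hpow' := mul_nonneg (Real.rpow_nonneg hr (2 / 3)) (sub_nonneg.2 hpow)
  calc G / w ^ (1 / 3 : ℝ) * (x - y)
      = G / w ^ (1 / 3 : ℝ) * (u - v) + G / w ^ (1 / 3 : ℝ) * (min x Y - min y Y) := by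
        rw [← mul_add]
        congr 1
        linarith [hsplit x, hsplit y]
    _ ≤ _ := by
      rw [regretPotential, regretPotential]
      linarith

/-- The per-phase terms `w ^ (2 / 3)` telescope along a doubling sequence of guesses `w`. -/
lemma three_mul_rpow_le_two_mul_rpow_two_mul (hw : 0 ≤ w) :
    3 * w ^ (2 / 3 : ℝ) ≤ 2 * (2 * w) ^ (2 / 3 : ℝ) := by
  have htwo : (3 / 2 : ℝ) ≤ 2 ^ (2 / 3 : ℝ) := by
    rw [← rpow_third_pow_two zero_le_two]
    have hroot : (5 / 4 : ℝ) ≤ 2 ^ (1 / 3 : ℝ) := by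
      refine le_of_pow_le_pow_left₀ (n := 3) (by norm_num) (by positivity) ?_
      rw [rpow_third_pow_three zero_le_two]
      norm_num
    calc (3 / 2 : ℝ) ≤ (5 / 4) ^ 2 := by norm_num
      _ ≤ _ := by gcongr
  rw [Real.mul_rpow zero_le_two hw, ← mul_assoc]
  gcongr
  linarith

/-- The chord bound for the convex function `exp` on `[0, A]`. -/
lemma exp_mul_mul_add_le {A γ p q : ℝ} (hA : 0 ≤ A) (hγ : γ ∈ Set.Icc 0 1) (hp : 0 ≤ p)
    (hq : 0 ≤ q) :
    Real.exp (A * γ) * (p + q) ≤ Real.exp A * p + q + (Real.exp A - 1) * (γ * q) := by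
  have hchord : Real.exp (A * γ) ≤ 1 + (Real.exp A - 1) * γ := by
    have := exp_neg_mul_le_of_mem_Icc (η := -A) hγ
    rw [neg_neg] at this
    linarith
  have hmono : Real.exp (A * γ) ≤ Real.exp A :=
    Real.exp_le_exp.2 (mul_le_of_le_one_right hA hγ.2)
  calc _ = Real.exp (A * γ) * p + Real.exp (A * γ) * q := mul_add _ _ _
    _ ≤ Real.exp A * p + (1 + (Real.exp A - 1) * γ) * q := by gcongr
    _ = _ := by ring

end RegretPotential

section RegretConstants

/-- The regret rate of `ALG(w)` is at most a multiple of `exp (regretRate * γ(w))`, for all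
`w ≥ ω₀`. -/
def regretRate (D : ℝ) (ℓ m : ℕ) (ω₀ : ℝ) : ℝ :=
  regretExponent m (1 - gammaParam D ℓ m ω₀)⁻¹

/-- The cost `phaseConst * w ^ (2 / 3)` of starting the instance `ALG(w)` and of its explorations,
for all `w ≥ ω₀`. -/
def phaseConst (D : ℝ) (ℓ m : ℕ) (ω₀ : ℝ) : ℝ :=
  startupConst D m (1 - gammaParam D ℓ m ω₀)⁻¹ / ω₀ ^ (2 / 3 : ℝ)
    + Real.exp (regretRate D ℓ m ω₀) * (2 * rateConst D ℓ m)

/-- The offline optimum is at most `offlineConst * R * w` as long as the guess is `w ≥ ω₀`. -/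
def offlineConst (D ω₀ : ℝ) : ℝ :=
  2 * (1 + 2 * (D / ω₀))

/-- The regret of a phase is at most `potentialConst` times the increase of `regretPotential`,
up to the cost accounted for by `phaseConst`. -/
def potentialConst (D : ℝ) (ℓ m : ℕ) (ω₀ : ℝ) : ℝ :=
  (Real.exp (regretRate D ℓ m ω₀) - 1)
    * (1 + 3 / 2 * rateConst D ℓ m * offlineConst D ω₀ ^ (1 / 3 : ℝ))

variable {D ω₀ : ℝ} {ℓ m : ℕ}

lemma regretRate_nonneg (hγ : gammaParam D ℓ m ω₀ < 1) : 0 ≤ regretRate D ℓ m ω₀ :=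
  regretExponent_nonneg m (inv_nonneg.2 (sub_nonneg.2 hγ.le))

lemma phaseConst_nonneg (hD : 0 ≤ D) (hω₀ : 0 ≤ ω₀) : 0 ≤ phaseConst D ℓ m ω₀ := by
  have := rateConst_nonneg (ℓ := ℓ) (m := m) hD
  have := startupConst_nonneg hD m (1 - gammaParam D ℓ m ω₀)⁻¹
  rw [phaseConst]
  positivity

lemma offlineConst_nonneg (hD : 0 ≤ D) (hω₀ : 0 ≤ ω₀) : 0 ≤ offlineConst D ω₀ := by
  rw [offlineConst]
  positivity

lemma potentialConst_nonneg (hD : 0 ≤ D) (hω₀ : 0 ≤ ω₀) (hγ : gammaParam D ℓ m ω₀ < 1) :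
    0 ≤ potentialConst D ℓ m ω₀ := by
  have := rateConst_nonneg (ℓ := ℓ) (m := m) hD
  have := offlineConst_nonneg hD hω₀
  exact mul_nonneg (sub_nonneg.2 (Real.one_le_exp (regretRate_nonneg hγ))) (by positivity)

end RegretConstants

section PhaseSum

variable {M : Type*} [MetricSpace M] {s₀ : M} {ℓ : ℕ} [NeZero ℓ] {c : ℕ → CostFn M} {D : ℝ}
  {m : ℕ} {R ω : ℝ≥0} {ω₀ : ℝ} {H : Fin ℓ → OnlineAlg M s₀}

lemma expectedCost_le_add_regret (hD : 0 < D)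
    (hM : ∀ s s' : M, edist s s' ≤ ENNReal.ofReal D) (hm : 2 ≤ m) (hω₀ : 0 < ω₀)
    (hγ : gammaParam D ℓ m ω₀ < 1) (hω : ω₀ ≤ ω) (hc : ∀ t, Admissible (c t))
    (hH : ∀ i t, 1 ≤ t → (H i).stepCost c t ≤ ENNReal.ofReal (2 * D)) {b t : ℕ} (hbt : b < t)
    (h : (phase R ω c t).2 = b + 1) {w x y : ℝ} (hw : w = guess R ω c t)
    (hx : x = (opt H c t).toReal) (hy : y = (opt H c b).toReal) :
    expectedCost D m R ω H c t ≤ expectedCost D m R ω H c b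
      + ENNReal.ofReal ((x - y) + (Real.exp (regretRate D ℓ m ω₀) - 1)
          * (gammaParam D ℓ m w * (x - y)) + phaseConst D ℓ m ω₀ * w ^ (2 / 3 : ℝ)) := by
  obtain ⟨n, rfl⟩ : ∃ n, t = b + (n + 1) := Nat.exists_eq_add_of_lt hbt
  have hω₀w : ω₀ ≤ w := hω.trans (hw ▸ le_guess _)
  have hγw := gammaParam_anti (ℓ := ℓ) (m := m) hD.le hω₀ hω₀w
  have hγ_mem : gammaParam D ℓ m w ∈ Set.Icc 0 1 :=
    ⟨gammaParam_nonneg hD.le (hω₀.le.trans hω₀w), hγw.trans hγ.le⟩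
  have hG := rateConst_nonneg (ℓ := ℓ) (m := m) hD.le
  have hS := startupConst_nonneg hD.le m (1 - gammaParam D ℓ m ω₀)⁻¹
  have hopt := opt_ne_top ENNReal.ofReal_ne_top hH
  have hyx : y ≤ x := by
    rw [hx, hy]
    exact ENNReal.toReal_mono (hopt _) (opt_mono hbt.le)
  have hsub : opt H c (b + (n + 1)) - opt H c b = ENNReal.ofReal (x - y) := by
    rw [ENNReal.ofReal_sub _ (hy ▸ ENNReal.toReal_nonneg), hx, hy, ENNReal.ofReal_toReal (hopt _),
      ENNReal.ofReal_toReal (hopt _)]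
  have hstartup : startupConst D m (1 - gammaParam D ℓ m ω₀)⁻¹
      ≤ startupConst D m (1 - gammaParam D ℓ m ω₀)⁻¹ / ω₀ ^ (2 / 3 : ℝ) * w ^ (2 / 3 : ℝ) := by
    rw [div_mul_eq_mul_div, le_div_iff₀ (by positivity)]
    gcongr
  have hw₀ : 0 ≤ w := hω₀.le.trans hω₀w
  have hchord := exp_mul_mul_add_le (regretRate_nonneg hγ) hγ_mem
    (p := 2 * rateConst D ℓ m * w ^ (2 / 3 : ℝ)) (by positivity) (sub_nonneg.2 hyx)
  refine (expectedCost_le_of_phase_snd_eq hD hM hm (by exact_mod_cast hω₀.trans_le hω) hc hH h hw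
    hγw hγ).trans ?_
  rw [hsub, add_assoc (expectedCost D m R ω H c b),
    ← ENNReal.ofReal_add (by positivity) (sub_nonneg.2 hyx), ← ENNReal.ofReal_mul (by positivity),
    ← ENNReal.ofReal_add hS (mul_nonneg (by positivity) (add_nonneg (by positivity) (by linarith)))]
  refine add_le_add_right (ENNReal.ofReal_le_ofReal ?_) _
  rw [phaseConst, add_mul (_ / _)]
  rw [regretRate] at hchord ⊢
  linarith

lemma expectedCost_le_add_regretPotential_sub (hD : 0 < D)
    (hM : ∀ s s' : M, edist s s' ≤ ENNReal.ofReal D) (hm : 2 ≤ m) (hω₀ : 0 < ω₀)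
    (hγ : gammaParam D ℓ m ω₀ < 1) (hω : ω₀ ≤ ω) (hc : ∀ t, Admissible (c t))
    (hH : ∀ i t, 1 ≤ t → (H i).stepCost c t ≤ ENNReal.ofReal (2 * D)) {b t : ℕ} (hbt : b < t)
    (h : (phase R ω c t).2 = b + 1) {w x y r Y : ℝ} (hw : w = guess R ω c t)
    (hx : x = (opt H c t).toReal) (hy : y = (opt H c b).toReal) (hyx : y ≤ x) (hr : 0 ≤ r)
    (hY : x ≤ offlineConst D ω₀ * r ^ 2 * w + Y) :
    expectedCost D m R ω H c t ≤ expectedCost D m R ω H c b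
      + ENNReal.ofReal ((x - y)
          + potentialConst D ℓ m ω₀ * (regretPotential r Y x - regretPotential r Y y)
          + phaseConst D ℓ m ω₀ * w ^ (2 / 3 : ℝ)) := by
  have hω₀w : ω₀ ≤ w := hω.trans (hw ▸ le_guess _)
  have hw₀ := hω₀.trans_le hω₀w
  have hγw := (gammaParam_anti (ℓ := ℓ) (m := m) hD.le hω₀ hω₀w).trans hγ.le
  have hrate : 0 ≤ Real.exp (regretRate D ℓ m ω₀) - 1 :=
    sub_nonneg.2 (Real.one_le_exp (regretRate_nonneg hγ))
  have hregret : (Real.exp (regretRate D ℓ m ω₀) - 1) * (gammaParam D ℓ m w * (x - y))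
      ≤ potentialConst D ℓ m ω₀ * (regretPotential r Y x - regretPotential r Y y) := by
    rw [gammaParam_eq hw₀.le] at hγw ⊢
    rw [potentialConst, mul_assoc]
    exact mul_le_mul_of_nonneg_left (div_mul_sub_le_regretPotential_sub hr
      (offlineConst_nonneg hD.le hω₀.le) (rateConst_nonneg hD.le) hw₀ hγw hyx hY) hrate
  refine (expectedCost_le_add_regret hD hM hm hω₀ hγ hω hc hH hbt h hw hx hy).trans ?_
  gcongr

/-- The bound on the expected cost if the best heuristic pays `x` in the rounds up to the
present one, where the current guess is `w` (see `regretPotential` for `r` and `Y`). -/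
def costBound (D : ℝ) (ℓ m : ℕ) (ω₀ r Y x w : ℝ) : ℝ :=
  x + potentialConst D ℓ m ω₀ * regretPotential r Y x + 3 * phaseConst D ℓ m ω₀ * w ^ (2 / 3 : ℝ)

omit [NeZero ℓ] in
lemma costBound_le_add_two_mul (hD : 0 ≤ D) (hω₀ : 0 ≤ ω₀) {r Y x w : ℝ} (hw : 0 ≤ w) :
    costBound D ℓ m ω₀ r Y x w ≤ x + potentialConst D ℓ m ω₀ * regretPotential r Y x
      + 2 * phaseConst D ℓ m ω₀ * (2 * w) ^ (2 / 3 : ℝ) := by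
  have := mul_le_mul_of_nonneg_left (three_mul_rpow_le_two_mul_rpow_two_mul hw)
    (phaseConst_nonneg (ℓ := ℓ) (m := m) hD hω₀)
  rw [costBound]
  linarith

lemma expectedCost_le_costBound (hD : 0 < D)
    (hM : ∀ s s' : M, edist s s' ≤ ENNReal.ofReal D) (hm : 2 ≤ m) (hω₀ : 0 < ω₀)
    (hγ : gammaParam D ℓ m ω₀ < 1) (hω : ω₀ ≤ ω) (hc : ∀ t, Admissible (c t))
    (hH : ∀ i t, 1 ≤ t → (H i).stepCost c t ≤ ENNReal.ofReal (2 * D)) {T : ℕ} {r Y : ℝ}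
    (hr : 0 ≤ r) (hY₀ : 0 ≤ Y) (hY : ∀ t ∈ phaseEnds R ω c T,
      (opt H c t).toReal ≤ offlineConst D ω₀ * r ^ 2 * guess R ω c t + Y)
    {t : ℕ} (ht : t ∈ phaseEnds R ω c T) :
    expectedCost D m R ω H c t
      ≤ ENNReal.ofReal (costBound D ℓ m ω₀ r Y (opt H c t).toReal (guess R ω c t)) := by
  induction t using Nat.strong_induction_on with
  | _ t ih =>
  have hP := potentialConst_nonneg hD.le hω₀.le hγ
  have hQ := phaseConst_nonneg (ℓ := ℓ) (m := m) hD.le hω₀.le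
  have hguess (t : ℕ) : 0 ≤ guess R ω c t := hω₀.le.trans (hω.trans (le_guess t))
  rcases Nat.eq_zero_or_pos t with rfl | ht₀
  · rw [expectedCost_zero]
    exact zero_le
  have : Nonempty M := ⟨s₀⟩
  obtain ⟨b, hb, hbt, hphase, hb₀⟩ :=
    exists_mem_phaseEnds (R := R) (ω := ω) (c := c) ht₀ (le_of_mem_phaseEnds ht)
  have hw₀ := hguess t
  have hxw := hY t ht
  have hyx := ENNReal.toReal_mono (opt_ne_top ENNReal.ofReal_ne_top hH t) (opt_mono hbt.le)
  have hy₀ : 0 ≤ (opt H c b).toReal := ENNReal.toReal_nonneg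
  have hprev : expectedCost D m R ω H c b ≤ ENNReal.ofReal ((opt H c b).toReal
      + potentialConst D ℓ m ω₀ * regretPotential r Y (opt H c b).toReal
      + 2 * phaseConst D ℓ m ω₀ * guess R ω c t ^ (2 / 3 : ℝ)) := by
    rcases hb₀ with rfl | hb₀
    · rw [expectedCost_zero]
      exact zero_le
    · have hw : guess R ω c t = 2 * guess R ω c b := by
        rw [guess, guess, hb₀, pow_succ', mul_assoc]
      rw [hw]
      exact (ih b hbt hb).trans
        (ENNReal.ofReal_le_ofReal (costBound_le_add_two_mul hD.le hω₀.le (hguess b)))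
  have hstep := expectedCost_le_add_regretPotential_sub hD hM hm hω₀ hγ hω hc hH hbt hphase
    rfl rfl rfl hyx hr hxw
  set w := guess R ω c t
  set x := (opt H c t).toReal
  set y := (opt H c b).toReal
  have hΦ := regretPotential_mono hr hyx (Y := Y)
  have hΦ₀ := (regretPotential_zero hY₀).symm.trans_le (regretPotential_mono hr hy₀)
  refine (hstep.trans (add_le_add_left hprev _)).trans_eq ?_
  rw [← ENNReal.ofReal_add (by positivity)
    (add_nonneg (add_nonneg (sub_nonneg.2 hyx) (mul_nonneg hP (sub_nonneg.2 hΦ))) (by positivity)),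
    costBound]
  ring_nf

end PhaseSum

/-! ### The regret of the doubling algorithm -/

section RegretBound

variable {D ω₀ r α o x w Y : ℝ} {ℓ m : ℕ}

lemma mul_sqrt_le (hr : 0 ≤ r) (hx : 0 ≤ x) :
    r * √x ≤ r ^ (2 / 3 : ℝ) * x ^ (2 / 3 : ℝ) + r ^ 2 := by
  have hp : 0 ≤ r ^ (2 / 3 : ℝ) * x ^ (2 / 3 : ℝ) := by positivity
  have hgeom : (r ^ (2 / 3 : ℝ) * x ^ (2 / 3 : ℝ)) ^ (3 / 4 : ℝ) * (r ^ 2) ^ (1 / 4 : ℝ)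
      = r * √x := by
    rw [Real.mul_rpow (by positivity) (by positivity), ← Real.rpow_mul hr, ← Real.rpow_mul hx,
      ← Real.rpow_natCast, ← Real.rpow_mul hr, mul_right_comm,
      ← Real.rpow_add_of_nonneg hr (by norm_num) (by norm_num), Real.sqrt_eq_rpow]
    norm_num
  have hle := Real.geom_mean_le_arith_mean2_weighted (w₁ := 3 / 4) (w₂ := 1 / 4) (by norm_num)
    (by norm_num) hp (sq_nonneg r) (by norm_num)
  rw [hgeom] at hle
  linarith [sq_nonneg r]

lemma rpow_two_thirds_le_two_mul (hw : 0 ≤ w) (hx : 0 ≤ x) (h : w ≤ 2 * x) :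
    w ^ (2 / 3 : ℝ) ≤ 2 * x ^ (2 / 3 : ℝ) := by
  have htwo : (2 : ℝ) ^ (2 / 3 : ℝ) ≤ 2 ^ (1 : ℝ) :=
    Real.rpow_le_rpow_of_exponent_le one_le_two (by norm_num)
  calc w ^ (2 / 3 : ℝ) ≤ (2 * x) ^ (2 / 3 : ℝ) := Real.rpow_le_rpow hw h (by norm_num)
    _ = 2 ^ (2 / 3 : ℝ) * x ^ (2 / 3 : ℝ) := Real.mul_rpow zero_le_two hx
    _ ≤ 2 * x ^ (2 / 3 : ℝ) := by
      rw [Real.rpow_one] at htwo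
      gcongr

lemma regretPotential_le (hr : 0 ≤ r) (hY : 0 ≤ Y) (hx : 0 ≤ x) :
    regretPotential r Y x ≤ r ^ (2 / 3 : ℝ) * x ^ (2 / 3 : ℝ) + Y := by
  have hmax : max (x - Y) 0 ≤ x := max_le (by linarith) hx
  rw [regretPotential]
  gcongr
  exact min_le_right x Y

/-- The constant `C` of the regret bound `C * R ^ (2 / 3) * OPT ^ (2 / 3) + K`. -/
def regretCoeff (D : ℝ) (ℓ m : ℕ) (ω₀ : ℝ) : ℝ :=
  2 * potentialConst D ℓ m ω₀ + 6 * phaseConst D ℓ m ω₀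

/-- The constant `K` of the regret bound `C * R ^ (2 / 3) * OPT ^ (2 / 3) + K` for the competitive
ratio `R = r` with additive constant `α`. -/
def regretConst (D : ℝ) (ℓ m : ℕ) (ω₀ r ω α : ℝ) : ℝ :=
  potentialConst D ℓ m ω₀ * (r ^ 2 + 2 * r + r * D + α) + 3 * phaseConst D ℓ m ω₀ * ω ^ (2 / 3 : ℝ)

lemma regretCoeff_nonneg (hD : 0 ≤ D) (hω₀ : 0 ≤ ω₀) (hγ : gammaParam D ℓ m ω₀ < 1) :
    0 ≤ regretCoeff D ℓ m ω₀ := by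
  have := potentialConst_nonneg hD hω₀ hγ
  have := phaseConst_nonneg (ℓ := ℓ) (m := m) hD hω₀
  rw [regretCoeff]
  positivity

lemma regretConst_nonneg (hD : 0 ≤ D) (hω₀ : 0 ≤ ω₀) (hγ : gammaParam D ℓ m ω₀ < 1)
    (hr : 0 ≤ r) {ω : ℝ} (hω : 0 ≤ ω) (hα : 0 ≤ α) : 0 ≤ regretConst D ℓ m ω₀ r ω α := by
  have := potentialConst_nonneg hD hω₀ hγ
  have := phaseConst_nonneg (ℓ := ℓ) (m := m) hD hω₀
  rw [regretConst]
  positivity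

lemma costBound_le (hD : 0 ≤ D) (hω₀ : 0 ≤ ω₀) (hγ : gammaParam D ℓ m ω₀ < 1) (hr : 1 ≤ r)
    (hα : 0 ≤ α) (ho : 0 ≤ o) (hox : o ≤ x) (hw₀ : 0 ≤ w) {ω : ℝ} (hω : 0 ≤ ω)
    (hw : w = ω ∨ w ≤ 2 * o) :
    costBound D ℓ m ω₀ r (r * (√(2 + o) + D) + α) x w
      ≤ x + regretCoeff D ℓ m ω₀ * (r ^ (2 / 3 : ℝ) * x ^ (2 / 3 : ℝ))
        + regretConst D ℓ m ω₀ r ω α := by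
  have hx : 0 ≤ x := ho.trans hox
  have hr₀ : 0 ≤ r := zero_le_one.trans hr
  set z := r ^ (2 / 3 : ℝ) * x ^ (2 / 3 : ℝ)
  have hz₀ : 0 ≤ z := by positivity
  have hΦ : regretPotential r (r * (√(2 + o) + D) + α) x ≤ 2 * z + (r ^ 2 + 2 * r + r * D + α) := by
    have hsqrt : √(2 + o) ≤ 2 + √x := by
      rw [Real.sqrt_le_left (by positivity)]
      nlinarith [Real.sq_sqrt hx, Real.sqrt_nonneg x]
    have hle := regretPotential_le hr₀ (Y := r * (√(2 + o) + D) + α) (by positivity) hx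
    linarith [mul_le_mul_of_nonneg_left hsqrt hr₀, mul_sqrt_le hr₀ hx]
  have hguess : w ^ (2 / 3 : ℝ) ≤ ω ^ (2 / 3 : ℝ) + 2 * z := by
    rcases hw with rfl | hw
    · linarith
    · have hxz : x ^ (2 / 3 : ℝ) ≤ z :=
        le_mul_of_one_le_left (by positivity) (Real.one_le_rpow hr (by norm_num))
      have := rpow_two_thirds_le_two_mul hw₀ hx (by linarith)
      linarith [Real.rpow_nonneg hω (2 / 3)]
  have hP := mul_le_mul_of_nonneg_left hΦ (potentialConst_nonneg hD hω₀ hγ)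
  have hQ := mul_le_mul_of_nonneg_left hguess (phaseConst_nonneg (ℓ := ℓ) (m := m) hD hω₀)
  rw [costBound, regretCoeff, regretConst]
  linarith

end RegretBound

section OfflineRPow

variable {M : Type*} [MetricSpace M] {s₀ : M} {c : ℕ → CostFn M} {D : ℝ} {R ω : ℝ≥0}

lemma toReal_offline_mono (hM : ∀ s s' : M, edist s s' ≤ ENNReal.ofReal D)
    (hc : ∀ t, Admissible (c t)) : Monotone fun t => (offline s₀ c t).toReal := fun _ t h =>
  ENNReal.toReal_mono (offline_ne_top hM ENNReal.ofReal_ne_top hc t) (offline_mono h)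

lemma toReal_offline_succ_le (hD : 0 ≤ D) (hM : ∀ s s' : M, edist s s' ≤ ENNReal.ofReal D)
    (hc : ∀ t, Admissible (c t)) (t : ℕ) :
    (offline s₀ c (t + 1)).toReal ≤ (offline s₀ c t).toReal + D := by
  have hne := offline_ne_top (s₀ := s₀) hM ENNReal.ofReal_ne_top hc t
  calc _ ≤ (offline s₀ c t + ENNReal.ofReal D).toReal :=
        ENNReal.toReal_mono (ENNReal.add_ne_top.2 ⟨hne, ENNReal.ofReal_ne_top⟩)
          (offline_succ_le hM hc t)
    _ = _ := by rw [ENNReal.toReal_add hne ENNReal.ofReal_ne_top, ENNReal.toReal_ofReal hD]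

/-- The high-probability bounds on the heuristics are evaluated from the round `τ` on only: they
hold there with high probability in terms of the final offline optimum `OFF`, and the cost paid
before is `O(√OFF)`. -/
lemma exists_offline_sqrt (hD : 0 ≤ D) (hM : ∀ s s' : M, edist s s' ≤ ENNReal.ofReal D)
    (hc : ∀ t, Admissible (c t)) (T : ℕ) :
    ∃ τ, (∀ t, τ ≤ t → 2 + (offline s₀ c T).toReal ≤ (2 + (offline s₀ c t).toReal) ^ 2) ∧
      (offline s₀ c τ).toReal ≤ √(2 + (offline s₀ c T).toReal) + D := by
  classical
  have hnonneg (t : ℕ) : 0 ≤ (offline s₀ c t).toReal := ENNReal.toReal_nonneg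
  have hT : ∃ t, 2 + (offline s₀ c T).toReal ≤ (2 + (offline s₀ c t).toReal) ^ 2 :=
    ⟨T, by nlinarith [hnonneg T]⟩
  refine ⟨Nat.find hT, fun t ht => (Nat.find_spec hT).trans ?_, ?_⟩
  · exact pow_le_pow_left₀ (by linarith [hnonneg (Nat.find hT)])
      (by linarith [show _ ≤ _ from toReal_offline_mono (s₀ := s₀) hM hc ht]) 2
  · rcases h : Nat.find hT with - | k
    · rw [offline_zero, ENNReal.toReal_zero]
      positivity
    · have hk := not_le.1 (Nat.find_min hT (m := k) (by omega))
      have hsqrt : (offline s₀ c k).toReal ≤ √(2 + (offline s₀ c T).toReal) :=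
        Real.le_sqrt_of_sq_le (by nlinarith [hnonneg k])
      linarith [toReal_offline_succ_le (s₀ := s₀) hD hM hc k]

lemma two_add_offline_rpow (hM : ∀ s s' : M, edist s s' ≤ ENNReal.ofReal D)
    (hc : ∀ t, Admissible (c t)) (t : ℕ) (β : ℝ) :
    (2 + offline s₀ c t) ^ β = ENNReal.ofReal ((2 + (offline s₀ c t).toReal) ^ β) := by
  have : 0 ≤ (offline s₀ c t).toReal := ENNReal.toReal_nonneg
  rw [← ENNReal.ofReal_rpow_of_pos (by positivity), ENNReal.ofReal_add zero_le_two this,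
    ENNReal.ofReal_toReal (offline_ne_top hM ENNReal.ofReal_ne_top hc t), ENNReal.ofReal_ofNat]

lemma card_phaseEnds_le_mul (s₀ : M) (hM : ∀ s s' : M, edist s s' ≤ ENNReal.ofReal D)
    (hω : 0 < ω) (hc : ∀ t, Admissible (c t)) (hR : 1 ≤ R) (T : ℕ) :
    ((phaseEnds R ω c T).card : ℝ) ≤ (2 + 2 / ω) * (2 + (offline s₀ c T).toReal) := by
  have : Nonempty M := ⟨s₀⟩
  have hω' : (0 : ℝ) < ω := hω
  have ho : 0 ≤ (offline s₀ c T).toReal := ENNReal.toReal_nonneg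
  have hcard : ((phaseEnds R ω c T).card : ℝ) ≤ (phase R ω c T).1 + 2 := by
    exact_mod_cast card_phaseEnds_le T
  have hguess : ((phase R ω c T).1 : ℝ) * ω ≤ guess R ω c T - ω := by
    have hpow : ((phase R ω c T).1 : ℝ) + 1 ≤ 2 ^ (phase R ω c T).1 := by
      exact_mod_cast Nat.succ_le_of_lt Nat.lt_two_pow_self
    rw [guess]
    linarith [mul_le_mul_of_nonneg_right hpow hω'.le]
  have hphase : ((phase R ω c T).1 : ℝ) ≤ 2 / ω * (offline s₀ c T).toReal := by
    rw [div_mul_eq_mul_div, le_div_iff₀ hω']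
    rcases guess_eq_or_guess_le (R := R) (ω := ω) (s₀ := s₀) hM ENNReal.ofReal_ne_top hc hR
      (t := T) with h | h <;> linarith
  have : 0 ≤ 2 / (ω : ℝ) := by positivity
  linarith

end OfflineRPow

section HighProbability

open MeasureTheory

variable {M : Type*} [MetricSpace M] {s₀ : M} {ℓ : ℕ} [NeZero ℓ] {c : ℕ → CostFn M} {D : ℝ}
  {m : ℕ} {R ω : ℝ≥0} {ω₀ : ℝ} {α : ℝ≥0} {T τ : ℕ}

/-- A factor `2 + OFF` and the exponent `phaseExponent` pay for the union bound over the phases. -/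
def phaseExponent (ω : ℝ) : ℝ :=
  Real.logb 2 (2 + 2 / ω)

lemma phaseExponent_nonneg {ω : ℝ} (hω : 0 ≤ ω) : 0 ≤ phaseExponent ω :=
  Real.logb_nonneg one_lt_two (by linarith [div_nonneg zero_le_two hω])

lemma card_phaseEnds_mul_rpow_le (hM : ∀ s s' : M, edist s s' ≤ ENNReal.ofReal D)
    (hω : 0 < ω) (hc : ∀ t, Admissible (c t)) (hR : 1 ≤ R) (β : ℝ) (T : ℕ) :
    ((phaseEnds R ω c T).card : ℝ)
        * (2 + (offline s₀ c T).toReal) ^ (-(β + 1 + phaseExponent ω))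
      ≤ (2 + (offline s₀ c T).toReal) ^ (-β) := by
  have hcard := card_phaseEnds_le_mul s₀ hM hω hc hR T
  have ho : 0 ≤ (offline s₀ c T).toReal := ENNReal.toReal_nonneg
  set X := 2 + (offline s₀ c T).toReal
  have hX : 0 < X := by positivity
  have hconst : 2 + 2 / (ω : ℝ) ≤ X ^ phaseExponent ω :=
    calc 2 + 2 / (ω : ℝ) = 2 ^ phaseExponent ω :=
          (Real.rpow_logb two_pos (by norm_num) (by positivity)).symm
      _ ≤ X ^ phaseExponent ω :=
        Real.rpow_le_rpow zero_le_two (le_add_of_nonneg_right ho)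
          (phaseExponent_nonneg ω.coe_nonneg)
  calc _ ≤ X ^ phaseExponent ω * X * X ^ (-(β + 1 + phaseExponent ω)) := by
        gcongr
        exact hcard.trans (by gcongr)
    _ = X ^ (-β) := by
      rw [← Real.rpow_add_one hX.ne', ← Real.rpow_add hX]
      congr 1
      ring

lemma measure_biUnion_phaseEnds_le {Ω : Type*} [MeasurableSpace Ω] {P : Measure Ω}
    {A : Ω → OnlineAlg M s₀} (hM : ∀ s s' : M, edist s s' ≤ ENNReal.ofReal D)
    (hω : 0 < ω) (hc : ∀ t, Admissible (c t)) (hR : 1 ≤ R) {β : ℝ} (hβ : 0 ≤ β)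
    (hτ : ∀ t, τ ≤ t → 2 + (offline s₀ c T).toReal ≤ (2 + (offline s₀ c t).toReal) ^ 2)
    (hA : ∀ t, P {w | (R : ℝ≥0∞) * offline s₀ c t + α < (A w).totalCost c t}
      ≤ (2 + offline s₀ c t) ^ (-(2 * (β + 1 + phaseExponent ω)))) :
    P (⋃ t ∈ phaseEnds R ω c T,
        {w | (R : ℝ≥0∞) * offline s₀ c (max t τ) + α < (A w).totalCost c (max t τ)})
      ≤ (2 + offline s₀ c T) ^ (-β) := by
  have ho (t : ℕ) : 0 ≤ (offline s₀ c t).toReal := ENNReal.toReal_nonneg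
  have hfail (t : ℕ) (ht : τ ≤ t) : (2 + offline s₀ c t) ^ (-(2 * (β + 1 + phaseExponent ω)))
      ≤ ENNReal.ofReal ((2 + (offline s₀ c T).toReal) ^ (-(β + 1 + phaseExponent ω))) := by
    have hL := phaseExponent_nonneg ω.coe_nonneg
    rw [two_add_offline_rpow hM hc, ← mul_neg, Real.rpow_mul (by linarith [ho t]), Real.rpow_two]
    exact ENNReal.ofReal_le_ofReal
      (Real.rpow_le_rpow_of_nonpos (by linarith [ho T]) (hτ t ht) (by linarith))
  calc _ ≤ ∑ t ∈ phaseEnds R ω c T, P {w | (R : ℝ≥0∞) * offline s₀ c (max t τ) + α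
          < (A w).totalCost c (max t τ)} := measure_biUnion_finset_le _ _
    _ ≤ ∑ t ∈ phaseEnds R ω c T,
        ENNReal.ofReal ((2 + (offline s₀ c T).toReal) ^ (-(β + 1 + phaseExponent ω))) :=
      Finset.sum_le_sum fun t _ => (hA _).trans (hfail _ (le_max_right t τ))
    _ = ENNReal.ofReal ((phaseEnds R ω c T).card
        * (2 + (offline s₀ c T).toReal) ^ (-(β + 1 + phaseExponent ω))) := by
      rw [Finset.sum_const, nsmul_eq_mul, ENNReal.ofReal_mul (Nat.cast_nonneg _),
        ENNReal.ofReal_natCast]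
    _ ≤ _ := by
      rw [two_add_offline_rpow hM hc]
      exact ENNReal.ofReal_le_ofReal (card_phaseEnds_mul_rpow_le hM hω hc hR β T)

omit [NeZero ℓ] in
lemma toReal_opt_le_of_competitive {H : Fin ℓ → OnlineAlg M s₀} (hD : 0 ≤ D)
    (hM : ∀ s s' : M, edist s s' ≤ ENNReal.ofReal D) (hω₀ : 0 < ω₀) (hω : ω₀ ≤ ω)
    (hR : 1 ≤ R) (hc : ∀ t, Admissible (c t))
    {Z : ℝ} (hZ : (offline s₀ c τ).toReal ≤ Z) {i : Fin ℓ} {t : ℕ}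
    (hi : (H i).totalCost c (max t τ) ≤ (R : ℝ≥0∞) * offline s₀ c (max t τ) + α) :
    (opt H c t).toReal ≤ offlineConst D ω₀ * R ^ 2 * guess R ω c t + (R * Z + α) := by
  have hne := offline_ne_top (s₀ := s₀) hM ENNReal.ofReal_ne_top hc
  have hRo : (R : ℝ≥0∞) * offline s₀ c (max t τ) ≠ ∞ := ENNReal.mul_ne_top (by simp) (hne _)
  have hopt : (opt H c t).toReal ≤ R * (offline s₀ c (max t τ)).toReal + α := by
    have := ENNReal.toReal_mono (ENNReal.add_ne_top.2 ⟨hRo, ENNReal.coe_ne_top⟩)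
      ((opt_mono (le_max_left t τ)).trans ((iInf_le _ i).trans hi))
    rwa [ENNReal.toReal_add hRo ENNReal.coe_ne_top, ENNReal.toReal_mul] at this
  have hmax : (offline s₀ c (max t τ)).toReal ≤ (offline s₀ c t).toReal + Z := by
    rw [(toReal_offline_mono (s₀ := s₀) hM hc).map_max]
    exact max_le (le_add_of_nonneg_right (ENNReal.toReal_nonneg.trans hZ))
      (hZ.trans (le_add_of_nonneg_left ENNReal.toReal_nonneg))
  have hguess := toReal_offline_le_mul_guess (s₀ := s₀) hD hω₀ hω hR hM hc t
  have := R.coe_nonneg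
  calc (opt H c t).toReal ≤ R * ((offline s₀ c t).toReal + Z) + α :=
        hopt.trans (by gcongr)
    _ ≤ R * (2 * (1 + 2 * (D / ω₀)) * (R * guess R ω c t) + Z) + α := by gcongr
    _ = _ := by rw [offlineConst]; ring

lemma ofReal_add_regret {C K x : ℝ} (hC : 0 ≤ C) (hK : 0 ≤ K) (hx : 0 ≤ x) :
    ENNReal.ofReal (x + C * ((R : ℝ) ^ (2 / 3 : ℝ) * x ^ (2 / 3 : ℝ)) + K)
      = ENNReal.ofReal x + (C.toNNReal : ℝ≥0∞) * (R : ℝ≥0∞) ^ (2 / 3 : ℝ)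
        * ENNReal.ofReal x ^ (2 / 3 : ℝ) + (K.toNNReal : ℝ≥0∞) := by
  rw [ENNReal.ofReal_add (by positivity) hK, ENNReal.ofReal_add hx (by positivity),
    ENNReal.ofReal_mul hC, ENNReal.ofReal_mul (by positivity),
    ← ENNReal.ofReal_rpow_of_nonneg R.coe_nonneg (by norm_num),
    ← ENNReal.ofReal_rpow_of_nonneg hx (by norm_num), ENNReal.ofReal_coe_nnreal, mul_assoc]
  rfl

lemma expectedCost_le_of_competitive {H : Fin ℓ → OnlineAlg M s₀} (hD : 0 < D)
    (hM : ∀ s s' : M, edist s s' ≤ ENNReal.ofReal D) (hm : 2 ≤ m) (hω₀ : 0 < ω₀)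
    (hγ : gammaParam D ℓ m ω₀ < 1) (hω : ω₀ ≤ ω) (hR : 1 ≤ R) (hc : ∀ t, Admissible (c t))
    (hH : ∀ i t, 1 ≤ t → (H i).stepCost c t ≤ ENNReal.ofReal (2 * D))
    (hτ : (offline s₀ c τ).toReal ≤ √(2 + (offline s₀ c T).toReal) + D) {i : Fin ℓ}
    (hi : ∀ t ∈ phaseEnds R ω c T, (H i).totalCost c (max t τ)
      ≤ (R : ℝ≥0∞) * offline s₀ c (max t τ) + α) :
    expectedCost D m R ω H c T ≤ opt H c T
      + ((regretCoeff D ℓ m ω₀).toNNReal : ℝ≥0∞) * (R : ℝ≥0∞) ^ (2 / 3 : ℝ)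
        * opt H c T ^ (2 / 3 : ℝ)
      + ((regretConst D ℓ m ω₀ R ω α).toNNReal : ℝ≥0∞) := by
  have hopt := opt_ne_top ENNReal.ofReal_ne_top hH T
  have hR₀ := R.coe_nonneg
  have hα := α.coe_nonneg
  have hω' := ω.coe_nonneg
  have hcost := expectedCost_le_costBound hD hM hm hω₀ hγ hω hc hH hR₀ (by positivity)
    (fun t ht => toReal_opt_le_of_competitive hD.le hM hω₀ hω hR hc hτ (hi t ht))
    (Finset.mem_insert_self T _)
  refine hcost.trans ((ENNReal.ofReal_le_ofReal (costBound_le hD.le hω₀.le hγ (by exact_mod_cast hR)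
    hα ENNReal.toReal_nonneg (ENNReal.toReal_mono hopt (offline_le_opt T))
    (hω'.trans (le_guess T)) hω'
    (guess_eq_or_guess_le hM ENNReal.ofReal_ne_top hc hR))).trans_eq ?_)
  rw [ofReal_add_regret (regretCoeff_nonneg hD.le hω₀.le hγ)
    (regretConst_nonneg hD.le hω₀.le hγ hR₀ hω' hα) ENNReal.toReal_nonneg,
    ENNReal.ofReal_toReal hopt]

lemma measure_regret_lt_expectedCost_le {Ω : Type*} [MeasurableSpace Ω] {P : Measure Ω}
    {H : Fin ℓ → Ω → OnlineAlg M s₀} (hD : 0 < D)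
    (hM : ∀ s s' : M, edist s s' ≤ ENNReal.ofReal D) (hm : 2 ≤ m) (hω₀ : 0 < ω₀)
    (hγ : gammaParam D ℓ m ω₀ < 1) (hω : ω₀ ≤ ω) (hR : 1 ≤ R) (hc : ∀ t, Admissible (c t))
    (hH : ∀ i w t, 1 ≤ t → (H i w).stepCost c t ≤ ENNReal.ofReal (2 * D))
    {β : ℝ} (hβ : 0 ≤ β) {i : Fin ℓ}
    (hi : ∀ t, P {w | (R : ℝ≥0∞) * offline s₀ c t + α < (H i w).totalCost c t}
      ≤ (2 + offline s₀ c t) ^ (-(2 * (β + 1 + phaseExponent ω)))) (T : ℕ) :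
    P {w | opt (fun i => H i w) c T
          + ((regretCoeff D ℓ m ω₀).toNNReal : ℝ≥0∞) * (R : ℝ≥0∞) ^ (2 / 3 : ℝ)
            * opt (fun i => H i w) c T ^ (2 / 3 : ℝ)
          + ((regretConst D ℓ m ω₀ R ω α).toNNReal : ℝ≥0∞)
        < expectedCost D m R ω (fun i => H i w) c T}
      ≤ (2 + offline s₀ c T) ^ (-β) := by
  obtain ⟨τ, hτ, hτT⟩ := exists_offline_sqrt (s₀ := s₀) hD.le hM hc T
  refine (measure_mono fun w hw => ?_).trans
    (measure_biUnion_phaseEnds_le hM (by exact_mod_cast hω₀.trans_le hω) hc hR hβ hτ hi)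
  by_contra hgood
  simp only [Set.mem_iUnion, Set.mem_ofPred_eq, not_exists, not_lt] at hgood
  exact not_lt.2 (expectedCost_le_of_competitive hD hM hm hω₀ hγ hω hR hc (fun i => hH i w) hτT
    hgood) hw

end HighProbability

end MTS

end

theorem mainTheorem7 (D : ℝ) (hD : 0 < D) (ℓ : ℕ) [NeZero ℓ] (m : ℕ) (hm : 2 ≤ m)
    (ω₀ : ℝ≥0) (hω₀ : 0 < ω₀) (hγ : MTS.gammaParam D ℓ m ω₀ < 1) :
    ∃ C : ℝ≥0, ∀ (ω R : ℝ≥0), ω₀ ≤ ω → 1 ≤ R →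
      ∀ (M : Type*) [MetricSpace M] (s₀ : M), (∀ s s' : M, dist s s' ≤ D) →
      ∀ (Ω : Type*) [MeasurableSpace Ω] (P : MeasureTheory.Measure Ω)
        [MeasureTheory.IsProbabilityMeasure P] (H : Fin ℓ → Ω → MTS.OnlineAlg M s₀),
      (∀ (i : Fin ℓ) (w : Ω) (c : ℕ → MTS.CostFn M), (∀ t, MTS.Admissible (c t)) →
        ∀ t, 1 ≤ t → (H i w).stepCost c t ≤ ENNReal.ofReal (2 * D)) →
      (∃ i, MTS.CompetitiveWHP P (H i) R) →
      ∀ β : ℝ, 1 ≤ β → ∃ K : ℝ≥0,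
        ∀ c : ℕ → MTS.CostFn M, (∀ t, MTS.Admissible (c t)) → ∀ T : ℕ,
          P {w | MTS.opt (fun i => H i w) c T
                + C * (R : ℝ≥0∞) ^ (2 / 3 : ℝ) * MTS.opt (fun i => H i w) c T ^ (2 / 3 : ℝ) + K
              < MTS.expectedCost D m R ω (fun i => H i w) c T}
            ≤ (2 + MTS.offline s₀ c T) ^ (-β) := by
  refine ⟨(MTS.regretCoeff D ℓ m ω₀).toNNReal, ?_⟩
  intro ω R hω hR M _ s₀ hM Ω _ P _ H hH ⟨i, hi⟩ β hβ
  have hL := MTS.phaseExponent_nonneg ω.coe_nonneg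
  obtain ⟨α, hα⟩ := hi (2 * (β + 1 + MTS.phaseExponent ω)) (by linarith)
  have hM' (s s' : M) : edist s s' ≤ ENNReal.ofReal D := by
    rw [edist_dist]
    exact ENNReal.ofReal_le_ofReal (hM s s')
  refine ⟨(MTS.regretConst D ℓ m ω₀ R ω α).toNNReal, fun c hc T => ?_⟩
  exact MTS.measure_regret_lt_expectedCost_le hD hM' hm (by exact_mod_cast hω₀) hγ
    (by exact_mod_cast hω) hR hc (fun i w => hH i w c hc) (by linarith)
    (fun t => hα c hc t) T
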